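/- Let $L$ be a finite extension of $\mathbb{Q}_p$ with ring of integers $\mathcal{O}$, uniformizer $\varpi$ and residue field $k=\mathcal{O}/\varpi\mathcal{O}$, and let $G$ be a locally pro-$p$ topological group (for example a $p$-adic analytic group). Let $\mathrm{Mod}^{\mathrm{pro\,aug}}_G(\mathcal{O})$ be the category of profinite augmented $G$-representations over $\mathcal{O}$: its objects are the profinite linearly topological $\mathcal{O}[[H]]$-modules, $H\subseteq G$ a compact open subgroup, with a compatible $\mathcal{O}$-linear action of $G$ by continuous maps (equivalently, the profinite linearly topological $\mathcal{O}$-modules with a continuous $\mathcal{O}$-linear action of $G$), and its morphisms are the continuous $\mathcal{O}$-linear $G$-equivariant maps. Let $\mathfrak{C}(\mathcal{O})$ be a full subcategory of it that is closed under arbitrary direct products and subquotients and in which every object is the projective limit of its quotients of finite length; it is abelian. Let $\mathfrak{C}(k)$ be the full subcategory of objects of $\mathfrak{C}(\mathcal{O})$ killed by $\varpi$. Let $S$ be an irreducible object of $\mathfrak{C}(k)$ with $\mathrm{End}(S)=k$, let $\widetilde{P}\twoheadrightarrow S$ be a projective envelope of $S$ in $\mathfrak{C}(\mathcal{O})$,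 and put $\widetilde{E}=\mathrm{End}_{\mathfrak{C}(\mathcal{O})}(\widetilde{P})$. Let $Q$ be an object of finite length of $\mathfrak{C}(k)$, and let $R=\mathrm{rad}\,Q$ be the intersection of its maximal proper subobjects. Assume: (H0) $\mathrm{Hom}_{\mathfrak{C}(\mathcal{O})}(\widetilde{P}[\varpi],R)=0$, where $\widetilde{P}[\varpi]$ is the kernel of multiplication by $\varpi$ on $\widetilde{P}$; (H1) $\mathrm{Hom}_{\mathfrak{C}(k)}(Q,S')=0$ for every irreducible object $S'\not\cong S$ of $\mathfrak{C}(k)$; (H2) $S$ occurs as a subquotient of $Q$ with multiplicity $1$; (H3) $\mathrm{Ext}^1_{\mathfrak{C}(k)}(Q,S')=0$ for every irreducible object $S'\not\cong S$ of $\mathfrak{C}(k)$; (H4) $\mathrm{Ext}^1_{\mathfrak{C}(k)}(Q,S)$ is finite dimensional over $k$; (H5) $\mathrm{Ext}^2_{\mathfrak{C}(k)}(Q,R)=0$. Let $d=\dim_k\mathrm{Ext}^1_{\mathfrak{C}(k)}(Q,Q)$ (which is then finite) and $r=\lfloor d/2\rfloor$. Suppose that there is a surjective homomorphism of $\mathcal{O}$-algebras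 $\widetilde{E}\twoheadrightarrow\mathcal{O}[[x_1,\ldots,x_d]]$. Suppose further that for every exact sequence $0\to Q^{\oplus r}\to T\to Q\to 0$ in $\mathfrak{C}(k)$ with $\dim_k\mathrm{Hom}_{\mathfrak{C}(k)}(T,S)=1$ one has $$\dim_k\mathrm{Ext}^1_{\mathfrak{C}(k)}(T,S)\le\frac{r(r-1)}{2}+d.$$ Then $\widetilde{E}\cong\mathcal{O}[[x_1,\ldots,x_d]]$ as $\mathcal{O}$-algebras; in particular $\widetilde{E}$ is commutative. -/

import Mathlib

open CategoryTheory Limits Topology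

universe u

/-! ### Profinite augmented representations -/

/-- Profinite augmented `O`-representations of the topological group `G`: compact Hausdorff
`O`-modules whose topology is `O`-linear (the open submodules are a basis at `0`, so the module is
profinite), with a continuous `O`-linear action of `G`.

For a compact open subgroup `H`, such an object is the same thing as a profinite linearly
topological `O[[H]]`-module with a compatible action of `O[G]`: by `exists_open_stable_submodule`
the open `H`-stable `O`-submodules `N` are a basis at `0`, the finite quotients `M / N` are modules
over `(O/I)[H/H']` with `I` an ideal of finite index and `H'` open normal in `H`, and in the limit
this makes `M` a topological `O[[H]]`-module, in a unique way. -/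
structure ProAug (O G : Type u) [CommRing O] [Group G] [TopologicalSpace G] where
  carrier : Type u
  [addCommGroup : AddCommGroup carrier]
  [module : Module O carrier]
  [action : DistribMulAction G carrier]
  [smulComm : SMulCommClass G O carrier]
  [topology : TopologicalSpace carrier]
  [topAddGroup : IsTopologicalAddGroup carrier]
  [compact : CompactSpace carrier]
  [hausdorff : T2Space carrier]
  [linearTopology : IsLinearTopology O carrier]
  [continuousAction : ContinuousSMul G carrier]

namespace ProAug

variable {O G : Type u} [CommRing O] [Group G] [TopologicalSpace G]

instance : CoeSort (ProAug O G) (Type u) := ⟨ProAug.carrier⟩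

attribute [instance] addCommGroup module action smulComm topology topAddGroup compact hausdorff
  linearTopology continuousAction

instance (M : ProAug O G) : ContinuousConstSMul O M := by
  refine ⟨fun a => ?_⟩
  have h0 : Filter.Tendsto (fun x : M => a • x) (𝓝 0) (𝓝 0) := by
    refine (IsLinearTopology.hasBasis_submodule O).tendsto_iff
      (IsLinearTopology.hasBasis_submodule O) |>.2 fun N hN => ⟨N, hN, fun x hx => N.smul_mem a hx⟩
  exact continuous_of_tendsto_nhds_zero (DistribSMul.toAddMonoidHom M a) h0

/-- The open `O`-submodules stable under a compact subgroup `H` form a basis at `0`. -/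
lemma exists_open_stable_submodule (M : ProAug O G) (H : Subgroup G) (hH : IsCompact (H : Set G))
    (U : Set M) (hU : U ∈ 𝓝 (0 : M)) :
    ∃ N : Submodule O M, IsOpen (N : Set M) ∧ (N : Set M) ⊆ U ∧
      ∀ h ∈ H, ∀ x ∈ N, h • x ∈ N := by
  obtain ⟨V, hV, hVU⟩ := (IsLinearTopology.hasBasis_open_submodule O).mem_iff.1 hU
  let N : Submodule O M :=
    { carrier := {x | ∀ h ∈ H, h • x ∈ V}
      add_mem' := fun {x y} hx hy h hh => by
        rw [smul_add]; exact V.add_mem (hx h hh) (hy h hh)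
      zero_mem' := fun h _ => by rw [smul_zero]; exact V.zero_mem
      smul_mem' := fun a x hx h hh => by
        rw [smul_comm]; exact V.smul_mem a (hx h hh) }
  have hopen : IsOpen {q : G × M | q.1 • q.2 ∈ V} :=
    hV.preimage (continuous_fst.smul continuous_snd)
  obtain ⟨A, B, -, hB, hHA, h0B, hAB⟩ := generalized_tube_lemma hH (isCompact_singleton (x := (0 : M)))
    hopen fun q hq => by
      have hx : q.2 = 0 := hq.2
      change q.1 • q.2 ∈ V
      rw [hx, smul_zero]; exact V.zero_mem
  have hBN : B ⊆ (N : Set M) := fun x hx h hh =>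
    hAB (show (h, x) ∈ A ×ˢ B from ⟨hHA hh, hx⟩)
  refine ⟨N, N.toAddSubgroup.isOpen_of_mem_nhds (g := 0) (Filter.mem_of_superset
    (hB.mem_nhds (h0B rfl)) hBN), fun x hx => hVU ?_, fun h hh x hx h' hh' => ?_⟩
  · simpa using hx 1 H.one_mem
  · rw [smul_smul]; exact hx _ (H.mul_mem hh' hh)

/-- Morphisms are the continuous `O`-linear `G`-equivariant maps. -/
@[ext]
structure Hom (M N : ProAug O G) where
  toCLM : M →L[O] N
  map_smul : ∀ (g : G) (x : M), toCLM (g • x) = g • toCLM x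

instance : Category (ProAug O G) where
  Hom := Hom
  id M := ⟨ContinuousLinearMap.id O M, fun _ _ => rfl⟩
  comp f g := ⟨g.toCLM.comp f.toCLM, fun a x => by simp [f.map_smul, g.map_smul]⟩

variable {M N K : ProAug O G}

instance : FunLike (M ⟶ N) M N where
  coe f := f.toCLM
  coe_injective _ _ h := Hom.ext (DFunLike.coe_injective h)

@[ext]
lemma hom_ext {f g : M ⟶ N} (h : ∀ x, f x = g x) : f = g := DFunLike.ext _ _ h

@[simp] lemma id_apply (x : M) : (𝟙 M : M ⟶ M) x = x := rfl
@[simp] lemma comp_apply (f : M ⟶ N) (g : N ⟶ K) (x : M) : (f ≫ g) x = g (f x) := rfl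
lemma map_add' (f : M ⟶ N) (x y : M) : f (x + y) = f x + f y := map_add f.toCLM x y
lemma map_zero' (f : M ⟶ N) : f 0 = 0 := map_zero f.toCLM
lemma map_smulO (f : M ⟶ N) (a : O) (x : M) : f (a • x) = a • f x := map_smul f.toCLM a x
lemma map_smulG (f : M ⟶ N) (g : G) (x : M) : f (g • x) = g • f x := f.map_smul g x
lemma continuous_coe (f : M ⟶ N) : Continuous f := f.toCLM.continuous

instance : Zero (M ⟶ N) := ⟨⟨0, fun g x => by simp⟩⟩
instance : Add (M ⟶ N) :=
  ⟨fun f g => ⟨f.toCLM + g.toCLM, fun a x => by simp [f.map_smul, g.map_smul]⟩⟩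
instance : Neg (M ⟶ N) := ⟨fun f => ⟨-f.toCLM, fun a x => by simp [f.map_smul]⟩⟩
instance : Sub (M ⟶ N) :=
  ⟨fun f g => ⟨f.toCLM - g.toCLM, fun a x => by simp [f.map_smul, g.map_smul, smul_sub]⟩⟩
instance {R : Type*} [Monoid R] [DistribMulAction R N] [SMulCommClass O R N] [SMulCommClass G R N]
    [ContinuousConstSMul R N] : SMul R (M ⟶ N) :=
  ⟨fun c f => ⟨c • f.toCLM, fun a x => by simp [f.map_smul, smul_comm]⟩⟩

lemma toCLM_injective : Function.Injective (fun f : M ⟶ N => f.toCLM) := fun _ _ h => Hom.ext h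

instance : AddCommGroup (M ⟶ N) :=
  toCLM_injective.addCommGroup _ rfl (fun _ _ => rfl) (fun _ => rfl) (fun _ _ => rfl)
    (fun _ _ => rfl) (fun _ _ => rfl)

instance : Module O (M ⟶ N) :=
  toCLM_injective.module O (⟨⟨fun f => f.toCLM, rfl⟩, fun _ _ => rfl⟩ : (M ⟶ N) →+ (M →L[O] N))
    (fun _ _ => rfl)

@[simp] lemma zero_apply (x : M) : (0 : M ⟶ N) x = 0 := rfl
@[simp] lemma add_apply (f g : M ⟶ N) (x : M) : (f + g) x = f x + g x := rfl
@[simp] lemma smul_apply (a : O) (f : M ⟶ N) (x : M) : (a • f) x = a • f x := rfl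

instance : Preadditive (ProAug O G) where
  add_comp _ _ _ f f' g := by ext x; exact map_add' g _ _
  comp_add _ _ _ f g g' := by ext x; rfl

instance : Linear O (ProAug O G) where
  smul_comp _ _ _ a f g := by ext x; exact map_smulO g _ _
  comp_smul _ _ _ f a g := by ext x; rfl


/-! ### Kernels, cokernels and products -/

/-- A closed `G`-stable `O`-submodule, as an object. -/
def ofSubmodule (M : ProAug O G) (U : Submodule O M) (hU : IsClosed (U : Set M))
    (hG : ∀ (g : G), ∀ x ∈ U, g • x ∈ U) : ProAug O G :=
  letI : DistribMulAction G U :=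
    { smul := fun g x => ⟨g • (x : M), hG g x x.2⟩
      one_smul := fun x => Subtype.ext (one_smul G (x : M))
      mul_smul := fun g h x => Subtype.ext (mul_smul g h (x : M))
      smul_zero := fun g => Subtype.ext (smul_zero g)
      smul_add := fun g x y => Subtype.ext (smul_add g (x : M) y) }
  haveI : SMulCommClass G O U := ⟨fun g a x => Subtype.ext (smul_comm g a (x : M))⟩
  haveI : CompactSpace U := isCompact_iff_compactSpace.1 hU.isCompact
  haveI : IsLinearTopology O U := by
    have h : (𝓝 (0 : U)).HasBasis (fun N : Submodule O M => (N : Set M) ∈ 𝓝 0)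
        (fun N => ((N.comap U.subtype : Submodule O U) : Set U)) := by
      rw [nhds_subtype]
      exact (IsLinearTopology.hasBasis_submodule O).comap _
    exact IsLinearTopology.mk_of_hasBasis O h
  haveI : ContinuousSMul G U :=
    ⟨(continuous_fst.smul (continuous_subtype_val.comp continuous_snd)).subtype_mk _⟩
  { carrier := U }

/-- The quotient by a closed `G`-stable `O`-submodule. -/
def quotient (M : ProAug O G) (U : Submodule O M) (hU : IsClosed (U : Set M))
    (hG : ∀ (g : G), ∀ x ∈ U, g • x ∈ U) : ProAug O G :=
  letI : DistribMulAction G (M ⧸ U) :=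
    { smul := fun g => U.mapQ U (DistribSMul.toLinearMap O M g) (hG g)
      one_smul := fun x => by
        obtain ⟨x, rfl⟩ := U.mkQ_surjective x
        exact congrArg U.mkQ (one_smul G x)
      mul_smul := fun g h x => by
        obtain ⟨x, rfl⟩ := U.mkQ_surjective x
        exact congrArg U.mkQ (mul_smul g h x)
      smul_zero := fun g => map_zero (U.mapQ U (DistribSMul.toLinearMap O M g) (hG g))
      smul_add := fun g => map_add (U.mapQ U (DistribSMul.toLinearMap O M g) (hG g)) }
  haveI : SMulCommClass G O (M ⧸ U) :=
    ⟨fun g a x => map_smul (U.mapQ U (DistribSMul.toLinearMap O M g) (hG g)) a x⟩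
  haveI : T2Space (M ⧸ U) :=
    haveI : IsClosed (U.toAddSubgroup : Set M) := hU
    inferInstanceAs (T2Space (M ⧸ U.toAddSubgroup))
  haveI : CompactSpace (M ⧸ U) := inferInstanceAs (CompactSpace (Quotient _))
  have hq : IsOpenQuotientMap U.mkQ := U.isOpenQuotientMap_mkQ
  haveI : IsLinearTopology O (M ⧸ U) := by
    have h : (𝓝 (0 : M ⧸ U)).HasBasis (fun N : Submodule O M => (N : Set M) ∈ 𝓝 0)
        (fun N => ((N.map U.mkQ : Submodule O (M ⧸ U)) : Set (M ⧸ U))) := by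
      have : 𝓝 (0 : M ⧸ U) = Filter.map U.mkQ (𝓝 0) := by
        rw [hq.map_nhds_eq, map_zero]
      rw [this]
      exact (IsLinearTopology.hasBasis_submodule O).map _
    exact IsLinearTopology.mk_of_hasBasis O h
  haveI : ContinuousSMul G (M ⧸ U) := by
    refine ⟨?_⟩
    have h2 : IsOpenQuotientMap (Prod.map (id : G → G) U.mkQ) := IsOpenQuotientMap.id.prodMap hq
    refine h2.isQuotientMap.continuous_iff.2 ?_
    exact hq.continuous.comp (continuous_fst.smul continuous_snd)
  { carrier := M ⧸ U }

/-- Products, with the product topology and the componentwise actions. -/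
def pi {J : Type u} (F : J → ProAug O G) : ProAug O G :=
  haveI : IsLinearTopology O (∀ j, F j) := by
    have h : (𝓝 (0 : ∀ j, F j)).HasBasis
        (fun x : Set J × (∀ j, Submodule O (F j)) =>
          x.1.Finite ∧ ∀ j ∈ x.1, (x.2 j : Set (F j)) ∈ 𝓝 0)
        (fun x => ((Submodule.pi x.1 x.2 : Submodule O (∀ j, F j)) : Set (∀ j, F j))) := by
      rw [nhds_pi]
      exact Filter.hasBasis_pi fun j => IsLinearTopology.hasBasis_submodule O
    exact IsLinearTopology.mk_of_hasBasis O h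
  { carrier := ∀ j, F j }

/-- The projections from the product. -/
def piProj {J : Type u} (F : J → ProAug O G) (j : J) : pi F ⟶ F j :=
  ⟨ContinuousLinearMap.proj (φ := fun j => (F j : Type u)) j, fun _ _ => rfl⟩

/-- The map into the product given by a family of maps. -/
def piLift {J : Type u} (F : J → ProAug O G) {M : ProAug O G} (f : ∀ j, M ⟶ F j) : M ⟶ pi F :=
  ⟨ContinuousLinearMap.pi (φ := fun j => (F j : Type u)) fun j => (f j).toCLM,
    fun g x => funext fun j => map_smulG (f j) g x⟩

instance : HasProducts.{u} (ProAug O G) := fun J => by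
  refine ⟨fun K => ?_⟩
  let F : J → ProAug O G := fun j => K.obj ⟨j⟩
  have : HasLimit (Discrete.functor F) := ⟨⟨⟨Fan.mk (pi F) (piProj F),
    Fan.IsLimit.mk _ (fun s => piLift F s.proj) (fun _ _ => rfl)
      (fun s m h => hom_ext fun x => funext fun j => DFunLike.congr_fun (h j) x)⟩⟩⟩
  exact hasLimit_of_iso (Discrete.natIso fun _ => Iso.refl _ : Discrete.functor F ≅ K)

/-- The inclusion of a closed `G`-stable submodule. -/
def subι (M : ProAug O G) (U : Submodule O M) (hU : IsClosed (U : Set M))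
    (hG : ∀ (g : G), ∀ x ∈ U, g • x ∈ U) : ofSubmodule M U hU hG ⟶ M :=
  ⟨⟨U.subtype, continuous_subtype_val⟩, fun _ _ => rfl⟩

/-- The projection onto the quotient by a closed `G`-stable submodule. -/
def quotientπ (M : ProAug O G) (U : Submodule O M) (hU : IsClosed (U : Set M))
    (hG : ∀ (g : G), ∀ x ∈ U, g • x ∈ U) : M ⟶ quotient M U hU hG :=
  ⟨⟨U.mkQ, U.isOpenQuotientMap_mkQ.continuous⟩, fun _ _ => rfl⟩

lemma subι_injective (M : ProAug O G) (U : Submodule O M) (hU hG) :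
    Function.Injective (subι M U hU hG) := Subtype.val_injective

lemma quotientπ_surjective (M : ProAug O G) (U : Submodule O M) (hU hG) :
    Function.Surjective (quotientπ M U hU hG) := U.mkQ_surjective

/-- Every map whose image lies in that of an injective map `i` factors through `i`. -/
lemma exists_lift (i : M ⟶ N) (hi : Function.Injective i) (f : K ⟶ N)
    (hf : ∀ x, f x ∈ Set.range i) : ∃ l : K ⟶ M, l ≫ i = f := by
  have hemb : IsClosedEmbedding i :=
    IsClosedEmbedding.of_continuous_injective_isClosedMap (continuous_coe i) hi
      (continuous_coe i).isClosedMap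
  choose l hl using hf
  refine ⟨⟨⟨⟨⟨l, fun x y => hi ?_⟩, fun a x => hi ?_⟩, ?_⟩, fun g x => hi ?_⟩, hom_ext hl⟩
  · rw [map_add', hl, hl, hl, map_add']
  · simp only [RingHom.id_apply]
    rw [map_smulO, hl, hl, map_smulO]
  · refine hemb.isEmbedding.continuous_iff.2 ?_
    exact (continuous_coe f).congr fun x => (hl x).symm
  · change i (l (g • x)) = i (g • l x)
    rw [map_smulG, hl, hl, map_smulG]

/-- Every map which kills the kernel of a surjective map `q` factors through `q`. -/
lemma exists_desc (q : M ⟶ N) (hq : Function.Surjective q) (f : M ⟶ K)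
    (hf : ∀ x, q x = 0 → f x = 0) : ∃ l : N ⟶ K, q ≫ l = f := by
  have hquot : IsQuotientMap q :=
    (continuous_coe q).isClosedMap.isQuotientMap (continuous_coe q) hq
  have key : ∀ x y, q x = q y → f x = f y := fun x y h => by
    have h1 : q (x - y) = 0 := by
      have := map_sub q.toCLM x y
      exact this.trans (sub_eq_zero.2 h)
    have h2 : f x - f y = 0 := (map_sub f.toCLM x y).symm.trans (hf _ h1)
    exact sub_eq_zero.1 h2
  obtain ⟨s, hs⟩ := hq.hasRightInverse
  have hl : ∀ x, f (s (q x)) = f x := fun x => key _ _ (hs _)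
  refine ⟨⟨⟨⟨⟨fun y => f (s y), ?_⟩, ?_⟩, ?_⟩, ?_⟩, hom_ext hl⟩
  · intro x y
    obtain ⟨x, rfl⟩ := hq x
    obtain ⟨y, rfl⟩ := hq y
    rw [← map_add', hl, hl, hl, map_add']
  · intro a x
    obtain ⟨x, rfl⟩ := hq x
    simp only [RingHom.id_apply]
    rw [← map_smulO, hl, hl, map_smulO]
  · refine hquot.continuous_iff.2 ?_
    exact (continuous_coe f).congr fun x => (hl x).symm
  · intro g x
    obtain ⟨x, rfl⟩ := hq x
    change f (s (g • q x)) = g • f (s (q x))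
    rw [← map_smulG, hl, hl, map_smulG]

/-- The kernel of a morphism. -/
def ker (f : M ⟶ N) : ProAug O G :=
  ofSubmodule M (LinearMap.ker f.toCLM.toLinearMap)
    (isClosed_singleton.preimage (continuous_coe f) : IsClosed (f ⁻¹' {0})) fun g x hx => by
      have hx : f x = 0 := hx
      change f (g • x) = 0
      rw [map_smulG, hx, smul_zero]

/-- The inclusion of the kernel. -/
def kerι (f : M ⟶ N) : ker f ⟶ M := subι M _ _ _

/-- The cokernel of a morphism. -/
def coker (f : M ⟶ N) : ProAug O G :=
  quotient N (LinearMap.range f.toCLM.toLinearMap)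
    (isCompact_range (continuous_coe f)).isClosed fun g x hx => by
      obtain ⟨y, rfl⟩ := hx
      exact ⟨g • y, map_smulG f g y⟩

/-- The projection onto the cokernel. -/
def cokerπ (f : M ⟶ N) : N ⟶ coker f := quotientπ N _ _ _

lemma kerι_injective (f : M ⟶ N) : Function.Injective (kerι f) := subι_injective _ _ _ _

lemma cokerπ_surjective (f : M ⟶ N) : Function.Surjective (cokerπ f) :=
  quotientπ_surjective _ _ _ _

lemma mem_range_kerι (f : M ⟶ N) (x : M) : x ∈ Set.range (kerι f) ↔ f x = 0 :=
  ⟨by rintro ⟨y, rfl⟩; exact y.2, fun h => ⟨⟨x, h⟩, rfl⟩⟩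

lemma cokerπ_eq_zero (f : M ⟶ N) (x : N) : cokerπ f x = 0 ↔ x ∈ Set.range f :=
  (Submodule.Quotient.mk_eq_zero _).trans Iff.rfl

lemma mono_of_injective (f : M ⟶ N) (hf : Function.Injective f) : Mono f :=
  ⟨fun a b h => hom_ext fun x => hf (by rw [← comp_apply, h, comp_apply])⟩

lemma epi_of_surjective (f : M ⟶ N) (hf : Function.Surjective f) : Epi f :=
  ⟨fun a b h => hom_ext fun x => by
    obtain ⟨y, rfl⟩ := hf x
    rw [← comp_apply, h, comp_apply]⟩

lemma injective_of_mono (f : M ⟶ N) [Mono f] : Function.Injective f := by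
  have h : kerι f = 0 := by
    rw [← cancel_mono f]
    ext x
    exact ((mem_range_kerι f _).1 ⟨x, rfl⟩).trans (map_zero' f).symm
  refine (injective_iff_map_eq_zero f.toCLM).2 fun x hx => ?_
  obtain ⟨y, rfl⟩ := (mem_range_kerι f x).2 hx
  rw [h]; rfl

lemma surjective_of_epi (f : M ⟶ N) [Epi f] : Function.Surjective f := by
  have h : cokerπ f = 0 := by
    rw [← cancel_epi f]
    ext x
    exact (cokerπ_eq_zero f _).2 ⟨x, rfl⟩
  intro x
  exact (cokerπ_eq_zero f x).1 (by rw [h]; rfl)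

lemma mono_iff_injective (f : M ⟶ N) : Mono f ↔ Function.Injective f :=
  ⟨fun _ => injective_of_mono f, mono_of_injective f⟩

lemma epi_iff_surjective (f : M ⟶ N) : Epi f ↔ Function.Surjective f :=
  ⟨fun _ => surjective_of_epi f, epi_of_surjective f⟩

/-- A monomorphism with image the kernel of `f` is a kernel of `f`. -/
lemma exists_isLimit (i : K ⟶ M) (f : M ⟶ N) (hi : Function.Injective i)
    (hf : ∀ x, x ∈ Set.range i ↔ f x = 0) (w : i ≫ f = 0) :
    Nonempty (IsLimit (KernelFork.ofι i w)) := by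
  have := mono_of_injective i hi
  have h : ∀ {W : ProAug O G} (k : W ⟶ M), k ≫ f = 0 → ∃ l : W ⟶ K, l ≫ i = k := fun k hk =>
    exists_lift i hi k fun x => (hf _).2 (by rw [← comp_apply, hk, zero_apply])
  exact ⟨KernelFork.IsLimit.ofι' i w fun k hk => ⟨(h k hk).choose, (h k hk).choose_spec⟩⟩

/-- An epimorphism with kernel the image of `f` is a cokernel of `f`. -/
lemma exists_isColimit (f : K ⟶ M) (q : M ⟶ N) (hq : Function.Surjective q)
    (hf : ∀ x, q x = 0 ↔ x ∈ Set.range f) (w : f ≫ q = 0) :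
    Nonempty (IsColimit (CokernelCofork.ofπ q w)) := by
  have := epi_of_surjective q hq
  have h : ∀ {W : ProAug O G} (k : M ⟶ W), f ≫ k = 0 → ∃ l : N ⟶ W, q ≫ l = k := fun k hk =>
    exists_desc q hq k fun x hx => by
      obtain ⟨y, rfl⟩ := (hf x).1 hx
      rw [← comp_apply, hk, zero_apply]
  exact ⟨CokernelCofork.IsColimit.ofπ' q w fun k hk => ⟨(h k hk).choose, (h k hk).choose_spec⟩⟩

instance : HasKernels (ProAug O G) where
  has_limit f := by
    have w : kerι f ≫ f = 0 := hom_ext fun x => (mem_range_kerι f _).1 ⟨x, rfl⟩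
    exact ⟨⟨⟨_, (exists_isLimit (kerι f) f (kerι_injective f) (mem_range_kerι f) w).some⟩⟩⟩

instance : HasCokernels (ProAug O G) where
  has_colimit f := by
    have w : f ≫ cokerπ f = 0 := hom_ext fun x => (cokerπ_eq_zero f _).2 ⟨x, rfl⟩
    exact ⟨⟨⟨_, (exists_isColimit f (cokerπ f) (cokerπ_surjective f) (cokerπ_eq_zero f) w).some⟩⟩⟩

instance : IsNormalMonoCategory (ProAug O G) where
  normalMonoOfMono f _ := by
    have w : f ≫ cokerπ f = 0 := hom_ext fun x => (cokerπ_eq_zero f _).2 ⟨x, rfl⟩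
    exact ⟨⟨_, cokerπ f, w, (exists_isLimit f (cokerπ f) (injective_of_mono f)
      (fun x => (cokerπ_eq_zero f x).symm) w).some⟩⟩

instance : IsNormalEpiCategory (ProAug O G) where
  normalEpiOfEpi f _ := by
    have w : kerι f ≫ f = 0 := hom_ext fun x => (mem_range_kerι f _).1 ⟨x, rfl⟩
    exact ⟨⟨_, kerι f, w, (exists_isColimit (kerι f) f (surjective_of_epi f)
      (fun x => (mem_range_kerι f x).symm) w).some⟩⟩

instance : HasFiniteProducts (ProAug O G) :=
  hasFiniteProducts_of_hasProducts _

instance : Abelian (ProAug O G) where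

end ProAug

/-! ### Pro-`p` groups -/

/-- A pro-`p` group: a profinite group all of whose finite continuous quotients are `p`-groups. -/
structure IsProP (p : ℕ) (H : Type*) [Group H] [TopologicalSpace H] : Prop where
  topGroup : IsTopologicalGroup H
  compact : CompactSpace H
  hausdorff : T2Space H
  totallyDisconnected : TotallyDisconnectedSpace H
  isPGroup : ∀ (N : Subgroup H) [N.Normal], IsOpen (N : Set H) → IsPGroup p (H ⧸ N)

/-- A locally pro-`p` group: it has an open pro-`p` subgroup. -/
def IsLocallyProP (p : ℕ) (G : Type*) [Group G] [TopologicalSpace G] : Prop :=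
  ∃ H : Subgroup G, IsOpen (H : Set G) ∧ IsProP p H

/-! ### Notions for objects of a category -/

section General

variable {C : Type*} [Category* C]

/-- Objects of finite length: both chain conditions hold for subobjects. -/
def IsFiniteLengthObject (X : C) : Prop := IsNoetherianObject X ∧ IsArtinianObject X

/-- `q : X ⟶ Y` is a projective envelope: an essential epimorphism from a projective object. -/
structure IsProjectiveEnvelope {X Y : C} (q : X ⟶ Y) : Prop where
  projective : Projective X
  epi : Epi q
  essential : ∀ {W : C} (s : W ⟶ X), Epi (s ≫ q) → Epi s

/-- `R = rad X`, the intersection of all maximal proper subobjects of `X`. -/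
def IsRadicalOf {X : C} (R : Subobject X) : Prop :=
  IsGLB {M : Subobject X | IsCoatom M} R

/-- `HasMultiplicity S Y n`: the object `Y` has a finite composition series in which exactly `n`
factors are isomorphic to `S`. -/
inductive HasMultiplicity [HasZeroMorphisms C] (S : C) : C → ℕ → Prop
  | zero {X : C} (hX : IsZero X) : HasMultiplicity S X 0
  | cons_iso {X Y Z : C} (i : X ⟶ Y) (q : Y ⟶ Z) (w : i ≫ q = 0)
      (h : (ShortComplex.mk i q w).ShortExact) (hZ : Simple Z) (e : Nonempty (Z ≅ S))
      {n : ℕ} (hX : HasMultiplicity S X n) : HasMultiplicity S Y (n + 1)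
  | cons_not_iso {X Y Z : C} (i : X ⟶ Y) (q : Y ⟶ Z) (w : i ≫ q = 0)
      (h : (ShortComplex.mk i q w).ShortExact) (hZ : Simple Z) (e : IsEmpty (Z ≅ S))
      {n : ℕ} (hX : HasMultiplicity S X n) : HasMultiplicity S Y n

end General

/-! ### The categories `C(O)` and `C(k)` -/

section DualCat

variable {O G : Type u} [CommRing O] [Group G] [TopologicalSpace G]

/-- The finite length quotients of `M`, as objects under `M`. -/
def finLenQuotients (M : ProAug O G) : ObjectProperty (Under M) :=
  fun q => Epi q.hom ∧ IsFiniteLengthObject q.right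

/-- The canonical cone with vertex `M` over the diagram of all finite length quotients of `M`. -/
def finLenCone (M : ProAug O G) : Cone ((finLenQuotients M).ι ⋙ Under.forget M) where
  pt := M
  π := { app := fun q => q.obj.hom
         naturality := fun q q' f => by simp }

/-- The conditions on a full subcategory `C(O)` of the category of profinite augmented
representations: it is closed under subquotients and arbitrary direct products, and each of its
objects is the limit of its quotients of finite length. -/
class IsDualCat (P : ObjectProperty (ProAug O G)) : Prop where
  subobjects : P.IsClosedUnderSubobjects
  quotients : P.IsClosedUnderQuotients
  products : ∀ J : Type u, P.IsClosedUnderLimitsOfShape (Discrete J)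
  isLimit : ∀ M, P M → Nonempty (IsLimit (finLenCone M))

/-- The objects of the subcategory which are killed by `a`. -/
def killedBy (P : ObjectProperty (ProAug O G)) (a : O) : ObjectProperty (ProAug O G) :=
  fun M => P M ∧ ∀ x : M, a • x = 0

variable (P : ObjectProperty (ProAug O G))

attribute [instance] IsDualCat.subobjects IsDualCat.quotients IsDualCat.products

instance [IsDualCat P] : P.IsClosedUnderFiniteProducts :=
  .of_isClosedUnderLimitsOfShape fun J _ => IsDualCat.products J

instance [IsDualCat P] : P.ContainsZero where
  exists_zero := by
    let F : PEmpty.{u + 1} → ProAug O G := PEmpty.elim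
    refine ⟨∏ᶜ F, (IsZero.iff_id_eq_zero _).2 ?_, P.prop_pi F fun j => j.elim⟩
    exact Pi.hom_ext _ _ fun j => j.elim

/-- The category `C(O)`. -/
abbrev DualCat : Type (u + 1) := P.FullSubcategory

/-- The category `C(k)`, for `k = O/(a)`: the objects of `C(O)` killed by `a`. -/
abbrev DualCatMod (a : O) : Type (u + 1) := (killedBy P a).FullSubcategory

/-- The inclusion of `C(k)` into `C(O)`. -/
abbrev DualCatMod.incl (a : O) : DualCatMod P a ⥤ DualCat P :=
  ObjectProperty.ιOfLE fun _ h => h.1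

noncomputable instance [IsDualCat P] : Abelian P.FullSubcategory := inferInstance

instance [IsDualCat P] : HasFiniteBiproducts P.FullSubcategory := Abelian.hasFiniteBiproducts

instance (a : O) [IsDualCat P] : IsDualCat (killedBy P a) where
  subobjects := ⟨fun {X Y} f _ h => ⟨P.prop_of_mono f h.1, fun x =>
    ProAug.injective_of_mono f (by rw [ProAug.map_smulO, h.2, ProAug.map_zero'])⟩⟩
  quotients := ⟨fun {X Y} f _ h => ⟨P.prop_of_epi f h.1, fun x => by
    obtain ⟨y, rfl⟩ := ProAug.surjective_of_epi f x
    rw [← ProAug.map_smulO, h.2, ProAug.map_zero']⟩⟩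
  products J := ⟨fun X => by
    rintro ⟨h⟩
    refine ⟨P.prop_of_isLimit h.isLimit fun j => (h.prop_diag_obj j).1, fun x => ?_⟩
    have : a • 𝟙 X = 0 := h.isLimit.hom_ext fun j => by
      ext y
      change h.π.app j (a • y) = h.π.app j 0
      rw [ProAug.map_smulO, (h.prop_diag_obj j).2, ProAug.map_zero']
    exact DFunLike.congr_fun this x⟩
  isLimit M hM := IsDualCat.isLimit M hM.1

/-- The groups of homomorphisms in `C(k)` are `k`-vector spaces. -/
instance (a : O) (M N : (killedBy P a).FullSubcategory) :
    Module (O ⧸ Ideal.span {a}) (M ⟶ N) :=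
  Module.IsTorsionBySet.module (R := O) (M := (M ⟶ N)) (I := Ideal.span {a}) <| by
    rw [Module.isTorsionBySet_span_singleton_iff]
    intro f
    ext x
    exact N.property.2 _

noncomputable instance (a : O) : Linear (O ⧸ Ideal.span {a}) (killedBy P a).FullSubcategory where
  smul_comp _ _ _ r f g := by
    obtain ⟨r, rfl⟩ := Ideal.Quotient.mk_surjective r
    exact Linear.smul_comp _ _ _ r f g
  comp_smul _ _ _ f r g := by
    obtain ⟨r, rfl⟩ := Ideal.Quotient.mk_surjective r
    exact Linear.comp_smul _ _ _ f r g

/-- The Ext groups in these categories exist, in the universe `u + 1`. -/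
instance [IsDualCat P] : HasExt.{u+1} P.FullSubcategory := HasExt.standard _

end DualCat

/-! Write A for the reduction of `Pt` modulo ϖ. Since `Pt` is projective, End(A) = End(Pt)/ϖ, so a
surjection φ onto O[[x]] induces a surjection End(A) → k[[x]]. If the latter is injective, every
element of ker φ is ϖ times an element of ker φ, because O[[x]] has no ϖ-torsion. Such an element is
divisible by all powers of ϖ and vanishes by passing to finite length quotients
(`DualCatMod.injective_of_injective_red`). It remains to treat A over k
(`IsFlatFibre.injective_of_surjective`).

Multiplicity one makes Hom(A, Q) a line spanned by a surjection π; let N = ker π. By (H3) every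
simple quotient of N is S, and (H5) shifts to Ext¹(N, R) = 0. Hence there are d endomorphisms `f i`
whose images add up to N, they generate the kernel of the residue character End(A) → k as a right
ideal, and ∑ `f i` (`p i`) = 0 with `p i` in A forces π(`p i`) = 0. This is the trace of flatness
that the proof needs (`isFlatFibre`, `IsFlatFibre.IsDualGen.π_eq_zero`). The number of generators is
dim Hom(N, S) = dim Ext¹(Q, S) = dim Ext¹(Q, Q).

The core is that the `f i` commute up to order three. Let `relForms` be the annihilator of the
residues of all relations ∑ `f i * f j * h i j` = 0. It contains the symmetric matrices, since x_i
x_j = x_j x_i are the only quadratic relations in k[[x]]. Suppose it contains a non-symmetric b. The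
alternating form b - bᵀ vanishes on a subspace of dimension d - r; in an adapted basis I₁ ⊔ I₂, with
I₂ spanning that subspace, subtracting a symmetric matrix makes the rows of b in I₂ zero. Together
with the symmetric matrices on I₁ this gives r(r+1)/2 + 1 independent forms with zero rows in I₂.
Let T be the quotient of A by the images of the `f i`, i ∈ I₂, and of all products `f i * f j`; it
is an extension of Q by Q^r. Those forms, and one functional for each i ∈ I₂, define independent
elements of Ext¹(T, S), so its dimension is at least (d - r) + r(r+1)/2 + 1 = r(r-1)/2 + d + 1,
against the assumed bound (`isSymm_of_finrank_le`, `IsFlatFibre.IsDualGen.le_finrank_hom`).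

Once the generators commute up to order three, monomials in a fixed order span the graded pieces of
End(A), and their images in k[[x]] are independent. So the kernel lies in every power of the ideal,
and these powers meet in 0 by a Nakayama argument on finite length quotients of A. -/

set_option linter.unusedSectionVars false

/-! ### Closed stable submodules and chain conditions -/

namespace ProAug

variable {O G : Type u} [CommRing O] [Group G] [TopologicalSpace G]

/-- Closed `G`-stable `O`-submodules. -/
structure Sub (M : ProAug O G) where
  toSubmodule : Submodule O M
  isClosed : IsClosed (toSubmodule : Set M)
  smul_mem : ∀ (g : G), ∀ x ∈ toSubmodule, g • x ∈ toSubmodule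

namespace Sub

variable {M N : ProAug O G}

instance : Membership (M : Type u) (Sub M) := ⟨fun U x => x ∈ U.toSubmodule⟩

instance : PartialOrder (Sub M) :=
  PartialOrder.lift toSubmodule fun U V h => by cases U; cases V; congr

@[ext]
lemma ext {U V : Sub M} (h : ∀ x : M, x ∈ U ↔ x ∈ V) : U = V :=
  le_antisymm (fun x hx => (h x).1 hx) fun x hx => (h x).2 hx

/-- The inclusion of a closed stable submodule, as a map in the ambient category. -/
abbrev incl (U : Sub M) : ofSubmodule M U.toSubmodule U.isClosed U.smul_mem ⟶ M :=
  subι M U.toSubmodule U.isClosed U.smul_mem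

/-- The range of a morphism. -/
def range (f : M ⟶ N) : Sub N where
  toSubmodule := LinearMap.range f.toCLM.toLinearMap
  isClosed := (isCompact_range (continuous_coe f)).isClosed
  smul_mem g x hx := by
    obtain ⟨y, rfl⟩ := hx
    exact ⟨g • y, map_smulG f g y⟩

/-- The preimage of a closed stable submodule. -/
def comap (f : M ⟶ N) (U : Sub N) : Sub M where
  toSubmodule := U.toSubmodule.comap f.toCLM.toLinearMap
  isClosed := U.isClosed.preimage (continuous_coe f)
  smul_mem g x hx := by
    change f (g • x) ∈ U.toSubmodule
    rw [map_smulG]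
    exact U.smul_mem g _ hx

lemma mem_comap {f : M ⟶ N} {U : Sub N} {x : M} : x ∈ comap f U ↔ f x ∈ U := Iff.rfl

instance : Bot (Sub M) where
  bot :=
    { toSubmodule := ⊥
      isClosed := isClosed_singleton
      smul_mem := fun g x hx => by
        rw [Submodule.mem_bot] at hx ⊢
        rw [hx, smul_zero] }

lemma mem_bot {x : M} : x ∈ (⊥ : Sub M) ↔ x = 0 := Submodule.mem_bot O

instance : Top (Sub M) where
  top :=
    { toSubmodule := ⊤
      isClosed := isClosed_univ
      smul_mem := fun _ _ _ => Submodule.mem_top }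

lemma mem_top {x : M} : x ∈ (⊤ : Sub M) := Submodule.mem_top

instance : InfSet (Sub M) where
  sInf s :=
    { toSubmodule := sInf (toSubmodule '' s)
      isClosed := by
        rw [Submodule.coe_sInf]
        refine isClosed_biInter fun V hV => ?_
        obtain ⟨U, -, rfl⟩ := hV
        exact U.isClosed
      smul_mem := fun g x hx => by
        rw [Submodule.mem_sInf] at hx ⊢
        rintro V ⟨U, hU, rfl⟩
        exact U.smul_mem g x (hx _ ⟨U, hU, rfl⟩) }

lemma mem_sInf {s : Set (Sub M)} {x : M} : x ∈ sInf s ↔ ∀ U ∈ s, x ∈ U := by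
  change x ∈ sInf (toSubmodule '' s) ↔ _
  rw [Submodule.mem_sInf]
  exact Set.forall_mem_image

instance (U : Sub M) : Mono U.incl := mono_of_injective _ (subι_injective _ _ _ _)

/-- A closed stable submodule, as a subobject. -/
noncomputable def toSubobject : Sub M ↪o Subobject M :=
  OrderEmbedding.ofMapLEIff (fun U => Subobject.mk U.incl) fun U V => by
    refine ⟨fun h x hx => ?_, fun h => ?_⟩
    · have := DFunLike.congr_fun (Subobject.ofMkLEMk_comp h) (⟨x, hx⟩ : U.toSubmodule)
      have h2 : (V.incl (Subobject.ofMkLEMk _ _ h (⟨x, hx⟩ : U.toSubmodule)) : M) = x := this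
      rw [← h2]
      exact Subtype.prop (Subobject.ofMkLEMk _ _ h (⟨x, hx⟩ : U.toSubmodule))
    · obtain ⟨l, hl⟩ := exists_lift V.incl (subι_injective _ _ _ _) U.incl
        fun x => ⟨⟨x.1, h x.2⟩, rfl⟩
      exact Subobject.mk_le_mk_of_comm l hl

lemma wellFoundedGT [IsNoetherianObject M] : WellFoundedGT (Sub M) :=
  (toSubobject (M := M)).strictMono.wellFoundedGT

lemma wellFoundedLT [IsArtinianObject M] : WellFoundedLT (Sub M) :=
  (toSubobject (M := M)).strictMono.wellFoundedLT

end Sub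

end ProAug

/-! ### Elements, kernels and quotients in the full subcategories -/

section Concrete

variable {O G : Type u} [CommRing O] [Group G] [TopologicalSpace G]
  {P : ObjectProperty (ProAug O G)}

namespace DualCat

variable {X Y Z : P.FullSubcategory}

/-- Evaluation of morphisms at an element. -/
def ev (Y : P.FullSubcategory) (x : X.obj) : (X ⟶ Y) →ₗ[O] Y.obj where
  toFun f := f.hom x
  map_add' _ _ := rfl
  map_smul' _ _ := rfl

protected lemma ext_iff {f g : X ⟶ Y} : f = g ↔ ∀ x, f.hom x = g.hom x :=
  ⟨fun h x => by rw [h], fun h => ObjectProperty.hom_ext _ (ProAug.hom_ext h)⟩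

protected lemma ext {f g : X ⟶ Y} (h : ∀ x, f.hom x = g.hom x) : f = g := DualCat.ext_iff.2 h

@[simp] protected lemma comp_apply (f : X ⟶ Y) (g : Y ⟶ Z) (x : X.obj) :
    (f ≫ g).hom x = g.hom (f.hom x) := rfl
@[simp] lemma id_apply (x : X.obj) : InducedCategory.Hom.hom (𝟙 X) x = x := rfl
@[simp] lemma zero_apply (x : X.obj) : (0 : X ⟶ Y).hom x = 0 := rfl
@[simp] lemma sum_apply {J : Type*} (s : Finset J) (f : J → (X ⟶ Y)) (x : X.obj) :
    (∑ j ∈ s, f j).hom x = ∑ j ∈ s, (f j).hom x := _root_.map_sum (ev Y x) f s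

/-- A morphism, as a linear map. -/
def toLin (f : X ⟶ Y) : X.obj →ₗ[O] Y.obj := f.hom.toCLM.toLinearMap

@[simp] protected lemma map_zero (f : X ⟶ Y) : f.hom 0 = 0 := _root_.map_zero (toLin f)
protected lemma map_add (f : X ⟶ Y) (x y : X.obj) : f.hom (x + y) = f.hom x + f.hom y :=
  _root_.map_add (toLin f) x y
protected lemma map_sub (f : X ⟶ Y) (x y : X.obj) : f.hom (x - y) = f.hom x - f.hom y :=
  _root_.map_sub (toLin f) x y
protected lemma map_neg (f : X ⟶ Y) (x : X.obj) : f.hom (-x) = -f.hom x := _root_.map_neg (toLin f) x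
protected lemma map_sum {J : Type*} (f : X ⟶ Y) (s : Finset J) (x : J → X.obj) :
    f.hom (∑ j ∈ s, x j) = ∑ j ∈ s, f.hom (x j) := _root_.map_sum (toLin f) x s
protected lemma map_smul (f : X ⟶ Y) (a : O) (x : X.obj) : f.hom (a • x) = a • f.hom x :=
  _root_.map_smul (toLin f) a x

lemma exists_desc (q : X ⟶ Y) (hq : Function.Surjective q.hom) (f : X ⟶ Z)
    (hf : ∀ x, q.hom x = 0 → f.hom x = 0) : ∃ l : Y ⟶ Z, q ≫ l = f := by
  obtain ⟨l, hl⟩ := ProAug.exists_desc q.hom hq f.hom hf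
  exact ⟨ObjectProperty.homMk l, ObjectProperty.hom_ext _ hl⟩

lemma exists_lift (i : X ⟶ Y) (hi : Function.Injective i.hom) (f : Z ⟶ Y)
    (hf : ∀ z, ∃ x, i.hom x = f.hom z) : ∃ l : Z ⟶ X, l ≫ i = f := by
  obtain ⟨l, hl⟩ := ProAug.exists_lift i.hom hi f.hom hf
  exact ⟨ObjectProperty.homMk l, ObjectProperty.hom_ext _ hl⟩

lemma mono_of_injective (f : X ⟶ Y) (hf : Function.Injective f.hom) : Mono f :=
  ⟨fun a b h => DualCat.ext fun x => hf (by rw [← DualCat.comp_apply, h, DualCat.comp_apply])⟩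

lemma epi_of_surjective (f : X ⟶ Y) (hf : Function.Surjective f.hom) : Epi f :=
  ⟨fun a b h => DualCat.ext fun x => by
    obtain ⟨y, rfl⟩ := hf x
    rw [← DualCat.comp_apply, h, DualCat.comp_apply]⟩

/-- The kernel of a morphism. -/
abbrev kerSub (f : X ⟶ Y) : X.obj.Sub := ProAug.Sub.comap f.hom ⊥

lemma mem_kerSub {f : X ⟶ Y} {x : X.obj} : x ∈ kerSub f ↔ f.hom x = 0 := Submodule.mem_bot O

lemma injective_of_eq_zero (f : X ⟶ Y) (hf : ∀ x, f.hom x = 0 → x = 0) :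
    Function.Injective f.hom :=
  (injective_iff_map_eq_zero (toLin f)).2 hf

lemma exists_ne_zero_of_hom_ne_zero {f : X ⟶ Y} (hf : f ≠ 0) : ∃ x, f.hom x ≠ 0 := by
  by_contra! h
  exact hf (DualCat.ext h)

variable [IsDualCat P]

/-- A closed stable submodule, as an object. -/
def sub (X : P.FullSubcategory) (U : X.obj.Sub) : P.FullSubcategory :=
  ⟨ProAug.ofSubmodule X.obj U.toSubmodule U.isClosed U.smul_mem,
    P.prop_of_mono U.incl X.property⟩

/-- The inclusion of a closed stable submodule. -/
def incl (X : P.FullSubcategory) (U : X.obj.Sub) : sub X U ⟶ X :=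
  ObjectProperty.homMk U.incl

lemma incl_injective (U : X.obj.Sub) : Function.Injective (incl X U).hom := Subtype.val_injective

lemma incl_mem (U : X.obj.Sub) (x) : (incl X U).hom x ∈ U := Subtype.prop x

lemma exists_incl_eq {U : X.obj.Sub} {x : X.obj} (hx : x ∈ U) : ∃ y, (incl X U).hom y = x :=
  ⟨⟨x, hx⟩, rfl⟩

/-- The quotient by a closed stable submodule. -/
def quot (X : P.FullSubcategory) (U : X.obj.Sub) : P.FullSubcategory :=
  haveI := ProAug.epi_of_surjective _
    (ProAug.quotientπ_surjective X.obj U.toSubmodule U.isClosed U.smul_mem)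
  ⟨ProAug.quotient X.obj U.toSubmodule U.isClosed U.smul_mem,
    P.prop_of_epi (ProAug.quotientπ X.obj U.toSubmodule U.isClosed U.smul_mem) X.property⟩

/-- The projection onto the quotient by a closed stable submodule. -/
def proj (X : P.FullSubcategory) (U : X.obj.Sub) : X ⟶ quot X U :=
  ObjectProperty.homMk (ProAug.quotientπ X.obj U.toSubmodule U.isClosed U.smul_mem)

lemma proj_surjective (U : X.obj.Sub) : Function.Surjective (proj X U).hom :=
  ProAug.quotientπ_surjective _ _ _ _

lemma proj_eq_zero {U : X.obj.Sub} {x : X.obj} : (proj X U).hom x = 0 ↔ x ∈ U :=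
  Submodule.Quotient.mk_eq_zero U.toSubmodule

instance (U : X.obj.Sub) : Mono (incl X U) := mono_of_injective _ (incl_injective U)
instance (U : X.obj.Sub) : Epi (proj X U) := epi_of_surjective _ (proj_surjective U)

lemma apply_incl (f : X ⟶ Y) (x : (sub X (kerSub f)).obj) :
    f.hom ((incl X (kerSub f)).hom x) = 0 := mem_kerSub.1 (incl_mem _ x)

lemma incl_comp (f : X ⟶ Y) : incl X (kerSub f) ≫ f = 0 := DualCat.ext (apply_incl f)

lemma injective_of_mono (f : X ⟶ Y) [Mono f] : Function.Injective f.hom := by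
  refine injective_of_eq_zero f fun x hx => ?_
  have h : incl X (kerSub f) = 0 := by
    rw [← cancel_mono f, zero_comp]
    exact incl_comp f
  obtain ⟨y, rfl⟩ := exists_incl_eq (mem_kerSub.2 hx)
  rw [h]; rfl

lemma surjective_of_epi (f : X ⟶ Y) [Epi f] : Function.Surjective f.hom := by
  intro y
  have h : proj Y (ProAug.Sub.range f.hom) = 0 := by
    rw [← cancel_epi f]
    exact DualCat.ext fun x => proj_eq_zero.2 ⟨x, rfl⟩
  exact proj_eq_zero.1 (by rw [h]; rfl)

lemma isIso_of_bijective (f : X ⟶ Y) (hi : Function.Injective f.hom)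
    (hs : Function.Surjective f.hom) : IsIso f := by
  have := mono_of_injective f hi
  have := epi_of_surjective f hs
  exact isIso_of_mono_of_epi f

lemma shortExact {f : X ⟶ Y} {g : Y ⟶ Z} (hf : Function.Injective f.hom)
    (hg : Function.Surjective g.hom) (h : ∀ y, g.hom y = 0 → ∃ x, f.hom x = y) (w : f ≫ g = 0) :
    (ShortComplex.mk f g w).ShortExact := by
  have := mono_of_injective f hf
  have := epi_of_surjective g hg
  refine { exact := ShortComplex.exact_of_f_is_kernel _ ?_ }
  have key : ∀ {W : P.FullSubcategory} (k : W ⟶ Y), k ≫ g = 0 → ∃ l : W ⟶ X, l ≫ f = k :=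
    fun k hk => exists_lift f hf k fun z => h _ (by rw [← DualCat.comp_apply, hk, zero_apply])
  exact KernelFork.IsLimit.ofι' f w fun k hk => ⟨(key k hk).choose, (key k hk).choose_spec⟩

lemma shortExact_incl (f : X ⟶ Y) (hf : Function.Surjective f.hom) :
    (ShortComplex.mk (incl X (kerSub f)) f (incl_comp f)).ShortExact :=
  shortExact (incl_injective _) hf (fun _ hy => exists_incl_eq (mem_kerSub.2 hy)) _

lemma incl_proj (U : X.obj.Sub) : incl X U ≫ proj X U = 0 :=
  DualCat.ext fun x => proj_eq_zero.2 (incl_mem _ x)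

lemma shortExact_proj (U : X.obj.Sub) :
    (ShortComplex.mk (incl X U) (proj X U) (incl_proj U)).ShortExact :=
  shortExact (incl_injective _) (proj_surjective _)
    (fun _ hy => exists_incl_eq (proj_eq_zero.1 hy)) _

lemma surjective_of_simple [Simple Y] {f : X ⟶ Y} (hf : f ≠ 0) : Function.Surjective f.hom :=
  haveI := epi_of_nonzero_to_simple hf
  surjective_of_epi f

/-- The quotient by a maximal closed stable submodule is simple. -/
lemma simple_quot {U : X.obj.Sub} (hU : U ≠ ⊤) (hmax : ∀ V, U < V → V = ⊤) :
    Simple (quot X U) where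
  mono_isIso_iff_nonzero {W} f _ := by
    constructor
    · rintro h rfl
      refine hU (ProAug.Sub.ext fun x => ⟨fun _ => ProAug.Sub.mem_top, fun _ => ?_⟩)
      obtain ⟨y, hy⟩ := surjective_of_epi (0 : W ⟶ quot X U) ((proj X U).hom x)
      exact proj_eq_zero.1 (hy.symm.trans (zero_apply y))
    · intro h
      refine isIso_of_bijective f (injective_of_mono f) ?_
      have : ProAug.Sub.comap (proj X U).hom (ProAug.Sub.range f.hom) = ⊤ := by
        refine hmax _ (lt_of_le_of_ne (fun x hx => ?_) fun he => ?_)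
        · exact ⟨0, (DualCat.map_zero f).trans (proj_eq_zero.2 hx).symm⟩
        · obtain ⟨w, hw⟩ := exists_ne_zero_of_hom_ne_zero h
          obtain ⟨x, hx⟩ := proj_surjective U (f.hom w)
          refine hw ?_
          rw [← hx, proj_eq_zero, he]
          exact ⟨w, hx.symm⟩
      intro y
      obtain ⟨x, rfl⟩ := proj_surjective U y
      have hx : x ∈ ProAug.Sub.comap (proj X U).hom (ProAug.Sub.range f.hom) := by
        rw [this]; exact ProAug.Sub.mem_top
      exact hx

/-- Elements are separated by maps to objects whose closed stable submodules satisfy both chain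
conditions. -/
lemma exists_finLen_quotient {x : X.obj} (hx : x ≠ 0) :
    ∃ (Y : P.FullSubcategory) (f : X ⟶ Y), Function.Surjective f.hom ∧ f.hom x ≠ 0 ∧
      WellFoundedGT Y.obj.Sub ∧ WellFoundedLT Y.obj.Sub := by
  by_contra! hcon
  have hker : ∀ q : Under X.obj, finLenQuotients X.obj q → q.hom x = 0 := by
    intro q hq
    by_contra hne
    have := hq.1
    have := hq.2.1
    have := hq.2.2
    exact hcon ⟨q.right, P.prop_of_epi q.hom X.property⟩ (ObjectProperty.homMk q.hom)
      (ProAug.surjective_of_epi q.hom) hne ProAug.Sub.wellFoundedGT ProAug.Sub.wellFoundedLT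
  -- The common kernel of all finite length quotients: its inclusion and the zero map agree on the
  -- limit cone, so it vanishes.
  let K : X.obj.Sub := sInf {U | ∃ q : Under X.obj, finLenQuotients X.obj q ∧
    U = ProAug.Sub.comap q.hom ⊥}
  have hxK : x ∈ K := ProAug.Sub.mem_sInf.2 fun U ⟨q, hq, hU⟩ => by
    rw [hU]; exact ProAug.Sub.mem_bot.2 (hker q hq)
  obtain ⟨hlim⟩ := IsDualCat.isLimit X.obj X.property
  have h2 : ∀ q : (finLenQuotients X.obj).FullSubcategory, K.incl ≫ q.obj.hom = 0 := fun q =>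
    ProAug.hom_ext fun y => ProAug.Sub.mem_bot.1 (ProAug.Sub.mem_comap.1
      (ProAug.Sub.mem_sInf.1 y.2 _ ⟨q.obj, q.property, rfl⟩))
  have h0 : K.incl = 0 := hlim.hom_ext fun q => (h2 q).trans zero_comp.symm
  have h1 : ∀ y, K.incl y = 0 := fun y => by rw [h0]; rfl
  exact hx (h1 ⟨x, hxK⟩)

/-- A morphism which is not surjective is killed by a nonzero map to a simple object. -/
lemma exists_simple_quotient (f : X ⟶ Y) (hf : ¬ Function.Surjective f.hom) :
    ∃ (S : P.FullSubcategory) (g : Y ⟶ S), Simple S ∧ g ≠ 0 ∧ f ≫ g = 0 := by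
  simp only [Function.Surjective, not_forall] at hf
  obtain ⟨y, hy⟩ := hf
  have hne : (proj Y (ProAug.Sub.range f.hom)).hom y ≠ 0 := fun h => hy (proj_eq_zero.1 h)
  obtain ⟨W, u, hu, huy, hW, -⟩ := exists_finLen_quotient hne
  -- A nonzero finite length quotient of the cokernel has a maximal proper closed stable submodule,
  -- and that yields the simple quotient.
  obtain ⟨U, hU, hmax⟩ := hW.wf.has_min {U : W.obj.Sub | U ≠ ⊤}
    ⟨⊥, fun h => huy (ProAug.Sub.mem_bot.1 (h ▸ ProAug.Sub.mem_top))⟩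
  refine ⟨quot W U, proj Y _ ≫ u ≫ proj W U,
    simple_quot hU fun V hV => by_contra fun hV' => hmax V hV' hV, fun h => hU ?_, ?_⟩
  · refine ProAug.Sub.ext fun w => ⟨fun _ => ProAug.Sub.mem_top, fun _ => proj_eq_zero.1 ?_⟩
    obtain ⟨z, rfl⟩ := hu w
    obtain ⟨z, rfl⟩ := proj_surjective _ z
    exact DualCat.ext_iff.1 h z
  · refine DualCat.ext fun x => ?_
    have : (proj Y (ProAug.Sub.range f.hom)).hom (f.hom x) = 0 := proj_eq_zero.2 ⟨x, rfl⟩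
    simp [this]

/-! ### Finite direct sums -/

variable {J : Type} [Fintype J]

open Classical in
/-- The element of a finite direct sum with given components. -/
noncomputable def biprodMk {F : J → P.FullSubcategory} (x : ∀ j, (F j).obj) : (⨁ F).obj :=
  ∑ j, (biproduct.ι F j).hom (x j)

lemma desc_biprodMk {F : J → P.FullSubcategory} (f : ∀ j, F j ⟶ Y) (x : ∀ j, (F j).obj) :
    (biproduct.desc f).hom (biprodMk x) = ∑ j, (f j).hom (x j) := by
  rw [biprodMk, DualCat.map_sum]
  refine Finset.sum_congr rfl fun j _ => ?_
  rw [← DualCat.comp_apply, biproduct.ι_desc]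

lemma desc_apply {F : J → P.FullSubcategory} (f : ∀ j, F j ⟶ Y) (x : (⨁ F).obj) :
    (biproduct.desc f).hom x = ∑ j, (f j).hom ((biproduct.π F j).hom x) := by
  classical
  rw [biproduct.desc_eq, sum_apply]
  rfl

lemma comp_desc {F : J → P.FullSubcategory} (l : Z ⟶ ⨁ F) (f : ∀ j, F j ⟶ Y) :
    l ≫ biproduct.desc f = ∑ j, (l ≫ biproduct.π F j) ≫ f j := by
  classical
  rw [biproduct.desc_eq, Preadditive.comp_sum]
  simp only [Category.assoc]

lemma π_biprodMk {F : J → P.FullSubcategory} (x : ∀ j, (F j).obj) (j : J) :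
    (biproduct.π F j).hom (biprodMk x) = x j := by
  classical
  rw [biprodMk, DualCat.map_sum, Finset.sum_eq_single j]
  · rw [← DualCat.comp_apply, biproduct.ι_π_self]; rfl
  · intro i _ hij
    rw [← DualCat.comp_apply, biproduct.ι_π_ne _ hij]; rfl
  · simp

lemma biprod_ext {F : J → P.FullSubcategory} {x y : (⨁ F).obj}
    (h : ∀ j, (biproduct.π F j).hom x = (biproduct.π F j).hom y) : x = y := by
  classical
  have : ∀ z : (⨁ F).obj, z = ∑ j, (biproduct.ι F j).hom ((biproduct.π F j).hom z) := fun z => by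
    conv_lhs => rw [← id_apply z, ← biproduct.total, sum_apply]
    rfl
  rw [this x, this y]
  exact Finset.sum_congr rfl fun j _ => by rw [h j]

end DualCat

end Concrete

/-! ### Extensions and projective resolutions -/

section Ext

open Abelian

universe w v t

variable {C : Type u} [Category.{v} C] [Abelian C] [HasExt.{w} C] {Y : C}
  {S : ShortComplex C} (hS : S.ShortExact)

include hS

/-- Dimension shifting in degree zero. -/
lemma exists_extension_of_subsingleton_ext (h : Subsingleton (Ext.{w} S.X₃ Y 1))
    (g : S.X₁ ⟶ Y) : ∃ l : S.X₂ ⟶ Y, S.f ≫ l = g := by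
  obtain ⟨x, hx⟩ := Ext.contravariant_sequence_exact₁ hS Y (Ext.mk₀ g) (add_zero 1)
    (Subsingleton.elim _ _)
  obtain ⟨l, rfl⟩ := Ext.homEquiv₀.symm.surjective x
  refine ⟨l, Ext.homEquiv₀.symm.injective ?_⟩
  simpa using hx

/-- The connecting map Ext¹(X₁, Y) → Ext²(X₃, Y) is injective because Ext¹ out of the projective X₂
vanishes. -/
lemma subsingleton_ext_of_subsingleton_ext_succ [Projective S.X₂]
    (h : Subsingleton (Ext.{w} S.X₃ Y 2)) : Subsingleton (Ext.{w} S.X₁ Y 1) := by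
  refine subsingleton_of_forall_eq 0 fun x => ?_
  obtain ⟨y, hy⟩ := Ext.contravariant_sequence_exact₁ hS Y x (show 1 + 1 = 2 from rfl)
    (Subsingleton.elim _ _)
  rw [← hy, Ext.eq_zero_of_projective y, Ext.comp_zero]

/-- As X₂ is projective, Ext¹(X₃, Y) is a quotient of Hom(X₁, Y). -/
lemma subsingleton_ext_one [Projective S.X₂] (h : ∀ g : S.X₁ ⟶ Y, g = 0) :
    Subsingleton (Ext.{w} S.X₃ Y 1) := by
  refine subsingleton_of_forall_eq 0 fun x => ?_
  obtain ⟨y, hy⟩ := Ext.contravariant_sequence_exact₃ hS Y x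
    (Ext.eq_zero_of_projective _) (add_zero 1)
  obtain ⟨l, rfl⟩ := Ext.homEquiv₀.symm.surjective y
  rw [← hy, h l]
  simp

/-- If `X₂` is projective and all maps from `X₂` to `Y` vanish on `X₁`, then
`Hom(X₁, Y) ≃ Ext¹(X₃, Y)`. -/
lemma nonempty_linearEquiv_ext_one (k : Type t) [CommRing k] [Linear k C] [Projective S.X₂]
    (h : ∀ g : S.X₂ ⟶ Y, S.f ≫ g = 0) : Nonempty ((S.X₁ ⟶ Y) ≃ₗ[k] Ext.{w} S.X₃ Y 1) := by
  let Φ : (S.X₁ ⟶ Y) →ₗ[k] Ext.{w} S.X₃ Y 1 :=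
    (hS.extClass.precompOfLinear k Y (add_zero 1)).comp
      (Ext.linearEquiv₀ (R := k)).symm.toLinearMap
  have hΦ : ∀ g, Φ g = hS.extClass.comp (Ext.mk₀ g) (add_zero 1) := fun g => by
    simp [Φ]
  refine ⟨LinearEquiv.ofBijective Φ ⟨?_, ?_⟩⟩
  · refine (injective_iff_map_eq_zero Φ).2 fun g hg => ?_
    rw [hΦ] at hg
    obtain ⟨x, hx⟩ := Ext.contravariant_sequence_exact₁ hS Y (Ext.mk₀ g) (add_zero 1) hg
    obtain ⟨l, rfl⟩ := Ext.homEquiv₀.symm.surjective x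
    refine Ext.homEquiv₀.symm.injective ?_
    have := h l
    simpa [this] using hx.symm
  · intro x
    obtain ⟨y, hy⟩ := Ext.contravariant_sequence_exact₃ hS Y x
      (Ext.eq_zero_of_projective _) (add_zero 1)
    obtain ⟨l, rfl⟩ := Ext.homEquiv₀.symm.surjective y
    exact ⟨l, (hΦ l).trans hy⟩

/-- Both neighbours in the covariant long exact sequence vanish. With X₁ = R this compares Ext¹(Q,
Q) with Ext¹(Q, S). -/
lemma nonempty_linearEquiv_ext_of_subsingleton (k : Type t) [CommRing k] [Linear k C] (X : C)
    (n : ℕ) (h1 : Subsingleton (Ext.{w} X S.X₁ n)) (h2 : Subsingleton (Ext.{w} X S.X₁ (n + 1))) :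
    Nonempty (Ext.{w} X S.X₂ n ≃ₗ[k] Ext.{w} X S.X₃ n) := by
  refine ⟨LinearEquiv.ofBijective ((Ext.mk₀ S.g).postcompOfLinear k X (add_zero n)) ⟨?_, ?_⟩⟩
  · refine (injective_iff_map_eq_zero _).2 fun x hx => ?_
    obtain ⟨y, hy⟩ := Ext.covariant_sequence_exact₂ X hS x hx
    rw [← hy, Subsingleton.elim y 0, Ext.zero_comp]
  · intro x
    obtain ⟨y, hy⟩ := Ext.covariant_sequence_exact₃ X hS x rfl (Subsingleton.elim _ _)
    exact ⟨y, hy⟩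

end Ext

/-! ### Projective envelopes of simple objects -/

section Envelope

variable {O G : Type u} [CommRing O] [Group G] [TopologicalSpace G]
  {P : ObjectProperty (ProAug O G)} [IsDualCat P]

open DualCat

namespace IsProjectiveEnvelope

variable {A S : P.FullSubcategory} [Simple S] {κ : A ⟶ S} (hκ : IsProjectiveEnvelope κ)

include hκ

omit [IsDualCat P] in
lemma ne_zero : κ ≠ 0 := by
  rintro rfl
  have := hκ.epi
  exact id_nonzero S ((cancel_epi (0 : A ⟶ S)).1 (by simp))

/-- If κ were nonzero on ker f, then ker f would surject onto S and be all of A by essentiality. So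
κ factors through f, by a nonzero map of simple objects. -/
lemma exists_iso {S' : P.FullSubcategory} [Simple S'] {f : A ⟶ S'} (hf : f ≠ 0) :
    ∃ e : S ≅ S', f = κ ≫ e.hom := by
  have hker : ∀ x, f.hom x = 0 → κ.hom x = 0 := by
    intro x hx
    by_contra hne
    have h0 : incl A (kerSub f) ≫ κ ≠ 0 := fun h => by
      obtain ⟨y, rfl⟩ := exists_incl_eq (mem_kerSub.2 hx)
      exact hne (DualCat.ext_iff.1 h y)
    have := hκ.essential _ (epi_of_nonzero_to_simple h0)
    refine hf (DualCat.ext fun x => ?_)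
    obtain ⟨y, rfl⟩ := surjective_of_epi (incl A (kerSub f)) x
    exact mem_kerSub.1 (incl_mem _ y)
  obtain ⟨v, hv⟩ := exists_desc f (surjective_of_simple hf) κ hker
  have hv0 : v ≠ 0 := by
    rintro rfl
    exact hκ.ne_zero (by rw [← hv, comp_zero])
  have := isIso_of_hom_simple hv0
  exact ⟨(asIso v).symm, by simp [← hv]⟩

/-- In other words, ker κ is the radical of A; all later Nakayama arguments start from this. -/
lemma eq_zero_of_simple {S' : P.FullSubcategory} [Simple S'] (f : A ⟶ S') {x : A.obj}
    (hx : κ.hom x = 0) : f.hom x = 0 := by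
  by_cases hf : f = 0
  · rw [hf]; rfl
  · obtain ⟨e, rfl⟩ := hκ.exists_iso hf
    rw [DualCat.comp_apply, hx, DualCat.map_zero]

/-- Essentiality makes g an epimorphism, and projectivity of A splits it. -/
lemma exists_comp_eq (g : A ⟶ A) (hg : g ≫ κ ≠ 0) : ∃ s : A ⟶ A, s ≫ g = 𝟙 A := by
  have := hκ.essential g (epi_of_nonzero_to_simple hg)
  have := hκ.projective
  exact ⟨Projective.factorThru (𝟙 A) g, Projective.factorThru_comp _ _⟩

variable {k : Type u} [Field k] [Linear k P.FullSubcategory]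
  (hEnd : ∀ v : S ⟶ S, ∃ c : k, v = c • 𝟙 S)

include hEnd

lemma exists_smul (f : A ⟶ S) : ∃ c : k, f = c • κ := by
  by_cases hf : f = 0
  · exact ⟨0, by rw [hf, zero_smul]⟩
  · obtain ⟨e, rfl⟩ := hκ.exists_iso hf
    obtain ⟨c, hc⟩ := hEnd e.hom
    exact ⟨c, by rw [hc, Linear.comp_smul, Category.comp_id]⟩

/-- The rank of Hom(A, -) is subadditive along a composition series; a factor S contributes at most
1 and any other simple factor contributes 0. -/
lemma rank_hom_le {X : P.FullSubcategory} {n : ℕ} (hX : HasMultiplicity S X n) :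
    Module.rank k (A ⟶ X) ≤ n := by
  have := hκ.projective
  have key : ∀ {X Y Z : P.FullSubcategory} (i : X ⟶ Y) (q : Y ⟶ Z) (w : i ≫ q = 0)
      (h : (ShortComplex.mk i q w).ShortExact),
      Module.rank k (A ⟶ Y) ≤ Module.rank k (A ⟶ X) + Module.rank k (A ⟶ Z) := by
    intro X Y Z i q w h
    have : Mono (ShortComplex.mk i q w).f := h.mono_f
    have h1 := LinearMap.rank_range_add_rank_ker (Linear.rightComp k A q)
    have h2 : LinearMap.ker (Linear.rightComp k A q) ≤
        LinearMap.range (Linear.rightComp k A i) := fun g hg =>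
      ⟨h.exact.lift g hg, h.exact.lift_f g hg⟩
    rw [← h1, add_comm]
    exact add_le_add ((Submodule.rank_mono h2).trans (rank_range_le _))
      (Submodule.rank_le _)
  induction hX with
  | zero hX =>
    have : Subsingleton (A ⟶ _) := ⟨fun a b => hX.eq_of_tgt a b⟩
    simp
  | cons_iso i q w h hZ e hX ih =>
    refine (key i q w h).trans ?_
    rw [Nat.cast_add]
    refine add_le_add ih ?_
    obtain ⟨e⟩ := e
    rw [Nat.cast_one, rank_le_one_iff]
    refine ⟨κ ≫ e.inv, fun f => ?_⟩
    obtain ⟨c, hc⟩ := hκ.exists_smul hEnd (f ≫ e.hom)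
    exact ⟨c, by rw [← Linear.smul_comp, ← hc]; simp⟩
  | @cons_not_iso X Y Z i q w h hZ e n hX ih =>
    refine (key i q w h).trans ?_
    have : Subsingleton (A ⟶ Z) := subsingleton_of_forall_eq 0 fun f => by
      by_contra hf
      exact e.elim (hκ.exists_iso hf).choose.symm
    rw [rank_subsingleton' k (A ⟶ Z), add_zero]
    exact ih

end IsProjectiveEnvelope

end Envelope

/-! ### The cover of Q by the projective envelope of S -/

section Cover

variable {O G : Type u} [CommRing O] [Group G] [TopologicalSpace G]
  {P : ObjectProperty (ProAug O G)} [IsDualCat P]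

open DualCat

omit [IsDualCat P] in
lemma HasMultiplicity.eq_zero_of_isZero {S X : P.FullSubcategory} {n : ℕ}
    (h : HasMultiplicity S X n) (hX : IsZero X) : n = 0 := by
  cases h with
  | zero _ => rfl
  | cons_iso i q w h hZ e _ =>
    have : Epi q := h.epi_g
    exact absurd (IsZero.of_epi q hX) (Simple.not_isZero _)
  | cons_not_iso i q w h hZ e _ =>
    have : Epi q := h.epi_g
    exact absurd (IsZero.of_epi q hX) (Simple.not_isZero _)

/-- The epimorphisms `A → Q → S`, where `A → S` is a projective envelope of a simple object with
endomorphism ring `k` and `Q` is, in low degrees, like the fibre at the closed point of a flat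
module over `End A`. -/
structure IsFlatFibre (k : Type u) [Field k] [Linear k P.FullSubcategory]
    {A S Q : P.FullSubcategory} (π : A ⟶ Q) (q : Q ⟶ S) : Prop where
  simple : Simple S
  exists_smul_id : ∀ v : S ⟶ S, ∃ c : k, v = c • 𝟙 S
  envelope : IsProjectiveEnvelope (π ≫ q)
  surjective : Function.Surjective π.hom
  eq_zero : ∀ g : A ⟶ Q, g ≫ q = 0 → g = 0
  nonempty_iso : ∀ (S' : P.FullSubcategory) [Simple S'] (g : sub A (kerSub π) ⟶ S'), g ≠ 0 →
    Nonempty (S ≅ S')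
  eq_zero_of_ker : ∀ {J : Type} [Fintype J] (a : J → (A ⟶ sub A (kerSub π))),
    Function.Surjective (biproduct.desc a).hom →
    ∀ v : sub _ (kerSub (biproduct.desc a)) ⟶ Q, v ≫ q = 0 → v = 0

variable {k : Type u} [Field k] [Linear k P.FullSubcategory]
  {A S Q : P.FullSubcategory} [Simple S] {κ : A ⟶ S} (hκ : IsProjectiveEnvelope κ)
  (hEnd : ∀ v : S ⟶ S, ∃ c : k, v = c • 𝟙 S)
  (H1 : ∀ S' : P.FullSubcategory, Simple S' → IsEmpty (S ≅ S') → ∀ f : Q ⟶ S', f = 0)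
  (H2 : HasMultiplicity S Q 1)

include hκ hEnd H1 H2 in
-- Multiplicity one bounds Hom(A, Q) by a line. Were π not surjective, (H1) would give a nonzero Q →
-- S killing its image; lifting κ along that map gives a multiple of π, which the map kills, so κ =
-- 0.
lemma exists_factorization : ∃ (π : A ⟶ Q) (q : Q ⟶ S), π ≫ q = κ ∧
    Function.Surjective π.hom ∧ (∀ g : A ⟶ Q, g ≫ q = 0 → g = 0) ∧
    ∀ f : Q ⟶ S, ∃ c : k, f = c • q := by
  have hproj := hκ.projective
  have hrank : Module.rank k (A ⟶ Q) ≤ 1 := by simpa using hκ.rank_hom_le hEnd H2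
  obtain ⟨g₀, hg₀⟩ := rank_le_one_iff.1 hrank
  have hS : ∀ {X : P.FullSubcategory} (f : X ⟶ Q), ¬ Function.Surjective f.hom →
      ∃ g : Q ⟶ S, g ≠ 0 ∧ f ≫ g = 0 := by
    intro X f hf
    obtain ⟨S', g, hS', hg, hfg⟩ := exists_simple_quotient f hf
    have : Nonempty (S ≅ S') := by
      by_contra hcon
      exact hg (H1 S' hS' (not_nonempty_iff.1 hcon) g)
    obtain ⟨e⟩ := this
    exact ⟨g ≫ e.inv, fun h => hg (by simpa using congrArg (· ≫ e.hom) h), by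
      rw [reassoc_of% hfg, zero_comp]⟩
  obtain ⟨q, hq, -⟩ := hS (0 : Q ⟶ Q) fun h => by
    refine one_ne_zero (H2.eq_zero_of_isZero ((IsZero.iff_id_eq_zero _).2 (DualCat.ext fun x => ?_)))
    obtain ⟨y, hy⟩ := h x
    rw [← hy]; rfl
  have hlift : ∀ f : Q ⟶ S, f ≠ 0 → ∃ g : A ⟶ Q, g ≫ f = κ := fun f hf =>
    haveI := epi_of_nonzero_to_simple hf
    ⟨Projective.factorThru κ f, Projective.factorThru_comp _ _⟩
  obtain ⟨π, hπ⟩ := hlift q hq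
  have hspan : ∀ g : A ⟶ Q, ∃ c : k, g = c • π := by
    intro g
    obtain ⟨c, hc⟩ := hg₀ g
    obtain ⟨b, hb⟩ := hg₀ π
    have hb0 : b ≠ 0 := by
      rintro rfl
      rw [zero_smul] at hb
      exact hκ.ne_zero (by rw [← hπ, ← hb, zero_comp])
    exact ⟨c * b⁻¹, by rw [← hb, smul_smul, mul_assoc, inv_mul_cancel₀ hb0, mul_one, hc]⟩
  have hsurj : Function.Surjective π.hom := by
    by_contra hcon
    obtain ⟨f, hf, hπf⟩ := hS π hcon
    obtain ⟨g, hg⟩ := hlift f hf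
    obtain ⟨c, rfl⟩ := hspan g
    exact hκ.ne_zero (by rw [← hg, Linear.smul_comp, hπf, smul_zero])
  refine ⟨π, q, hπ, hsurj, fun g hg => ?_, fun f => ?_⟩
  · obtain ⟨c, rfl⟩ := hspan g
    rw [Linear.smul_comp, hπ, smul_eq_zero] at hg
    rw [hg.resolve_right hκ.ne_zero, zero_smul]
  · obtain ⟨c, hc⟩ := hκ.exists_smul hEnd (π ≫ f)
    refine ⟨c, DualCat.ext fun x => ?_⟩
    obtain ⟨x, rfl⟩ := hsurj x
    rw [← DualCat.comp_apply, hc, ← hπ, ← Linear.comp_smul, DualCat.comp_apply]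

include H1 in
/-- The radical is the kernel of the map to the unique simple quotient. -/
lemma IsRadicalOf.shortExact {R : Subobject Q} (hR : IsRadicalOf R) {q : Q ⟶ S} (hq : q ≠ 0)
    (hspan : ∀ f : Q ⟶ S, ∃ c : k, f = c • q) :
    ∃ w : R.arrow ≫ q = 0, (ShortComplex.mk R.arrow q w).ShortExact := by
  have hmem : ∀ M : Subobject Q, M.arrow ≫ q = 0 → M ≤ Subobject.mk (incl Q (kerSub q)) := by
    intro M hM
    obtain ⟨l, hl⟩ := DualCat.exists_lift (incl Q (kerSub q)) (incl_injective _) M.arrow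
      fun z => exists_incl_eq (mem_kerSub.2 (DualCat.ext_iff.1 hM z))
    exact Subobject.le_mk_of_comm l hl
  have hqs := surjective_of_simple hq
  have htop : ∀ M : Subobject Q, Function.Surjective M.arrow.hom → M = ⊤ := fun M hM =>
    haveI := isIso_of_bijective M.arrow (injective_of_mono _) hM
    Subobject.eq_top_of_isIso_arrow M
  have hco : IsCoatom (Subobject.mk (incl Q (kerSub q))) := by
    refine ⟨fun h => hq ?_, fun M hM => htop M ?_⟩
    · have := (Subobject.isIso_iff_mk_eq_top (incl Q (kerSub q))).2 h
      refine DualCat.ext fun x => ?_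
      obtain ⟨y, rfl⟩ := surjective_of_epi (incl Q (kerSub q)) x
      exact mem_kerSub.1 (incl_mem _ y)
    · have hne : M.arrow ≫ q ≠ 0 := fun h => hM.not_ge (hmem M h)
      intro x
      obtain ⟨y, hy⟩ := surjective_of_simple hne (q.hom x)
      have hx : x - M.arrow.hom y ∈ kerSub q :=
        mem_kerSub.2 (by rw [DualCat.map_sub, ← hy, DualCat.comp_apply, sub_self])
      obtain ⟨z, hz⟩ := exists_incl_eq hx
      refine ⟨y + (Subobject.ofMkLE _ M hM.le).hom z, ?_⟩
      rw [DualCat.map_add, ← DualCat.comp_apply, Subobject.ofMkLE_arrow, hz]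
      abel
  -- The kernel of q is the only maximal subobject: any other lies in the kernel of a nonzero map to
  -- a simple object, which by (H1) is a multiple of q up to isomorphism.
  have hker : R = Subobject.mk (incl Q (kerSub q)) := by
    refine hR.unique ⟨fun M hM => ?_, fun M hM => hM hco⟩
    have hns : ¬ Function.Surjective M.arrow.hom := fun h => hM.1 (htop M h)
    obtain ⟨S', g, hS', hg, hMg⟩ := exists_simple_quotient _ hns
    have hle : M ≤ Subobject.mk (incl Q (kerSub q)) := by
      refine hmem M ?_
      have : Nonempty (S ≅ S') := by
        by_contra hcon
        exact hg (H1 S' hS' (not_nonempty_iff.1 hcon) g)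
      obtain ⟨e⟩ := this
      obtain ⟨c, hc⟩ := hspan (g ≫ e.inv)
      have hc0 : c ≠ 0 := by
        rintro rfl
        rw [zero_smul] at hc
        exact hg (by simpa using congrArg (· ≫ e.hom) hc)
      have : c • (M.arrow ≫ q) = 0 := by
        rw [← Linear.comp_smul, ← hc, reassoc_of% hMg, zero_comp]
      exact (smul_eq_zero.1 this).resolve_left hc0
    exact ((hM.le_iff.1 hle).resolve_left hco.1).le
  have hinv : (Subobject.underlyingIso (incl Q (kerSub q))).inv ≫
      (Subobject.mk (incl Q (kerSub q))).arrow = incl Q (kerSub q) :=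
    Subobject.underlyingIso_arrow _
  subst hker
  refine ⟨?_, DualCat.shortExact (injective_of_mono _) hqs (fun y hy => ?_) _⟩
  · have h0 : incl Q (kerSub q) ≫ q = 0 := incl_comp q
    rw [← Subobject.underlyingIso_hom_comp_eq_mk, Category.assoc, h0, comp_zero]
  · obtain ⟨z, rfl⟩ := exists_incl_eq (mem_kerSub.2 hy)
    exact ⟨_, DualCat.ext_iff.1 hinv z⟩

include hκ hEnd in
-- Two uses of dimension shifting. By (H3) a map from N = ker π to a simple object other than S
-- extends to A, but maps from A to simple objects kill N. By (H5) Ext¹(N, R) = 0, so a map to R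
-- from the kernel of a cover A^J → N extends to A^J, where it vanishes since Hom(A, R) = 0.
lemma isFlatFibre {π : A ⟶ Q} {q : Q ⟶ S} (hπq : π ≫ q = κ) (hπ : Function.Surjective π.hom)
    (h0 : ∀ g : A ⟶ Q, g ≫ q = 0 → g = 0) {R : P.FullSubcategory} {i : R ⟶ Q} {w : i ≫ q = 0}
    (hR : (ShortComplex.mk i q w).ShortExact)
    (H3 : ∀ S' : P.FullSubcategory, Simple S' → IsEmpty (S ≅ S') →
      Subsingleton (Abelian.Ext.{u + 1} Q S' 1))
    (H5 : Subsingleton (Abelian.Ext.{u + 1} Q R 2)) : IsFlatFibre k π q := by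
  have hA := hκ.projective
  have hN := shortExact_incl π hπ
  have hi : Mono i := hR.mono_f
  subst hπq
  refine ⟨‹_›, hEnd, hκ, hπ, h0, fun S' hS' g hg => ?_, fun a ha v hv => ?_⟩
  · by_contra hcon
    refine hg ?_
    obtain ⟨l, rfl⟩ := exists_extension_of_subsingleton_ext hN
      (H3 S' hS' (not_nonempty_iff.1 hcon)) g
    refine DualCat.ext fun x => hκ.eq_zero_of_simple l ?_
    exact (congrArg q.hom (apply_incl π x)).trans (DualCat.map_zero q)
  · have hmono : Mono (ShortComplex.mk i q w).f := hi
    have hNR : Subsingleton (Abelian.Ext.{u + 1} (sub A (kerSub π)) R 1) :=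
      haveI : Projective (ShortComplex.mk (incl A (kerSub π)) π (incl_comp π)).X₂ := hA
      subsingleton_ext_of_subsingleton_ext_succ hN H5
    obtain ⟨l, hl⟩ := exists_extension_of_subsingleton_ext (shortExact_incl _ ha) hNR
      (hR.exact.lift v hv)
    have hl0 : l = 0 := by
      refine biproduct.hom_ext' _ _ fun j => ?_
      rw [comp_zero, ← cancel_mono i, zero_comp]
      refine h0 _ ?_
      rw [Category.assoc, w, comp_zero]
    rw [← hR.exact.lift_f v hv, ← hl, hl0, comp_zero]
    exact zero_comp

end Cover

/-- The bilinear forms on the span of a family `f`, which extend to functionals on the products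
`f i * f j` modulo higher order terms. -/
def relForms {k E I : Type*} [Field k] [Ring E] [Algebra k E] [Fintype I] (ε : E →ₐ[k] k)
    (f : I → E) : Submodule k (Matrix I I k) where
  carrier := {b | ∀ h : I → I → E, ∑ i, ∑ j, f i * f j * h i j = 0 →
    ∑ i, ∑ j, b i j * ε (h i j) = 0}
  zero_mem' h _ := by simp
  add_mem' {b c} hb hc h hh := by
    simp [add_mul, Finset.sum_add_distrib, hb h hh, hc h hh]
  smul_mem' a b hb h hh := by
    simp [mul_assoc, ← Finset.mul_sum, hb h hh]

/-! ### The residue character and dual families of endomorphisms -/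

section Generators

variable {O G : Type u} [CommRing O] [Group G] [TopologicalSpace G]
  {P : ObjectProperty (ProAug O G)} [IsDualCat P] {k : Type u} [Field k]
  [Linear k P.FullSubcategory] {A S Q : P.FullSubcategory} {π : A ⟶ Q} {q : Q ⟶ S}

open DualCat

namespace IsFlatFibre

section Residue

variable (hF : IsFlatFibre k π q)

include hF in
lemma comp_ne_zero : π ≫ q ≠ 0 :=
  haveI := hF.simple
  hF.envelope.ne_zero

/-- All maps from `A` to `S` are multiples of the given one. -/
noncomputable def coef : (A ⟶ S) ≃ₗ[k] k :=
  (LinearEquiv.ofBijective (LinearMap.toSpanSingleton k (A ⟶ S) (π ≫ q))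
    ⟨(injective_iff_map_eq_zero _).2 fun c hc => by
      rw [LinearMap.toSpanSingleton_apply, smul_eq_zero] at hc
      exact hc.resolve_right hF.comp_ne_zero, fun f => by
      have := hF.simple
      obtain ⟨c, hc⟩ := hF.envelope.exists_smul hF.exists_smul_id f
      exact ⟨c, hc.symm⟩⟩).symm

lemma coef_smul (f : A ⟶ S) : hF.coef f • (π ≫ q) = f :=
  hF.coef.symm_apply_apply f

lemma coef_comp : hF.coef (π ≫ q) = 1 := by
  have h := hF.coef.apply_symm_apply 1
  rwa [show hF.coef.symm 1 = π ≫ q from one_smul k _] at h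

/-- The residue character of `End A`. -/
noncomputable def residue : End A →ₐ[k] k :=
  AlgHom.ofLinearMap (hF.coef.toLinearMap.comp (Linear.rightComp k A (π ≫ q)))
    ((congrArg hF.coef (Category.id_comp _)).trans hF.coef_comp) fun x y => by
      change hF.coef ((y ≫ x) ≫ π ≫ q) = hF.coef (x ≫ π ≫ q) * hF.coef (y ≫ π ≫ q)
      rw [Category.assoc, ← hF.coef_smul (x ≫ π ≫ q), Linear.comp_smul, _root_.map_smul,
        hF.coef_smul, smul_eq_mul]

lemma residue_apply (g : End A) : hF.residue g = hF.coef (End.asHom g ≫ π ≫ q) := rfl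

lemma residue_smul (g : End A) : hF.residue g • (π ≫ q) = End.asHom g ≫ π ≫ q :=
  hF.coef_smul _

end Residue

variable {I : Type} [Fintype I] [DecidableEq I]

/-- Families of endomorphisms with image in `ker π` which are dual to a basis of
`Hom(ker π, S)`. -/
def IsDualGen (_ : IsFlatFibre k π q) (f : I → End A) : Prop :=
  ∃ (a : I → (A ⟶ sub A (kerSub π))) (e : Module.Basis I k (sub A (kerSub π) ⟶ S)),
    (∀ i, f i = End.of (a i ≫ incl A (kerSub π))) ∧
      ∀ i j, a i ≫ e j = if i = j then π ≫ q else 0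

variable {hF : IsFlatFibre k π q}

section Dual

variable (k) in
/-- Two-sided inverse matrices of residues transform dual families into dual families. -/
lemma IsDualGen.of_mul {f : I → End A} (hf : hF.IsDualGen f) {I' : Type} [Fintype I']
    [DecidableEq I'] {f' : I' → End A} {g : I' → I → End A} (hf' : ∀ i, f' i = ∑ j, f j * g i j)
    {D : Matrix I I' k} (h1 : Matrix.of (fun i j => hF.residue (g i j)) * D = 1)
    (h2 : D * Matrix.of (fun i j => hF.residue (g i j)) = 1) : hF.IsDualGen f' := by
  obtain ⟨a, e, hfa, hae⟩ := hf
  let a' : I' → (A ⟶ sub A (kerSub π)) := fun i => ∑ j, End.asHom (g i j) ≫ a j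
  have hae' : ∀ i j, a' i ≫ e j = hF.residue (g i j) • (π ≫ q) := fun i j => by
    rw [hF.residue_smul]
    simp only [a', Preadditive.sum_comp, Category.assoc, hae]
    rw [Finset.sum_eq_single j (fun l _ hl => by rw [if_neg hl, comp_zero]) (by simp), if_pos rfl]
  -- The residues of `g` give the pairing of `a'` with `e`, so their inverse `D` turns `e` into the
  -- basis dual to `a'`.
  let e' : I' → (sub A (kerSub π) ⟶ S) := fun j => ∑ l, D l j • e l
  have hd : ∀ i j, a' i ≫ e' j = if i = j then π ≫ q else 0 := fun i j => by
    simp only [e', Preadditive.comp_sum, Linear.comp_smul, hae', smul_smul]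
    rw [← Finset.sum_smul]
    have := congrFun (congrFun h1 i) j
    simp only [Matrix.mul_apply, Matrix.of_apply, Matrix.one_apply] at this
    simp only [mul_comm (D _ _), this, ite_smul, one_smul, zero_smul]
  have hli : LinearIndependent k e' := by
    refine Fintype.linearIndependent_iff.2 fun c hc i => ?_
    have h0 : a' i ≫ ∑ j, c j • e' j = c i • (π ≫ q) := by
      simp [Preadditive.comp_sum, hd]
    rw [hc, comp_zero] at h0
    exact (smul_eq_zero.1 h0.symm).resolve_right hF.comp_ne_zero
  have hsp : ⊤ ≤ Submodule.span k (Set.range e') := by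
    rw [← e.span_eq, Submodule.span_le]
    rintro _ ⟨j, rfl⟩
    have : e j = ∑ i, hF.residue (g i j) • e' i := by
      simp only [e', Finset.smul_sum, smul_smul]
      rw [Finset.sum_comm]
      simp only [← Finset.sum_smul]
      have h3 : ∀ l, ∑ i, hF.residue (g i j) * D l i = if l = j then 1 else 0 := fun l => by
        have := congrFun (congrFun h2 l) j
        simp only [Matrix.mul_apply, Matrix.of_apply, Matrix.one_apply] at this
        simpa only [mul_comm] using this
      simp [h3]
    rw [this]
    exact Submodule.sum_mem _ fun i _ => Submodule.smul_mem _ _ (Submodule.subset_span ⟨i, rfl⟩)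
  refine ⟨a', Module.Basis.mk hli hsp, fun i => ?_, fun i j => ?_⟩
  · rw [hf']
    simp only [a', hfa]
    change _ = (∑ j, End.asHom (g i j) ≫ a j) ≫ incl A (kerSub π)
    rw [Preadditive.sum_comp]
    rfl
  · rw [Module.Basis.mk_apply, hd]

/-- Pairing with a basis maps Hom(A, N) onto k^d: a functional vanishing on the image is a nonzero
map N → S killed by every A → N, yet π ≫ q lifts along it by projectivity. -/
lemma exists_isDualGen [Module.Finite k (sub A (kerSub π) ⟶ S)] {d : ℕ}
    (hd : Module.finrank k (sub A (kerSub π) ⟶ S) = d) :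
    ∃ f : Fin d → End A, hF.IsDualGen f := by
  have := hF.simple
  have := hF.envelope.projective
  let e := Module.finBasisOfFinrankEq k (sub A (kerSub π) ⟶ S) hd
  let T : (A ⟶ sub A (kerSub π)) →ₗ[k] (Fin d → k) :=
    LinearMap.pi fun j => hF.coef.toLinearMap.comp (Linear.rightComp k A (e j))
  have hT : LinearMap.range T = ⊤ := by
    by_contra hcon
    obtain ⟨φ, hφ, hle⟩ := Submodule.exists_le_ker_of_lt_top _ (lt_top_iff_ne_top.2 hcon)
    let c : Fin d → k := fun j => φ fun i => if j = i then 1 else 0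
    have hφc : ∀ v, φ v = ∑ j, v j * c j := fun v => 
      LinearMap.pi_apply_eq_sum_univ φ v
    have hne : ∑ j, c j • e j ≠ 0 := fun h => hφ (LinearMap.ext fun v => by
      have := Fintype.linearIndependent_iff.1 e.linearIndependent c h
      simp [hφc, this])
    have := epi_of_nonzero_to_simple hne
    have h1 := Projective.factorThru_comp (π ≫ q) (∑ j, c j • e j)
    have h2 : φ (T (Projective.factorThru (π ≫ q) (∑ j, c j • e j))) = 0 := hle ⟨_, rfl⟩
    rw [hφc] at h2
    have h3 := congrArg hF.coef h1
    rw [hF.coef_comp] at h3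
    refine one_ne_zero (h3.symm.trans ((Eq.trans ?_ h2)))
    rw [Preadditive.comp_sum, map_sum]
    refine Finset.sum_congr rfl fun j _ => ?_
    rw [Linear.comp_smul, _root_.map_smul, smul_eq_mul, mul_comm]
    rfl
  have hs := LinearMap.range_eq_top.1 hT
  choose a ha using fun i => hs (Pi.single i 1)
  refine ⟨fun i => End.of (a i ≫ incl A (kerSub π)), a, e, fun _ => rfl, fun i j => ?_⟩
  have : hF.coef (a i ≫ e j) = if i = j then 1 else 0 := by
    have := congrFun (ha i) j
    rw [Pi.single_apply] at this
    exact this.trans (if_congr eq_comm rfl rfl)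
  rw [← hF.coef_smul (a i ≫ e j), this, ite_smul, one_smul, zero_smul]

end Dual

end IsFlatFibre

end Generators

/-! ### Generation of ker π and relations between the generators -/

section Generators

variable {O G : Type u} [CommRing O] [Group G] [TopologicalSpace G]
  {P : ObjectProperty (ProAug O G)} [IsDualCat P] {k : Type u} [Field k]
  [Linear k P.FullSubcategory] {A S Q : P.FullSubcategory} {π : A ⟶ Q} {q : Q ⟶ S}

open DualCat

/-- The value of an endomorphism at an element. -/
abbrev DualCat.app (g : End A) (x : A.obj) : A.obj := (End.asHom g).hom x

namespace IsFlatFibre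

variable {hF : IsFlatFibre k π q}

section

variable {I : Type} [Fintype I] [DecidableEq I]

/-- Nakayama: otherwise a nonzero map from N to a simple object, necessarily S, kills every `a i`.
Its coordinates in the basis `e` are its values on the `a i`, hence zero. -/
lemma surjective_desc {a : I → (A ⟶ sub A (kerSub π))}
    {e : Module.Basis I k (sub A (kerSub π) ⟶ S)}
    (hae : ∀ i j, a i ≫ e j = if i = j then π ≫ q else 0) (hF : IsFlatFibre k π q) :
    Function.Surjective (biproduct.desc a).hom := by
  by_contra hcon
  obtain ⟨S', g, hS', hg, h0⟩ := exists_simple_quotient _ hcon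
  obtain ⟨u⟩ := hF.nonempty_iso S' g hg
  have h1 : ∀ i, a i ≫ g = 0 := fun i => by
    rw [← biproduct.ι_desc a i, Category.assoc, h0, comp_zero]
  have h2 := e.sum_repr (g ≫ u.inv)
  have h3 : ∀ i, e.repr (g ≫ u.inv) i = 0 := fun i => by
    have : a i ≫ ∑ j, e.repr (g ≫ u.inv) j • e j = e.repr (g ≫ u.inv) i • (π ≫ q) := by
      rw [Preadditive.comp_sum]
      simp only [Linear.comp_smul, hae]
      simp
    rw [h2, reassoc_of% h1 i, zero_comp] at this
    exact (smul_eq_zero.1 this.symm).resolve_right hF.comp_ne_zero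
  refine hg ?_
  have h4 : g ≫ u.inv = 0 := by rw [← h2]; simp [h3]
  simpa using congrArg (· ≫ u.hom) h4

variable {f : I → End A}

lemma IsDualGen.π_app (hf : hF.IsDualGen f) (i : I) (x : A.obj) :
    π.hom (app (f i) x) = 0 := by
  obtain ⟨a, e, hfa, -⟩ := hf
  rw [hfa]
  exact apply_incl π _

lemma IsDualGen.residue_eq_zero (hf : hF.IsDualGen f) (i : I) : hF.residue (f i) = 0 := by
  rw [residue_apply, show End.asHom (f i) ≫ π ≫ q = 0 from DualCat.ext fun x =>
    (congrArg q.hom (hf.π_app i x)).trans (DualCat.map_zero q), map_zero]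

lemma IsDualGen.exists_sum (hf : hF.IsDualGen f) {x : A.obj} (hx : π.hom x = 0) :
    ∃ p : I → A.obj, x = ∑ i, app (f i) (p i) := by
  obtain ⟨a, e, hfa, hae⟩ := hf
  obtain ⟨y, rfl⟩ := exists_incl_eq (mem_kerSub.2 hx)
  obtain ⟨z, rfl⟩ := surjective_desc hae hF y
  refine ⟨fun i => (biproduct.π (fun _ : I => A) i).hom z, ?_⟩
  rw [desc_apply, DualCat.map_sum]
  refine Finset.sum_congr rfl fun i _ => ?_
  rw [hfa]
  rfl

lemma comp_π_eq_zero (hF : IsFlatFibre k π q) {g : End A} (hg : hF.residue g = 0) :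
    End.asHom g ≫ π = 0 := by
  refine hF.eq_zero _ ?_
  rw [Category.assoc, ← residue_smul hF, hg, zero_smul]

/-- An endomorphism of residue zero has image in N, and projectivity lifts it along A^I → N. Thus
the `f i` generate the kernel of the residue character as a right ideal. -/
lemma IsDualGen.exists_eq_sum (hf : hF.IsDualGen f) {g : End A} (hg : hF.residue g = 0) :
    ∃ h : I → End A, g = ∑ i, f i * h i := by
  obtain ⟨a, e, hfa, hae⟩ := hf
  have := hF.envelope.projective
  obtain ⟨l, hl⟩ := DualCat.exists_lift (incl A (kerSub π)) (incl_injective _) (End.asHom g)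
    fun z => exists_incl_eq (mem_kerSub.2 (DualCat.ext_iff.1 (comp_π_eq_zero hF hg) z))
  have := epi_of_surjective _ (surjective_desc hae hF)
  obtain ⟨t, rfl⟩ : ∃ t, t ≫ biproduct.desc a = l := ⟨_, Projective.factorThru_comp _ _⟩
  refine ⟨fun i => End.of (t ≫ biproduct.π _ i), ?_⟩
  change End.asHom g = _
  rw [← hl, comp_desc, Preadditive.sum_comp]
  refine Finset.sum_congr rfl fun i _ => ?_
  rw [hfa, End.mul_def]
  exact Category.assoc _ _ _

/-- On the kernel of A^I → N, the i-th coordinate followed by π ≫ q equals the map to N followed by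
`e i`, so it is zero; `eq_zero_of_ker` removes the q. -/
lemma IsDualGen.π_eq_zero (hf : hF.IsDualGen f) {p : I → A.obj}
    (hp : ∑ i, app (f i) (p i) = 0) (i : I) : π.hom (p i) = 0 := by
  obtain ⟨a, e, hfa, hae⟩ := hf
  have hs := surjective_desc hae hF
  have hy : (biproduct.desc a).hom (biprodMk p) = 0 := by
    refine incl_injective (kerSub π) ?_
    rw [desc_biprodMk, DualCat.map_sum, DualCat.map_zero, ← hp]
    refine Finset.sum_congr rfl fun i _ => ?_
    rw [hfa]
    rfl
  obtain ⟨y, hy⟩ := exists_incl_eq (mem_kerSub.2 hy)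
  have h1 : biproduct.π (fun _ : I => A) i ≫ π ≫ q = biproduct.desc a ≫ e i := by
    refine biproduct.hom_ext' _ _ fun j => ?_
    rw [biproduct.ι_desc_assoc, hae, biproduct.ι_π_assoc]
    split_ifs with h
    · subst h; simp
    · simp
  have h2 := hF.eq_zero_of_ker a hs (incl _ _ ≫ biproduct.π (fun _ : I => A) i ≫ π) (by
    rw [Category.assoc, Category.assoc, h1, ← Category.assoc, incl_comp, zero_comp])
  have h3 := DualCat.ext_iff.1 h2 y
  rw [DualCat.comp_apply, hy, DualCat.comp_apply, π_biprodMk] at h3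
  exact h3

/-- `relForms` only tests relations with coefficients in End A; this passes to coefficients in A. If
the functional were nonzero on the kernel of m, π ≫ q would lift to a map from A to that kernel,
whose coordinates form a relation in End A contradicting the choice of b. -/
lemma relForms_apply (hF : IsFlatFibre k π q) {b : Matrix I I k}
    (hb : b ∈ relForms hF.residue f) {p : I → I → A.obj}
    (hp : ∑ i, ∑ j, app (f i) (app (f j) (p i j)) = 0) :
    ∑ i, ∑ j, (b i j • (π ≫ q)).hom (p i j) = 0 := by
  have := hF.simple
  have := hF.envelope.projective
  let m : (⨁ fun _ : I × I => A) ⟶ A :=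
    biproduct.desc fun ij => End.asHom (f ij.1 * f ij.2)
  let Λ : (⨁ fun _ : I × I => A) ⟶ S := biproduct.desc fun ij => b ij.1 ij.2 • (π ≫ q)
  have key : incl _ (kerSub m) ≫ Λ = 0 := by
    by_contra hne
    have := epi_of_nonzero_to_simple hne
    obtain ⟨t, ht1, ht2⟩ : ∃ t : A ⟶ ⨁ fun _ : I × I => A, t ≫ m = 0 ∧ t ≫ Λ = π ≫ q :=
      ⟨Projective.factorThru (π ≫ q) (incl _ (kerSub m) ≫ Λ) ≫ incl _ (kerSub m),
        by rw [Category.assoc, incl_comp, comp_zero],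
        by rw [Category.assoc, Projective.factorThru_comp]⟩
    let h : I → I → End A := fun i j => End.of (t ≫ biproduct.π (fun _ : I × I => A) (i, j))
    have h1 : ∑ i, ∑ j, f i * f j * h i j = 0 := by
      rw [show m = _ from rfl, comp_desc, Fintype.sum_prod_type] at ht1
      exact ht1
    have h2 := hb h h1
    refine hF.comp_ne_zero (ht2.symm.trans ?_)
    rw [show Λ = _ from rfl, comp_desc, Fintype.sum_prod_type]
    have h3 : ∀ i j, (t ≫ biproduct.π (fun _ : I × I => A) (i, j)) ≫
        (b i j • (π ≫ q)) = (b i j * hF.residue (h i j)) • (π ≫ q) := fun i j => by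
      rw [mul_smul, hF.residue_smul, Linear.comp_smul]
    simp only [h3, ← Finset.sum_smul, h2, zero_smul]
  have hy : m.hom (biprodMk fun ij => p ij.1 ij.2) = 0 := by
    rw [desc_biprodMk, Fintype.sum_prod_type]
    exact hp
  obtain ⟨y, hy⟩ := exists_incl_eq (mem_kerSub.2 hy)
  have h4 := DualCat.ext_iff.1 key y
  rw [DualCat.comp_apply, hy, desc_biprodMk, Fintype.sum_prod_type] at h4
  exact h4

end

end IsFlatFibre

end Generators

/-! ### The extension T of Q by a power of Q, and Ext¹(T, S) -/

section Generators

variable {O G : Type u} [CommRing O] [Group G] [TopologicalSpace G]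
  {P : ObjectProperty (ProAug O G)} [IsDualCat P] {k : Type u} [Field k]
  [Linear k P.FullSubcategory] {A S Q : P.FullSubcategory} {π : A ⟶ Q} {q : Q ⟶ S}

open DualCat

namespace IsFlatFibre

variable {hF : IsFlatFibre k π q} {I₁ I₂ : Type} [Fintype I₁] [Fintype I₂] [DecidableEq I₁]
  [DecidableEq I₂] {f : I₁ ⊕ I₂ → End A}

/-- The family of the `f i`, `i ∈ I₂`, and of all products `f i * f j`. -/
def genFamily (f : I₁ ⊕ I₂ → End A) : I₂ ⊕ (I₁ ⊕ I₂) × (I₁ ⊕ I₂) → (A ⟶ A) :=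
  Sum.elim (fun i => End.asHom (f (Sum.inr i))) fun ij => End.asHom (f ij.1 * f ij.2)

/-- The sum of the images of the `f i`, `i ∈ I₂`, and of all products `f i * f j`. -/
noncomputable def genSub (f : I₁ ⊕ I₂ → End A) : A.obj.Sub :=
  ProAug.Sub.range (biproduct.desc (genFamily f)).hom

lemma desc_genFamily (z : (⨁ fun _ : I₂ ⊕ (I₁ ⊕ I₂) × (I₁ ⊕ I₂) => A).obj) :
    (biproduct.desc (genFamily f)).hom z =
      ∑ i, app (f (Sum.inr i)) ((biproduct.π (fun _ => A) (Sum.inl i)).hom z) +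
        ∑ i, ∑ j, app (f i) (app (f j) ((biproduct.π (fun _ => A) (Sum.inr (i, j))).hom z)) := by
  rw [desc_apply, Fintype.sum_sum_type, Fintype.sum_prod_type]
  rfl

lemma mem_genSub {x : A.obj} : x ∈ genSub f ↔ ∃ (c : I₂ → A.obj)
    (p : I₁ ⊕ I₂ → I₁ ⊕ I₂ → A.obj),
    x = ∑ i, app (f (Sum.inr i)) (c i) + ∑ i, ∑ j, app (f i) (app (f j) (p i j)) := by
  constructor
  · rintro ⟨z, rfl⟩
    exact ⟨_, _, desc_genFamily z⟩
  · rintro ⟨c, p, rfl⟩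
    refine ⟨biprodMk (Sum.elim c fun ij => p ij.1 ij.2), (desc_genFamily _).trans ?_⟩
    simp only [π_biprodMk, Sum.elim_inl, Sum.elim_inr]

lemma app_sum (g : End A) {J : Type*} (s : Finset J) (x : J → A.obj) :
    app g (∑ j ∈ s, x j) = ∑ j ∈ s, app g (x j) := DualCat.map_sum _ _ _

lemma app_add (g : End A) (x y : A.obj) : app g (x + y) = app g x + app g y :=
  DualCat.map_add _ _ _

/-- Elements `u i`, `v i j` with `∑ f i (u i) + ∑ f i (f j (v i j)) = 0`. -/
lemma IsDualGen.exists_sum_of_eq_zero (hf : hF.IsDualGen f) {c : I₁ ⊕ I₂ → A.obj}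
    {p : I₁ ⊕ I₂ → I₁ ⊕ I₂ → A.obj}
    (h : ∑ i, app (f i) (c i) + ∑ i, ∑ j, app (f i) (app (f j) (p i j)) = 0) (i : I₁ ⊕ I₂) :
    π.hom (c i) = 0 := by
  have h1 : ∑ i, app (f i) (c i + ∑ j, app (f j) (p i j)) = 0 := by
    rw [← h, ← Finset.sum_add_distrib]
    refine Finset.sum_congr rfl fun i _ => ?_
    rw [app_add, app_sum]
  have h2 := hf.π_eq_zero h1 i
  rw [DualCat.map_add, DualCat.map_sum] at h2
  simpa only [hf.π_app, Finset.sum_const_zero, add_zero] using h2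

lemma IsDualGen.π_genSub (hf : hF.IsDualGen f) {x : A.obj} (hx : x ∈ genSub f) :
    π.hom x = 0 := by
  obtain ⟨c, p, rfl⟩ := mem_genSub.1 hx
  rw [DualCat.map_add, DualCat.map_sum, DualCat.map_sum]
  simp only [hf.π_app, DualCat.map_sum, Finset.sum_const_zero, add_zero]

/-- The quotient by `genSub f` is an extension of `Q` by a power of `Q`. -/
lemma IsDualGen.exists_shortExact (hf : hF.IsDualGen f) :
    ∃ (i : (⨁ fun _ : I₁ => Q) ⟶ quot A (genSub f)) (t : quot A (genSub f) ⟶ Q)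
      (w : i ≫ t = 0), (ShortComplex.mk i t w).ShortExact := by
  obtain ⟨t, ht⟩ := exists_desc (proj A (genSub f)) (proj_surjective _) π
    fun x hx => hf.π_genSub (proj_eq_zero.1 hx)
  -- Since N is the sum of the images of the `f j`, the map `f i` sends N into the products and
  -- induces a map from Q to the quotient.
  have hex : ∀ i : I₁, ∃ l : Q ⟶ quot A (genSub f),
      π ≫ l = End.asHom (f (Sum.inl i)) ≫ proj A (genSub f) := fun i => by
    refine exists_desc π hF.surjective _ fun x hx => proj_eq_zero.2 (mem_genSub.2 ?_)
    obtain ⟨p, rfl⟩ := hf.exists_sum hx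
    refine ⟨0, fun l j => if l = Sum.inl i then p j else 0, ?_⟩
    simp only [Pi.zero_apply, DualCat.map_zero, Finset.sum_const_zero, zero_add]
    refine Eq.trans ?_ (Finset.sum_eq_single (Sum.inl i) (fun l _ hl => ?_) (by simp)).symm
    · simp only [if_true]
      exact app_sum _ _ _
    · simp only [if_neg hl, DualCat.map_zero, Finset.sum_const_zero]
  choose l hl using hex
  have hl' : ∀ i x, (l i).hom (π.hom x) = (proj A (genSub f)).hom (app (f (Sum.inl i)) x) :=
    fun i x => DualCat.ext_iff.1 (hl i) x
  have ht' : ∀ x, t.hom ((proj A (genSub f)).hom x) = π.hom x := DualCat.ext_iff.1 ht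
  have hw : biproduct.desc l ≫ t = 0 := by
    refine biproduct.hom_ext' _ _ fun i => DualCat.ext fun y => ?_
    obtain ⟨x, rfl⟩ := hF.surjective y
    rw [biproduct.ι_desc_assoc, DualCat.comp_apply, hl', ht', hf.π_app, comp_zero, DualCat.zero_apply]
  refine ⟨biproduct.desc l, t, hw, DualCat.shortExact ?_ ?_ ?_ hw⟩
  -- Injectivity is where the flatness property enters, through `exists_sum_of_eq_zero`.
  · refine injective_of_eq_zero _ fun z hz => biprod_ext fun i => ?_
    choose p hp using fun i => hF.surjective ((biproduct.π (fun _ : I₁ => Q) i).hom z)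
    rw [desc_apply] at hz
    simp only [← hp, hl'] at hz
    rw [← DualCat.map_sum, proj_eq_zero, mem_genSub] at hz
    obtain ⟨c, r, hcr⟩ := hz
    have := hf.exists_sum_of_eq_zero (c := Sum.elim (fun i => -p i) c) (p := r) (by
      rw [Fintype.sum_sum_type]
      simp only [Sum.elim_inl, Sum.elim_inr, DualCat.map_neg, Finset.sum_neg_distrib]
      rw [hcr]
      abel) (Sum.inl i)
    rw [Sum.elim_inl, DualCat.map_neg, neg_eq_zero] at this
    rw [← hp, this, DualCat.map_zero]
  · intro y
    obtain ⟨x, rfl⟩ := hF.surjective y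
    exact ⟨_, ht' x⟩
  · intro y hy
    obtain ⟨x, rfl⟩ := proj_surjective _ y
    rw [ht'] at hy
    obtain ⟨p, rfl⟩ := hf.exists_sum hy
    refine ⟨biprodMk fun i => π.hom (p (Sum.inl i)), ?_⟩
    rw [desc_biprodMk]
    simp only [hl']
    rw [← DualCat.map_sum, ← sub_eq_zero, ← DualCat.map_sub, proj_eq_zero, mem_genSub]
    refine ⟨fun i => -p (Sum.inr i), 0, ?_⟩
    rw [Fintype.sum_sum_type]
    simp [DualCat.map_neg]

lemma IsDualGen.finrank_hom_eq_one (hf : hF.IsDualGen f) :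
    Module.finrank k (quot A (genSub f) ⟶ S) = 1 := by
  obtain ⟨l, hl⟩ := exists_desc (proj A (genSub f)) (proj_surjective _) (π ≫ q)
    fun x hx => (congrArg q.hom (hf.π_genSub (proj_eq_zero.1 hx))).trans (DualCat.map_zero q)
  refine finrank_eq_one_iff'.2 ⟨l, ?_, fun g => ⟨hF.coef (proj A (genSub f) ≫ g), ?_⟩⟩
  · rintro rfl
    exact hF.comp_ne_zero (by rw [← hl, comp_zero])
  · rw [← cancel_epi (proj A (genSub f)), Linear.comp_smul, hl, hF.coef_smul]

/-- `genSub f` lies in ker π, hence in the radical of A, so maps A → S restrict to zero on it and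
dimension shifting is an isomorphism. -/
lemma IsDualGen.nonempty_linearEquiv (hf : hF.IsDualGen f) :
    Nonempty ((sub A (genSub f) ⟶ S) ≃ₗ[k] Abelian.Ext.{u + 1} (quot A (genSub f)) S 1) := by
  have := hF.simple
  have : Projective (ShortComplex.mk _ _ (incl_proj (genSub f))).X₂ := hF.envelope.projective
  refine nonempty_linearEquiv_ext_one (shortExact_proj (genSub f)) k fun g => ?_
  refine DualCat.ext fun x => hF.envelope.eq_zero_of_simple g ?_
  exact (congrArg q.hom (hf.π_genSub (incl_mem _ x))).trans (DualCat.map_zero q)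

/-- Maps from `genSub f` to S embed by `ρ` into vectors on I₂ times matrices, through their values
on the generators `f i` and `f i * f j`. The image contains every pair (c, b) with b in X, because
such a pair is compatible with all relations between these generators. -/
lemma IsDualGen.le_finrank_hom (hf : hF.IsDualGen f)
    (X : Submodule k (Matrix (I₁ ⊕ I₂) (I₁ ⊕ I₂) k)) (hX : X ≤ relForms hF.residue f)
    (hX0 : ∀ b ∈ X, ∀ i j, b (Sum.inr i) j = 0) :
    Fintype.card I₂ + Module.finrank k X ≤ Module.finrank k (sub A (genSub f) ⟶ S) := by
  obtain ⟨m, hm⟩ := DualCat.exists_lift (incl A (genSub f)) (incl_injective _)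
    (biproduct.desc (genFamily f)) fun z => exists_incl_eq ⟨z, rfl⟩
  have hms : Function.Surjective m.hom := fun y => by
    obtain ⟨z, hz⟩ := incl_mem (genSub f) y
    exact ⟨z, incl_injective _ ((DualCat.ext_iff.1 hm z).trans hz)⟩
  have hme := epi_of_surjective m hms
  let ρ : (sub A (genSub f) ⟶ S) →ₗ[k] (I₂ → k) × Matrix (I₁ ⊕ I₂) (I₁ ⊕ I₂) k :=
    LinearMap.prod
      (LinearMap.pi fun i => hF.coef.toLinearMap.comp
        (Linear.leftComp k S (biproduct.ι (fun _ => A) (Sum.inl i) ≫ m)))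
      (LinearMap.pi fun i => LinearMap.pi fun j => hF.coef.toLinearMap.comp
        (Linear.leftComp k S (biproduct.ι (fun _ => A) (Sum.inr (i, j)) ≫ m)))
  have hρ1 : ∀ g i, (ρ g).1 i = hF.coef ((biproduct.ι (fun _ => A) (Sum.inl i) ≫ m) ≫ g) :=
    fun g i => rfl
  have hρ2 : ∀ g i j, (ρ g).2 i j =
      hF.coef ((biproduct.ι (fun _ => A) (Sum.inr (i, j)) ≫ m) ≫ g) := fun g i j => rfl
  have hinj : Function.Injective ρ := by
    refine (injective_iff_map_eq_zero ρ).2 fun g hg => ?_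
    rw [← cancel_epi m, comp_zero]
    refine biproduct.hom_ext' _ _ fun t => ?_
    rw [comp_zero, ← Category.assoc]
    refine hF.coef.injective ?_
    rw [map_zero]
    rcases t with i | ⟨i, j⟩
    · rw [← hρ1, hg]; rfl
    · rw [← hρ2, hg]; rfl
  let σ : (I₂ → k) × X →ₗ[k] (I₂ → k) × Matrix (I₁ ⊕ I₂) (I₁ ⊕ I₂) k :=
    LinearMap.prodMap LinearMap.id X.subtype
  have hσ : Function.Injective σ := Function.injective_id.prodMap Subtype.val_injective
  have hle : LinearMap.range σ ≤ LinearMap.range ρ := by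
    rintro _ ⟨⟨c, b, hb⟩, rfl⟩
    let Λ : (⨁ fun _ : I₂ ⊕ (I₁ ⊕ I₂) × (I₁ ⊕ I₂) => A) ⟶ S :=
      biproduct.desc (Sum.elim (fun i => c i • (π ≫ q)) fun ij => b ij.1 ij.2 • (π ≫ q))
    obtain ⟨g, hg⟩ := exists_desc m hms Λ fun z hz => by
      have hz' : (biproduct.desc (genFamily f)).hom z = 0 := by
        rw [← hm, DualCat.comp_apply, hz, DualCat.map_zero]
      rw [desc_genFamily] at hz'
      rw [desc_apply, Fintype.sum_sum_type, Fintype.sum_prod_type]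
      generalize hu : (fun i => (biproduct.π (fun _ => A) (Sum.inl i)).hom z) = u at hz' ⊢
      have hu : ∀ i, (biproduct.π (fun _ => A) (Sum.inl i)).hom z = u i := congrFun hu
      generalize hv : (fun i j => (biproduct.π (fun _ => A) (Sum.inr (i, j))).hom z) = v at hz' ⊢
      have hv : ∀ i j, (biproduct.π (fun _ => A) (Sum.inr (i, j))).hom z = v i j :=
        fun i j => congrFun (congrFun hv i) j
      simp only [hu, hv, Sum.elim_inl, Sum.elim_inr] at hz' ⊢
      have hπu : ∀ i, π.hom (u i) = 0 := fun i =>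
        hf.exists_sum_of_eq_zero (c := Sum.elim (fun _ => 0) u) (p := v) (by
          rw [Fintype.sum_sum_type]
          simpa using hz') (Sum.inr i)
      -- The linear coefficients lie in ker π, so they are absorbed into the rows of `v` indexed by
      -- I₂, leaving a purely quadratic relation. As b is zero on those rows, the correction `w`
      -- does not contribute.
      choose w hw using fun i => hf.exists_sum (hπu i)
      have h1 := relForms_apply hF (hX hb) (p := Sum.elim (fun _ _ => 0) w + v) (by
        refine Eq.trans ?_ hz'
        simp only [Pi.add_apply, app_add, Finset.sum_add_distrib]
        congr 1
        rw [Fintype.sum_sum_type]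
        simp only [Sum.elim_inl, Sum.elim_inr, DualCat.map_zero, Finset.sum_const_zero, zero_add]
        refine Finset.sum_congr rfl fun i _ => ?_
        rw [← app_sum, ← hw])
      have h2 : ∀ i j, (b i j • (π ≫ q)).hom ((Sum.elim (fun _ _ => 0) w + v : _ → _ → A.obj) i j) =
          (b i j • (π ≫ q)).hom (v i j) := by
        rintro (i | i) j
        · simp
        · rw [hX0 b hb, zero_smul]; rfl
      simp only [h2] at h1
      rw [h1, add_zero]
      refine Finset.sum_eq_zero fun i _ => ?_
      rw [← hF.coef_smul (c i • (π ≫ q)), ← Linear.comp_smul, DualCat.comp_apply, hπu,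
        DualCat.map_zero]
    refine ⟨g, Prod.ext (funext fun i => ?_) (funext fun i => funext fun j => ?_)⟩
    · rw [hρ1, Category.assoc, hg, biproduct.ι_desc, Sum.elim_inl, map_smul, hF.coef_comp,
        smul_eq_mul, mul_one]
      rfl
    · rw [hρ2, Category.assoc, hg, biproduct.ι_desc, Sum.elim_inr, map_smul, hF.coef_comp,
        smul_eq_mul, mul_one]
      rfl
  have h3 := Submodule.finrank_mono hle
  rw [LinearMap.finrank_range_of_inj hσ, LinearMap.finrank_range_of_inj hinj,
    Module.finrank_prod, Module.finrank_fintype_fun_eq_card] at h3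
  exact h3

end IsFlatFibre

end Generators

/-! ### Isotropic subspaces and symmetric matrices -/

section LinearAlgebra

open Matrix

variable {k : Type*} [Field k]

/-- While 2 dim W < dim V, the orthogonal of W is too large to lie in W, and any vector of it
outside W enlarges W because β is alternating. The `+ 1` admits the value n = ⌈dim V / 2⌉. -/
lemma exists_isotropic_submodule {V : Type*} [AddCommGroup V] [Module k V] [FiniteDimensional k V]
    {β : LinearMap.BilinForm k V} (hβ : β.IsAlt) (n : ℕ) (hn : 2 * n ≤ Module.finrank k V + 1) :
    ∃ W : Submodule k V, Module.finrank k W = n ∧ ∀ v ∈ W, ∀ w ∈ W, β v w = 0 := by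
  induction n with
  | zero => exact ⟨⊥, finrank_bot k V, fun v hv w hw => by
      rw [(Submodule.mem_bot k).1 hv, map_zero, LinearMap.zero_apply]⟩
  | succ n ih =>
    obtain ⟨W, hW, hiso⟩ := ih (by omega)
    have h1 := LinearMap.BilinForm.finrank_add_finrank_orthogonal hβ.isRefl W
    have hnot : ¬ β.orthogonal W ≤ W := fun h => by
      have := Submodule.finrank_mono h
      omega
    obtain ⟨v, hv, hvW⟩ := Set.not_subset.1 hnot
    have hvW' : ∀ w ∈ W, β w v = 0 := fun w hw => hv w hw
    have hWv : ∀ w ∈ W, β v w = 0 := fun w hw => hβ.isRefl w v (hvW' w hw)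
    refine ⟨W ⊔ Submodule.span k {v}, le_antisymm ?_ ?_, ?_⟩
    · refine (Submodule.finrank_add_le_finrank_add_finrank W _).trans ?_
      rw [hW, finrank_span_singleton (fun h => hvW (by rw [h]; exact W.zero_mem))]
    · rw [← hW]
      refine Submodule.finrank_lt_finrank_of_lt (lt_of_le_of_ne le_sup_left fun h => hvW ?_)
      rw [h]
      exact Submodule.mem_sup_right (Submodule.mem_span_singleton_self v)
    · intro x hx y hy
      obtain ⟨w, hw, z, hz, rfl⟩ := Submodule.mem_sup.1 hx
      obtain ⟨w', hw', z', hz', rfl⟩ := Submodule.mem_sup.1 hy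
      obtain ⟨a, rfl⟩ := Submodule.mem_span_singleton.1 hz
      obtain ⟨b, rfl⟩ := Submodule.mem_span_singleton.1 hz'
      simp [hiso w hw w' hw', hvW' w hw, hWv w' hw', hβ v]

lemma exists_isotropic_basis {V : Type*} [AddCommGroup V] [Module k V] [FiniteDimensional k V]
    {β : LinearMap.BilinForm k V} (hβ : β.IsAlt) {d : ℕ} (hd : Module.finrank k V = d) :
    ∃ e : Module.Basis (Fin (d / 2) ⊕ Fin (d - d / 2)) k V,
      ∀ i j, β (e (Sum.inr i)) (e (Sum.inr j)) = 0 := by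
  obtain ⟨W, hW, hiso⟩ := exists_isotropic_submodule hβ (d - d / 2) (by omega)
  obtain ⟨W', hW'⟩ := W.exists_isCompl
  have hfr := Submodule.finrank_add_eq_of_isCompl hW'
  refine ⟨((Module.finBasisOfFinrankEq k W' (by omega)).prod
    (Module.finBasisOfFinrankEq k W hW)).map (Submodule.prodEquivOfIsCompl W' W hW'.symm),
    fun i j => ?_⟩
  simp [hiso]

variable {d : ℕ}

/-- A space of matrices containing all symmetric ones, in which the matrices with many zero rows
form a small subspace, in every basis, consists of symmetric matrices. -/
lemma isSymm_of_finrank_le (F : Submodule k (Matrix (Fin d) (Fin d) k))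
    (hsym : ∀ b : Matrix (Fin d) (Fin d) k, b.IsSymm → b ∈ F)
    (H : ∀ (A : Matrix (Fin (d / 2) ⊕ Fin (d - d / 2)) (Fin d) k)
      (D : Matrix (Fin d) (Fin (d / 2) ⊕ Fin (d - d / 2)) k), A * D = 1 → D * A = 1 →
      ∀ X : Submodule k (Matrix (Fin (d / 2) ⊕ Fin (d - d / 2)) (Fin (d / 2) ⊕ Fin (d - d / 2)) k),
      (∀ b ∈ X, D * b * Dᵀ ∈ F) → (∀ b ∈ X, ∀ i j, b (Sum.inr i) j = 0) →
      d - d / 2 + Module.finrank k X ≤ d / 2 * (d / 2 - 1) / 2 + d)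
    {b : Matrix (Fin d) (Fin d) k} (hb : b ∈ F) : b.IsSymm := by
  by_contra hns
  have hβ : (Matrix.toBilin' (b - bᵀ)).IsAlt := fun v => by
    rw [Matrix.toBilin'_apply', sub_mulVec, dotProduct_sub, mulVec_transpose,
      dotProduct_comm v (v ᵥ* b), ← dotProduct_mulVec, sub_self]
  obtain ⟨e, he⟩ := exists_isotropic_basis hβ (Module.finrank_fin_fun k)
  let A : Matrix (Fin (d / 2) ⊕ Fin (d - d / 2)) (Fin d) k := Matrix.of fun i j => e i j
  have hA : A = ((Pi.basisFun k (Fin d)).toMatrix e)ᵀ := by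
    ext i j
    simp [A, Module.Basis.toMatrix_apply]
  let D : Matrix (Fin d) (Fin (d / 2) ⊕ Fin (d - d / 2)) k := (e.toMatrix (Pi.basisFun k (Fin d)))ᵀ
  have hAD : A * D = 1 := by
    rw [hA, ← transpose_mul, Module.Basis.toMatrix_mul_toMatrix_flip, transpose_one]
  have hDA : D * A = 1 := by
    rw [hA, ← transpose_mul, Module.Basis.toMatrix_mul_toMatrix_flip, transpose_one]
  have hDAT : Aᵀ * Dᵀ = 1 := by rw [← transpose_mul, hDA, transpose_one]
  -- The Gram matrix of b in the basis `e`.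
  let b' := A * b * Aᵀ
  have hb' : D * b' * Dᵀ = b := by
    calc D * b' * Dᵀ = (D * A) * b * (Aᵀ * Dᵀ) := by simp only [b', Matrix.mul_assoc]
      _ = b := by rw [hDA, hDAT, Matrix.one_mul, Matrix.mul_one]
  have hcongr : ∀ c : Matrix (Fin (d / 2) ⊕ Fin (d - d / 2)) (Fin (d / 2) ⊕ Fin (d - d / 2)) k,
      c.IsSymm → (D * c * Dᵀ).IsSymm := fun c hc => by
    rw [Matrix.IsSymm, transpose_mul, transpose_mul, transpose_transpose, hc.eq, Matrix.mul_assoc]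
  have hblock : ∀ i j, b' (Sum.inr i) (Sum.inr j) = b' (Sum.inr j) (Sum.inr i) := fun i j => by
    have h1 : ∀ x y, (A * (b - bᵀ) * Aᵀ) x y = b' x y - b' y x := fun x y => by
      have : A * (b - bᵀ) * Aᵀ = b' - b'ᵀ := by
        simp only [b', Matrix.mul_sub, Matrix.sub_mul, transpose_mul, transpose_transpose,
          Matrix.mul_assoc]
      rw [this]; rfl
    have h2 := he i j
    rw [Matrix.toBilin'_apply', dotProduct_mulVec] at h2
    have h3 := h1 (Sum.inr i) (Sum.inr j)
    have h4 : (A * (b - bᵀ) * Aᵀ) (Sum.inr i) (Sum.inr j) = 0 := h2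
    rw [h4] at h3
    exact (sub_eq_zero.1 h3.symm)
  -- Isotropy makes the lower right block of `b'` symmetric, so the lower rows of `b'` complete to a
  -- symmetric matrix. Subtracting it clears those rows and keeps the matrix non-symmetric.
  let s : Matrix (Fin (d / 2) ⊕ Fin (d - d / 2)) (Fin (d / 2) ⊕ Fin (d - d / 2)) k :=
    Matrix.fromBlocks 0 b'.toBlocks₂₁ᵀ b'.toBlocks₂₁ b'.toBlocks₂₂
  have hs : s.IsSymm := by
    refine Matrix.IsSymm.fromBlocks (by simp [Matrix.IsSymm]) rfl ?_
    ext i j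
    exact hblock j i
  let c := b' - s
  have hc0 : ∀ i j, c (Sum.inr i) j = 0 := by
    rintro i (j | j) <;> simp [c, s, Matrix.toBlocks₂₁, Matrix.toBlocks₂₂]
  have hcF : D * c * Dᵀ ∈ F := by
    simp only [c, Matrix.mul_sub, Matrix.sub_mul]
    rw [hb']
    exact F.sub_mem hb (hsym _ (hcongr s hs))
  have hcns : ¬ c.IsSymm := fun h => hns (by
    have : b'.IsSymm := by
      rw [show b' = c + s by simp [c]]
      exact h.add hs
    rw [← hb']
    exact hcongr _ this)
  -- Symmetric matrices supported on the upper left block: a space of dimension r(r+1)/2. With the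
  -- line through `c` this is one dimension more than the bound allows.
  let Sm : (Sym2 (Fin (d / 2)) → k) →ₗ[k]
      Matrix (Fin (d / 2) ⊕ Fin (d - d / 2)) (Fin (d / 2) ⊕ Fin (d - d / 2)) k :=
    { toFun := fun g => Matrix.fromBlocks (Matrix.of fun i j => g s(i, j)) 0 0 0
      map_add' := fun g h => by
        ext (i | i) (j | j) <;> simp
      map_smul' := fun a g => by
        ext (i | i) (j | j) <;> simp }
  have hSm : ∀ g, (Sm g).IsSymm := fun g => by
    refine Matrix.IsSymm.fromBlocks ?_ (by simp) (by simp [Matrix.IsSymm])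
    ext i j
    simp [Sym2.eq_swap]
  let Ψ : (Sym2 (Fin (d / 2)) → k) × k →ₗ[k]
      Matrix (Fin (d / 2) ⊕ Fin (d - d / 2)) (Fin (d / 2) ⊕ Fin (d - d / 2)) k :=
    Sm.coprod (LinearMap.toSpanSingleton k _ c)
  have hΨ : ∀ g t, Ψ (g, t) = Sm g + t • c := fun g t => by simp [Ψ]
  have hinj : Function.Injective Ψ := by
    refine (injective_iff_map_eq_zero Ψ).2 ?_
    rintro ⟨g, t⟩ hgt
    rw [hΨ] at hgt
    have ht : t = 0 := by
      by_contra ht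
      refine hcns ?_
      have h1 : c = -(t⁻¹ • Sm g) := by
        rw [← smul_neg, eq_inv_smul_iff₀ ht, eq_neg_iff_add_eq_zero, add_comm, hgt]
      rw [h1]
      exact ((hSm g).smul _).neg
    subst ht
    rw [zero_smul, add_zero] at hgt
    have : g = 0 := by
      ext x
      induction x with
      | _ i j => exact congrFun (congrFun hgt (Sum.inl i)) (Sum.inl j)
    rw [this]; rfl
  have hH := H A D hAD hDA (LinearMap.range Ψ) (by
      rintro _ ⟨⟨g, t⟩, rfl⟩
      rw [hΨ, Matrix.mul_add, Matrix.add_mul, Matrix.mul_smul, Matrix.smul_mul]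
      exact F.add_mem (hsym _ (hcongr _ (hSm g))) (F.smul_mem t hcF)) (by
      rintro _ ⟨⟨g, t⟩, rfl⟩ i j
      rw [hΨ, Matrix.add_apply, Matrix.smul_apply, hc0]
      rcases j with j | j <;> simp [Sm])
  rw [LinearMap.finrank_range_of_inj hinj, Module.finrank_prod, Module.finrank_fintype_fun_eq_card,
    Sym2.card, Fintype.card_fin, Module.finrank_self, Nat.choose_two_right] at hH
  -- The case d / 2 = 0 is separate because `d / 2 - 1` is a truncated subtraction.
  rcases hr : d / 2 with _ | r
  · rw [hr] at hH
    simp at hH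
  · rw [hr] at hH
    simp only [Nat.add_sub_cancel] at hH
    have : (r + 1 + 1) * (r + 1) = (r + 1) * r + (r + 1) * 2 := by ring
    rw [this, Nat.add_mul_div_right _ _ two_pos] at hH
    omega

end LinearAlgebra

/-! ### Noncommutative rings with commuting leading terms -/

section Rings

variable {k E : Type*} [Field k] [Ring E] [Algebra k E] {d : ℕ}

/-- The filtration by the powers of the right ideal generated by a family. -/
def powFil (k : Type*) {E I : Type*} [Field k] [Ring E] [Algebra k E] [Fintype I] (f : I → E) :
    ℕ → Submodule k E
  | 0 => ⊤
  | n + 1 =>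
    { carrier := {g | ∃ h : I → E, (∀ i, h i ∈ powFil k f n) ∧ g = ∑ i, f i * h i}
      zero_mem' := ⟨0, fun _ => Submodule.zero_mem _, by simp⟩
      add_mem' := by
        rintro _ _ ⟨h, hh, rfl⟩ ⟨h', hh', rfl⟩
        exact ⟨h + h', fun i => Submodule.add_mem _ (hh i) (hh' i), by
          simp [mul_add, Finset.sum_add_distrib]⟩
      smul_mem' := by
        rintro a _ ⟨h, hh, rfl⟩
        exact ⟨a • h, fun i => Submodule.smul_mem _ a (hh i), by simp [Finset.smul_sum]⟩ }

variable {I : Type*} [Fintype I] {f : I → E}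

lemma mem_powFil_succ {n : ℕ} {g : E} : g ∈ powFil k f (n + 1) ↔
    ∃ h : I → E, (∀ i, h i ∈ powFil k f n) ∧ g = ∑ i, f i * h i := Iff.rfl

lemma mul_mem_powFil_succ [DecidableEq I] {n : ℕ} {g : E} (hg : g ∈ powFil k f n) (i : I) :
    f i * g ∈ powFil k f (n + 1) :=
  mem_powFil_succ.2 ⟨Pi.single i g, fun j => by
    by_cases h : j = i
    · subst h; simpa using hg
    · simp [h], by
    rw [Finset.sum_eq_single i (fun j _ hj => by simp [hj]) (by simp), Pi.single_eq_same]⟩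

variable {ε : E →ₐ[k] k} (hε : ∀ g, ε g = 0 → ∃ h : I → E, g = ∑ i, f i * h i)
  (hf : ∀ i, ε (f i) = 0)

include hε hf in
-- The filtration is built from right ideals; it is multiplicative because `g * f i` has residue
-- zero and can be rewritten with the generators on the left.
lemma mul_mem_powFil {n m : ℕ} {g h : E} (hg : g ∈ powFil k f n) (hh : h ∈ powFil k f m) :
    g * h ∈ powFil k f (n + m) := by
  classical
  induction n generalizing g with
  | zero =>
    rw [zero_add]
    clear hg
    induction m generalizing g h with
    | zero => trivial
    | succ m ih =>
      obtain ⟨h', hh', rfl⟩ := mem_powFil_succ.1 hh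
      rw [Finset.mul_sum]
      refine Submodule.sum_mem _ fun i _ => ?_
      obtain ⟨g', hg'⟩ := hε (g * f i) (by rw [map_mul, hf, mul_zero])
      rw [← mul_assoc, hg', Finset.sum_mul]
      refine Submodule.sum_mem _ fun j _ => ?_
      rw [mul_assoc]
      exact mul_mem_powFil_succ (ih (hh' i)) j
  | succ n ih =>
    obtain ⟨h', hh', rfl⟩ := mem_powFil_succ.1 hg
    rw [Finset.sum_mul, add_right_comm]
    refine Submodule.sum_mem _ fun i _ => ?_
    rw [mul_assoc]
    exact mul_mem_powFil_succ (ih (hh' i)) i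

include hε in
lemma mem_powFil_one {g : E} (hg : ε g = 0) : g ∈ powFil k f 1 := by
  obtain ⟨h, rfl⟩ := hε g hg
  exact mem_powFil_succ.2 ⟨h, fun _ => trivial, rfl⟩

include hε hf in
/-- If only symmetric forms extend to functionals on products, then the generators commute up to
terms of order three. -/
lemma commutator_mem [DecidableEq I] (hF : ∀ b ∈ relForms ε f, b.IsSymm) (i j : I) :
    f j * f i - f i * f j ∈ powFil k f 3 := by
  -- The residues of the coefficients of quadratic relations. Their annihilator is `relForms`, so by
  -- duality an array on which all symmetric matrices vanish lies in `Rel`.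
  let Rel : Submodule k (I → I → k) :=
    { carrier := {u | ∃ h : I → I → E, ∑ i, ∑ j, f i * f j * h i j = 0 ∧ ∀ i j, u i j = ε (h i j)}
      zero_mem' := ⟨0, by simp, by simp⟩
      add_mem' := by
        rintro u v ⟨h, hh, hu⟩ ⟨h', hh', hv⟩
        exact ⟨h + h', by simp [mul_add, Finset.sum_add_distrib, hh, hh'], by simp [hu, hv]⟩
      smul_mem' := by
        rintro a u ⟨h, hh, hu⟩
        exact ⟨a • h, by simp [← Finset.smul_sum, hh], by simp [hu]⟩ }
  let u : I → I → k := Pi.single j (Pi.single i 1) - Pi.single i (Pi.single j 1)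
  have hu : u ∈ Rel := by
    by_contra hu
    obtain ⟨θ, hθu, hθ⟩ := Submodule.exists_le_ker_of_notMem hu
    let b : Matrix I I k := Matrix.of fun x y => θ (Pi.single x (Pi.single y 1))
    have hθb : ∀ v : I → I → k, θ v = ∑ x, ∑ y, b x y * v x y := fun v => by
      have hv : v = ∑ x, ∑ y, v x y • (Pi.single x (Pi.single y (1 : k)) : I → I → k) := by
        ext x y
        simp only [Finset.sum_apply, Pi.smul_apply, Pi.single_apply, smul_eq_mul]
        rw [Finset.sum_eq_single x, Finset.sum_eq_single y] <;> simp +contextual [eq_comm]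
      conv_lhs => rw [hv]
      simp only [map_sum, map_smul, smul_eq_mul]
      exact Finset.sum_congr rfl fun x _ => Finset.sum_congr rfl fun y _ => mul_comm _ _
    have hb := hF b fun h hh => by
      have : θ (fun x y => ε (h x y)) = 0 := hθ ⟨h, hh, fun _ _ => rfl⟩
      rwa [hθb] at this
    refine hθu ?_
    have : θ u = b j i - b i j := by simp [u, b]
    rw [this, hb.apply, sub_self]
  obtain ⟨h, hh, hu⟩ := hu
  -- Replacing the coefficients of the relation by their residues yields the commutator; the error
  -- has coefficients of residue zero, hence order three.
  have h1 : f j * f i - f i * f j =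
      ∑ x, f x * ∑ y, f y * (algebraMap k E (ε (h x y)) - h x y) := by
    simp only [mul_sub, Finset.sum_sub_distrib, Finset.mul_sum, ← mul_assoc, hh, sub_zero, ← hu]
    have h2 : ∀ x y, f x * f y * algebraMap k E (u x y) = u x y • (f x * f y) := fun x y => by
      rw [Algebra.smul_def, Algebra.commutes]
    simp only [h2]
    simp only [u, Pi.sub_apply, sub_smul, Finset.sum_sub_distrib]
    have h3 : ∀ a c : I, ∑ x, ∑ y, (Pi.single a (Pi.single c 1) : I → I → k) x y • (f x * f y) =
        f a * f c := fun a c => by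
      rw [Finset.sum_eq_single a (fun x _ hx => by simp [hx]) (by simp),
        Finset.sum_eq_single c (fun x _ hx => by simp [hx]) (by simp)]
      simp
    rw [h3, h3]
  rw [h1]
  refine Submodule.sum_mem _ fun x _ => mul_mem_powFil_succ (Submodule.sum_mem _ fun y _ =>
    mul_mem_powFil_succ (mem_powFil_one hε ?_) y) x
  rw [map_sub, AlgHom.commutes]
  exact sub_self _

include hε hf in
lemma prod_mem_powFil (l : List I) : (l.map f).prod ∈ powFil k f l.length := by
  classical
  induction l with
  | nil => trivial
  | cons a l ih =>
    rw [List.map_cons, List.prod_cons]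
    exact mul_mem_powFil_succ ih a

include hε hf in
-- Swapping two adjacent factors introduces a commutator, of order three in place of two, so the
-- product changes by a term of order one more than its length.
lemma prod_sub_prod_mem (hcomm : ∀ i j, f j * f i - f i * f j ∈ powFil k f 3) {l l' : List I}
    (h : l.Perm l') : (l.map f).prod - (l'.map f).prod ∈ powFil k f (l.length + 1) := by
  classical
  induction h with
  | nil => simp
  | cons a _ ih =>
    simp only [List.map_cons, List.prod_cons, List.length_cons, ← mul_sub]
    exact mul_mem_powFil_succ ih a
  | swap a b l =>
    simp only [List.map_cons, List.prod_cons, List.length_cons, ← mul_assoc, ← sub_mul]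
    have := mul_mem_powFil hε hf (hcomm a b) (prod_mem_powFil hε hf l)
    rwa [show 3 + l.length = l.length + 1 + 1 + 1 by ring] at this
  | trans h1 h2 ih1 ih2 =>
    rw [← h1.length_eq] at ih2
    simpa using Submodule.add_mem _ ih1 ih2

include hε hf in
/-- Products in sorted order span the graded pieces. -/
lemma powFil_le (hcomm : ∀ i j, f j * f i - f i * f j ∈ powFil k f 3) (n : ℕ) :
    powFil k f n ≤ Submodule.span k (Set.range fun s : Sym I n =>
      (((s : Multiset I).toList).map f).prod) ⊔ powFil k f (n + 1) := by
  classical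
  induction n with
  | zero =>
    intro g _
    have h1 : g = ε g • (1 : E) + (g - ε g • (1 : E)) := by abel
    rw [h1]
    refine Submodule.add_mem_sup (Submodule.smul_mem _ _ (Submodule.subset_span ⟨Sym.nil, ?_⟩))
      (mem_powFil_one hε ?_)
    · simp
    · simp
  | succ n ih =>
    rintro g ⟨h, hh, rfl⟩
    refine Submodule.sum_mem _ fun i _ => ?_
    have h1 := Submodule.mem_map_of_mem (f := LinearMap.mulLeft k (f i)) (ih (hh i))
    rw [Submodule.map_sup, Submodule.map_span] at h1
    refine (sup_le (Submodule.span_le.2 ?_) ?_ :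
      _ ≤ Submodule.span k (Set.range fun s : Sym I (n + 1) =>
      (((s : Multiset I).toList).map f).prod) ⊔ powFil k f (n + 1 + 1)) h1
    · rintro _ ⟨_, ⟨s, rfl⟩, rfl⟩
      -- Putting i in front of the chosen ordering of s need not give the chosen ordering of i ::ₛ
      -- s; reordering costs only a term of order n + 2.
      have hp : (i :: (s : Multiset I).toList).Perm ((i ::ₛ s : Sym I (n + 1)) : Multiset I).toList := by
        rw [← Multiset.coe_eq_coe, ← Multiset.cons_coe, Multiset.coe_toList, Multiset.coe_toList,
          Sym.coe_cons]
      have h2 := prod_sub_prod_mem hε hf hcomm hp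
      rw [List.length_cons, Multiset.length_toList, Sym.card_coe] at h2
      have h3 : (LinearMap.mulLeft k (f i)) (((s : Multiset I).toList.map f).prod) =
          ((((i ::ₛ s : Sym I (n + 1)) : Multiset I).toList).map f).prod +
          (((i :: (s : Multiset I).toList).map f).prod -
          ((((i ::ₛ s : Sym I (n + 1)) : Multiset I).toList).map f).prod) := by
        simp
      rw [h3]
      exact Submodule.add_mem_sup (Submodule.subset_span ⟨_, rfl⟩) h2
    · refine le_trans ?_ le_sup_right
      rintro _ ⟨x, hx, rfl⟩
      exact mul_mem_powFil_succ hx i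

end Rings

/-! ### Comparison with commutative power series -/

section PowerSeries

open MvPowerSeries

variable {k E I : Type*} [Field k] [Ring E] [Algebra k E] [Fintype I] {f : I → E}
  {ε : E →ₐ[k] k} (hε : ∀ g, ε g = 0 → ∃ h : I → E, g = ∑ i, f i * h i)
  (hf : ∀ i, ε (f i) = 0) (φ : E →ₐ[k] MvPowerSeries I k) (hφf : ∀ i, φ (f i) = X i)

include hφf in
lemma coeff_eq_zero_of_mem_powFil {n : ℕ} {g : E} (hg : g ∈ powFil k f n) (m : I →₀ ℕ)
    (hm : m.degree < n) : coeff m (φ g) = 0 := by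
  classical
  induction n generalizing g m with
  | zero => exact absurd hm (Nat.not_lt_zero _)
  | succ n ih =>
    obtain ⟨h, hh, rfl⟩ := mem_powFil_succ.1 hg
    rw [map_sum, map_sum]
    refine Finset.sum_eq_zero fun i _ => ?_
    rw [map_mul, hφf, X_def, coeff_monomial_mul]
    split_ifs with hle
    · rw [ih (hh i), mul_zero]
      have : m.degree = (m - Finsupp.single i 1).degree + 1 := by
        conv_lhs => rw [← tsub_add_cancel_of_le hle, map_add, Finsupp.degree_single]
      omega
    · rfl

include hφf in
lemma map_prod_toList (s : Multiset I) [DecidableEq I] :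
    φ ((s.toList.map f).prod) = monomial (Multiset.toFinsupp s) (1 : k) := by
  have : ∀ l : List I, φ ((l.map f).prod) = monomial (Multiset.toFinsupp (l : Multiset I)) (1 : k) := by
    intro l
    induction l with
    | nil => simp
    | cons a l ih =>
      rw [List.map_cons, List.prod_cons, map_mul, ih, hφf, X_def, monomial_mul_monomial, one_mul,
        ← Multiset.cons_coe, ← Multiset.singleton_add, map_add, Multiset.toFinsupp_singleton]
  rw [this, Multiset.coe_toList]

include hε hf hφf in
/-- The kernel of `φ` is contained in all powers. -/
lemma mem_powFil_of_map_eq_zero (hcomm : ∀ i j, f j * f i - f i * f j ∈ powFil k f 3) {g : E}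
    (hg : φ g = 0) (n : ℕ) : g ∈ powFil k f n := by
  classical
  induction n with
  | zero => trivial
  | succ n ih =>
    -- Up to order n + 1, g is a combination of ordered monomials of degree n. Their images are
    -- distinct monomials, so the coefficients are read off from φ g = 0.
    obtain ⟨x, hx, y, hy, rfl⟩ := Submodule.mem_sup.1 (powFil_le hε hf hcomm n ih)
    obtain ⟨c, rfl⟩ := (Submodule.mem_span_range_iff_exists_fun k).1 hx
    suffices hc : ∀ s, c s = 0 by simpa [hc] using hy
    intro s
    have h1 : coeff (Multiset.toFinsupp (s : Multiset I)) (φ y) = 0 := by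
      refine coeff_eq_zero_of_mem_powFil φ hφf hy _ ?_
      have : (Multiset.toFinsupp (s : Multiset I)).degree = n := by
        rw [Finsupp.degree_eq_sum]
        simp [Multiset.toFinsupp_apply]
      omega
    have h2 := congrArg (coeff (Multiset.toFinsupp (s : Multiset I))) hg
    rw [map_add, map_add, h1, add_zero, map_sum, map_sum, Finset.sum_eq_single s] at h2
    · rwa [map_smul, map_prod_toList φ hφf, map_smul, coeff_monomial_same, smul_eq_mul, mul_one,
        map_zero] at h2
    · intro t _ ht
      rw [map_smul, map_prod_toList φ hφf, map_smul, coeff_monomial_ne, smul_zero]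
      exact fun h => ht (Sym.coe_injective (Multiset.toFinsupp.injective h)).symm
    · simp

include hφf in
/-- Symmetric forms extend to functionals on products. -/
lemma mem_relForms_of_isSymm (hφε : ∀ g, constantCoeff (φ g) = ε g) {b : Matrix I I k}
    (hb : b.IsSymm) : b ∈ relForms ε f := by
  classical
  intro h hh
  have h1 := congrArg φ hh
  simp only [map_sum, map_mul, hφf, map_zero] at h1
  rw [← Fintype.sum_prod_type'] at h1
  rw [← Fintype.sum_prod_type' (f := fun i j => b i j * ε (h i j))]
  -- Pairs are grouped by the exponent of X_i X_j. The coefficient of that monomial in the relation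
  -- is the sum of residues over a fibre {(i, j), (j, i)}, on which a symmetric b is constant.
  let e : I × I → (I →₀ ℕ) := fun x => Finsupp.single x.1 1 + Finsupp.single x.2 1
  rw [← Finset.sum_fiberwise_of_maps_to (t := Finset.univ.image e) (g := e)
    (fun x _ => Finset.mem_image_of_mem e (Finset.mem_univ x))]
  refine Finset.sum_eq_zero fun m hm => ?_
  obtain ⟨y, -, rfl⟩ := Finset.mem_image.1 hm
  have hdeg : ∀ x, (e x).degree = 2 := fun x => by simp [e]
  have h2 : ∑ x ∈ Finset.univ.filter (fun x => e x = e y), ε (h x.1 x.2) = 0 := by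
    have h3 := congrArg (coeff (e y)) h1
    rw [map_sum, map_zero] at h3
    refine Eq.trans ?_ h3
    rw [Finset.sum_filter]
    refine Finset.sum_congr rfl fun x _ => ?_
    rw [X_def, X_def, monomial_mul_monomial, mul_one, coeff_monomial_mul]
    change _ = if e x ≤ e y then 1 * coeff (e y - e x) _ else 0
    by_cases hxy : e x = e y
    · rw [if_pos hxy, if_pos hxy.le, hxy, tsub_self, one_mul, ← hφε]
      rfl
    · rw [if_neg hxy, if_neg]
      intro hle
      refine hxy ?_
      have h4 : (e y - e x).degree = 0 := by
        have := congrArg Finsupp.degree (tsub_add_cancel_of_le hle)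
        rw [map_add, hdeg, hdeg] at this
        omega
      rw [Finsupp.degree_eq_zero_iff] at h4
      exact le_antisymm hle (tsub_eq_zero_iff_le.1 h4)
  have h5 : ∀ x ∈ Finset.univ.filter (fun x => e x = e y),
      b x.1 x.2 * ε (h x.1 x.2) = b y.1 y.2 * ε (h x.1 x.2) := by
    intro x hx
    congr 1
    rcases (Finsupp.single_add_single_eq_single_add_single one_ne_zero one_ne_zero).1
      (Finset.mem_filter.1 hx).2 with ⟨h6, h7⟩ | ⟨-, h6, h7⟩ | ⟨h6, -⟩
    · rw [h6, h7]
    · rw [h6, h7, hb.apply]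
    · exact absurd h6 (by norm_num)
  rw [Finset.sum_congr rfl h5, ← Finset.mul_sum, h2, mul_zero]

end PowerSeries

section Generators

variable {O G : Type u} [CommRing O] [Group G] [TopologicalSpace G]
  {P : ObjectProperty (ProAug O G)} [IsDualCat P] {k : Type u} [Field k]
  [Linear k P.FullSubcategory] {A S Q : P.FullSubcategory} {π : A ⟶ Q} {q : Q ⟶ S}

open DualCat

namespace IsFlatFibre

variable {hF : IsFlatFibre k π q}

/-! ### Separatedness -/

section Separated

variable {I : Type} [Fintype I] [DecidableEq I] {f : I → End A}

/-- The sums of the images of the products of `n` members of a family of endomorphisms. -/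
noncomputable def powSub (f : I → End A) : ℕ → A.obj.Sub
  | 0 => ⊤
  | n + 1 => ProAug.Sub.range
      (biproduct.desc fun i => incl A (powSub f n) ≫ End.asHom (f i)).hom

lemma mem_powSub_succ {n : ℕ} {x : A.obj} : x ∈ powSub f (n + 1) ↔
    ∃ p : I → A.obj, (∀ i, p i ∈ powSub f n) ∧ x = ∑ i, app (f i) (p i) := by
  constructor
  · rintro ⟨z, rfl⟩
    refine ⟨fun i => (incl A (powSub f n)).hom ((biproduct.π (fun _ => sub A (powSub f n)) i).hom z),
      fun i => incl_mem _ _, desc_apply _ z⟩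
  · rintro ⟨p, hp, rfl⟩
    choose y hy using fun i => exists_incl_eq (hp i)
    refine ⟨biprodMk y, (desc_biprodMk _ _).trans ?_⟩
    simp only [DualCat.comp_apply, hy]

lemma powSub_succ_le (n : ℕ) : powSub f (n + 1) ≤ powSub f n := by
  induction n with
  | zero => exact fun _ _ => ProAug.Sub.mem_top
  | succ n ih =>
    intro x hx
    obtain ⟨p, hp, rfl⟩ := mem_powSub_succ.1 hx
    exact mem_powSub_succ.2 ⟨p, fun i => ih (hp i), rfl⟩

lemma app_mem_powSub {n : ℕ} {g : End A} (hg : g ∈ powFil k f n) (x : A.obj) :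
    app g x ∈ powSub f n := by
  induction n generalizing g with
  | zero => exact ProAug.Sub.mem_top
  | succ n ih =>
    obtain ⟨h, hh, rfl⟩ := mem_powFil_succ.1 hg
    refine mem_powSub_succ.2 ⟨fun i => app (h i) x, fun i => ih (hh i), ?_⟩
    exact sum_apply _ _ _

/-- Each step of the filtration lies in the radical of the previous one. For n = 0 this holds
because ker π is in the radical of A; pulling μ back along the `f i` lowers n. -/
lemma IsDualGen.apply_eq_zero (hf : hF.IsDualGen f) {S' : P.FullSubcategory} [Simple S'] {n : ℕ}
    (μ : sub A (powSub f n) ⟶ S') {y : (sub A (powSub f n)).obj}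
    (hy : (incl A (powSub f n)).hom y ∈ powSub f (n + 1)) : μ.hom y = 0 := by
  have := hF.simple
  induction n with
  | zero =>
    have : IsIso (incl A (powSub f 0)) := isIso_of_bijective _ (incl_injective _)
      fun x => exists_incl_eq ProAug.Sub.mem_top
    obtain ⟨p, -, hp⟩ := mem_powSub_succ.1 hy
    have h1 := hF.envelope.eq_zero_of_simple (inv (incl A (powSub f 0)) ≫ μ)
      (x := (incl A (powSub f 0)).hom y) (by
        rw [hp, DualCat.map_sum]
        refine Finset.sum_eq_zero fun i _ => ?_
        rw [DualCat.comp_apply, hf.π_app, DualCat.map_zero])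
    rwa [← DualCat.comp_apply, IsIso.hom_inv_id_assoc] at h1
  | succ n ih =>
    obtain ⟨p, hp, hpy⟩ := mem_powSub_succ.1 hy
    have hlift : ∀ i, ∃ l : sub A (powSub f n) ⟶ sub A (powSub f (n + 1)),
        l ≫ incl _ _ = incl _ _ ≫ End.asHom (f i) := fun i =>
      DualCat.exists_lift _ (incl_injective _) _ fun z => exists_incl_eq
        (mem_powSub_succ.2 ⟨Pi.single i ((incl A (powSub f n)).hom z), fun j => by
          by_cases h : j = i
          · subst h; simpa using incl_mem _ z
          · rw [Pi.single_eq_of_ne h]; exact (powSub f n).toSubmodule.zero_mem, by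
          rw [Finset.sum_eq_single i (fun j _ hj => by
            rw [Pi.single_eq_of_ne hj]; exact DualCat.map_zero _) (by simp), Pi.single_eq_same]
          rfl⟩)
    choose l hl using hlift
    choose w hw using fun i => exists_incl_eq (powSub_succ_le n (hp i))
    have hyw : y = ∑ i, (l i).hom (w i) := by
      refine incl_injective _ ?_
      rw [hpy, DualCat.map_sum]
      refine Finset.sum_congr rfl fun i _ => ?_
      rw [← DualCat.comp_apply, hl, DualCat.comp_apply, hw]
    rw [hyw, DualCat.map_sum]
    refine Finset.sum_eq_zero fun i _ => ?_
    rw [← DualCat.comp_apply]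
    refine ih (l i ≫ μ) ?_
    rw [hw]
    exact hp i

/-- In a finite length quotient of A detecting g, the images of `powSub f n` stabilise at a nonzero
U. A simple quotient of U would be zero by `apply_eq_zero`, since U is also the image of the next
step. -/
lemma IsDualGen.eq_zero_of_mem_powFil (hf : hF.IsDualGen f) {g : End A}
    (hg : ∀ n, g ∈ powFil k f n) : g = 0 := by
  by_contra hne
  obtain ⟨x, hx⟩ := exists_ne_zero_of_hom_ne_zero (f := End.asHom g) hne
  obtain ⟨Y, u, hu, hux, -, hY⟩ := exists_finLen_quotient hx
  let U : ℕ → Y.obj.Sub := fun n => ProAug.Sub.range (incl A (powSub f n) ≫ u).hom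
  obtain ⟨V, ⟨n, rfl⟩, hmin⟩ := hY.wf.has_min (Set.range U) ⟨_, 0, rfl⟩
  have hmem : ∀ n z, z ∈ U n ↔ ∃ x ∈ powSub f n, u.hom x = z := fun n z => by
    constructor
    · rintro ⟨y, rfl⟩
      exact ⟨_, incl_mem _ y, rfl⟩
    · rintro ⟨x, hx, rfl⟩
      obtain ⟨y, rfl⟩ := exists_incl_eq hx
      exact ⟨y, rfl⟩
  have hle : U (n + 1) ≤ U n := fun z hz => by
    obtain ⟨x, hx, rfl⟩ := (hmem _ _).1 hz
    exact (hmem _ _).2 ⟨x, powSub_succ_le n hx, rfl⟩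
  have heq : U (n + 1) = U n := by
    by_contra hne
    exact hmin _ ⟨_, rfl⟩ (lt_of_le_of_ne hle hne)
  obtain ⟨t, ht⟩ := DualCat.exists_lift (incl Y (U n)) (incl_injective _)
    (incl A (powSub f n) ≫ u) fun z => exists_incl_eq ⟨z, rfl⟩
  obtain ⟨S', μ, hS', hμ, -⟩ := exists_simple_quotient (0 : sub Y (U n) ⟶ sub Y (U n)) fun h => by
    obtain ⟨y, hy⟩ := exists_incl_eq (U := U n) ((hmem n _).2 ⟨_, app_mem_powSub (hg n) x, rfl⟩)
    obtain ⟨z, hz⟩ := h y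
    refine hux (hy.symm.trans ?_)
    rw [← hz]
    exact DualCat.map_zero _
  refine hμ (DualCat.ext fun y => ?_)
  have hy : (incl Y (U n)).hom y ∈ U (n + 1) := by
    rw [heq]; exact incl_mem _ y
  obtain ⟨x, hx, hxy⟩ := (hmem _ _).1 hy
  obtain ⟨w, rfl⟩ := exists_incl_eq (powSub_succ_le n hx)
  have hyw : y = t.hom w := incl_injective _ (hxy.symm.trans (DualCat.ext_iff.1 ht w).symm)
  rw [hyw, ← DualCat.comp_apply]
  exact hf.apply_eq_zero (t ≫ μ) hx

end Separated

/-! ### Surjections onto power series rings -/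

section Main

open MvPowerSeries

variable {d : ℕ} (φ : End A →ₐ[k] MvPowerSeries (Fin d) k)

/-- An endomorphism of nonzero residue has a right inverse, so its image has nonzero constant
coefficient. Subtracting scalars, the kernel of the residue lies in that of the constant
coefficient, and two characters so related agree. -/
lemma constantCoeff_eq (hF : IsFlatFibre k π q) (g : End A) :
    constantCoeff (φ g) = hF.residue g := by
  have := hF.simple
  have hunit : ∀ g : End A, hF.residue g ≠ 0 → constantCoeff (φ g) ≠ 0 := fun g hg => by
    obtain ⟨s, hs⟩ := hF.envelope.exists_comp_eq (End.asHom g) fun h => hg (by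
      rw [residue_apply, h, map_zero])
    have h1 : g * End.of s = 1 := hs
    intro h0
    have h2 := congrArg (fun x => constantCoeff (φ x)) h1
    simp only [map_mul, h0, zero_mul, map_one] at h2
    exact zero_ne_one h2
  have hzero : ∀ g : End A, hF.residue g = 0 → constantCoeff (φ g) = 0 := fun g hg => by
    by_contra hne
    refine hunit (g - algebraMap k (End A) (constantCoeff (φ g))) ?_ ?_
    · rw [map_sub, hg, zero_sub, AlgHom.commutes]
      exact neg_ne_zero.2 hne
    · rw [map_sub, AlgHom.commutes, map_sub, sub_eq_zero, MvPowerSeries.algebraMap_apply]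
      simp
  have h := hzero (g - algebraMap k (End A) (hF.residue g)) (by
    rw [map_sub, AlgHom.commutes]; exact sub_self _)
  rw [map_sub, AlgHom.commutes, map_sub, sub_eq_zero, MvPowerSeries.algebraMap_apply] at h
  simpa using h

lemma coeff_single_one_mul (a b : MvPowerSeries (Fin d) k) (l : Fin d) :
    coeff (Finsupp.single l 1) (a * b) = coeff (Finsupp.single l 1) a * constantCoeff b +
      constantCoeff a * coeff (Finsupp.single l 1) b := by
  rw [coeff_mul, Finsupp.antidiagonal_single, Finset.sum_map]
  rw [Finset.Nat.sum_antidiagonal_eq_sum_range_succ_mk]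
  simp [Finset.sum_range_succ, add_comm]

/-- Over a flat fibre, dual families can be chosen as lifts of the variables. -/
lemma exists_isDualGen_map_eq_X (hF : IsFlatFibre k π q)
    [Module.Finite k (sub A (kerSub π) ⟶ S)]
    (hd : Module.finrank k (sub A (kerSub π) ⟶ S) = d) (hφ : Function.Surjective φ) :
    ∃ f : Fin d → End A, hF.IsDualGen f ∧ ∀ i, φ (f i) = X i := by
  obtain ⟨f₀, hf₀⟩ := exists_isDualGen (hF := hF) hd
  choose f hf using fun i : Fin d => hφ (X i)
  have hres : ∀ i, hF.residue (f i) = 0 := fun i => by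
    rw [← constantCoeff_eq φ hF, hf, constantCoeff_X]
  choose g hg using fun i => hf₀.exists_eq_sum (hres i)
  -- The Jacobian of `f₀`. Comparing linear coefficients in X_i = φ(∑ `f₀ j * g i j`) shows that it
  -- inverts the residue matrix of `g`.
  let D : Matrix (Fin d) (Fin d) k := Matrix.of fun j l => coeff (Finsupp.single l 1) (φ (f₀ j))
  have hD : Matrix.of (fun i j => hF.residue (g i j)) * D = 1 := by
    ext i l
    have h1 := congrArg (fun x => coeff (Finsupp.single l 1) (φ x)) (hg i)
    simp only [hf, map_sum, map_mul, coeff_single_one_mul, constantCoeff_eq φ hF,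
      hf₀.residue_eq_zero, zero_mul, add_zero, coeff_index_single_X] at h1
    simp only [Matrix.mul_apply, Matrix.of_apply, D, Matrix.one_apply]
    rw [if_congr (eq_comm (a := i)) rfl rfl, h1]
    exact Finset.sum_congr rfl fun j _ => mul_comm _ _
  exact ⟨f, hf₀.of_mul k hg hD (mul_eq_one_comm.1 hD), hf⟩

lemma sum_mul_eq_trace {J : Type*} [Fintype J] (b c : Matrix J J k) :
    ∑ i, ∑ j, b i j * c i j = (b.transpose * c).trace := by
  rw [Finset.sum_comm]
  simp [Matrix.trace, Matrix.mul_apply]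

open Matrix in
-- Under a linear substitution with matrix A, residues of coefficients transform by c ↦ Aᵀ c A; the
-- forms transform dually under the trace pairing tr(bᵀ c).
lemma mem_relForms_of_mul {E I I' : Type*} [Ring E] [Algebra k E] [Fintype I] [Fintype I']
    [DecidableEq I'] {ε : E →ₐ[k] k} {f : I → E} {A : Matrix I' I k} {D : Matrix I I' k}
    (hAD : A * D = 1) {b : Matrix I' I' k} (hb : D * b * Dᵀ ∈ relForms ε f) :
    b ∈ relForms ε fun i => ∑ j, f j * algebraMap k E (A i j) := by
  intro h hh
  let H : Matrix I' I' k := Matrix.of fun i j => ε (h i j)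
  have h1 := hb (fun x y => ∑ i, ∑ j, (A i x * A j y) • h i j) (by
    have e1 : ∀ i j, (∑ x, f x * algebraMap k E (A i x)) * (∑ y, f y * algebraMap k E (A j y)) *
        h i j = ∑ x, ∑ y, f x * f y * ((A i x * A j y) • h i j) := fun i j => by
      rw [Finset.sum_mul_sum, Finset.sum_mul]
      refine Finset.sum_congr rfl fun x _ => ?_
      rw [Finset.sum_mul]
      refine Finset.sum_congr rfl fun y _ => ?_
      simp only [← Algebra.commutes, ← Algebra.smul_def, mul_smul_comm, smul_mul_assoc, smul_smul]
      rw [mul_comm (A j y)]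
    simp only [e1] at hh
    simp only [Finset.mul_sum]
    have e2 : ∀ t : I → I → I' → I' → E, ∑ x, ∑ y, ∑ i, ∑ j, t x y i j =
        ∑ i, ∑ j, ∑ x, ∑ y, t x y i j := fun t => by
      simp only [← Fintype.sum_prod_type']
      let e : I × I × I' × I' ≃ I' × I' × I × I :=
        ⟨fun z => (z.2.2.1, z.2.2.2, z.1, z.2.1), fun z => (z.2.2.1, z.2.2.2, z.1, z.2.1),
          fun _ => rfl, fun _ => rfl⟩
      exact Fintype.sum_equiv e _ (fun x => t x.2.2.1 x.2.2.2 x.1 x.2.1) fun _ => rfl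
    exact (e2 _).trans hh)
  have h2 : (Matrix.of fun x y => ε (∑ i, ∑ j, (A i x * A j y) • h i j)) = Aᵀ * H * A := by
    ext x y
    simp only [Matrix.of_apply, map_sum, map_smul, smul_eq_mul, Matrix.mul_apply,
      Matrix.transpose_apply, H, Finset.sum_mul]
    rw [Finset.sum_comm]
    exact Finset.sum_congr rfl fun i _ => Finset.sum_congr rfl fun j _ => by ring
  have h3 := sum_mul_eq_trace (D * b * Dᵀ) (Matrix.of fun x y => ε (∑ i, ∑ j, (A i x * A j y) • h i j))
  simp only [Matrix.of_apply] at h3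
  rw [h1, h2] at h3
  have h4 := sum_mul_eq_trace b H
  simp only [H, Matrix.of_apply] at h4
  rw [h4]
  have hDA : Dᵀ * Aᵀ = 1 := by rw [← transpose_mul, hAD, transpose_one]
  calc (bᵀ * H).trace = ((A * D) * bᵀ * (Dᵀ * Aᵀ) * H).trace := by
        rw [hAD, hDA, Matrix.one_mul, Matrix.mul_one]
    _ = (A * (D * bᵀ * Dᵀ * Aᵀ * H)).trace := by simp only [Matrix.mul_assoc]
    _ = ((D * bᵀ * Dᵀ * Aᵀ * H) * A).trace := Matrix.trace_mul_comm _ _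
    _ = ((D * b * Dᵀ)ᵀ * (Aᵀ * H * A)).trace := by
        simp only [transpose_mul, transpose_transpose, Matrix.mul_assoc]
    _ = 0 := h3.symm

/-- A surjection from `End A` to a power series ring in `dim Hom(ker π, S)` variables is injective,
if the extensions of `Q` by powers of `Q` have few self-extensions. -/
theorem injective_of_surjective (hF : IsFlatFibre k π q)
    [Module.Finite k (sub A (kerSub π) ⟶ S)]
    (hd : Module.finrank k (sub A (kerSub π) ⟶ S) = d) (hφ : Function.Surjective φ)
    (hbound : ∀ (T : P.FullSubcategory) (i : (⨁ fun _ : Fin (d / 2) => Q) ⟶ T) (t : T ⟶ Q)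
      (w : i ≫ t = 0), (ShortComplex.mk i t w).ShortExact → Module.finrank k (T ⟶ S) = 1 →
      Module.finrank k (Abelian.Ext.{u + 1} T S 1) ≤ d / 2 * (d / 2 - 1) / 2 + d) :
    Function.Injective φ := by
  obtain ⟨f, hf, hφf⟩ := exists_isDualGen_map_eq_X φ hF hd hφ
  have hε : ∀ g, hF.residue g = 0 → ∃ h : Fin d → End A, g = ∑ i, f i * h i :=
    fun g hg => hf.exists_eq_sum hg
  have hsymm : ∀ b ∈ relForms hF.residue f, b.IsSymm := by
    intro b hb
    refine isSymm_of_finrank_le (relForms hF.residue f)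
      (fun b hb => mem_relForms_of_isSymm φ hφf (constantCoeff_eq φ hF) hb) ?_ hb
    intro A' D hAD hDA X hX hX0
    have hres : (Matrix.of (fun i j => hF.residue (algebraMap k (End A) (A' i j)))) = A' := by
      ext i j
      exact AlgHom.commutes hF.residue (A' i j)
    -- The basis adapted to the isotropic subspace is realised by a scalar substitution of the
    -- generators, and T is built from the new family.
    have hf' : hF.IsDualGen fun i => ∑ j, f j * algebraMap k (End A) (A' i j) :=
      hf.of_mul k (fun _ => rfl) (D := D) (by rw [hres, hAD]) (by rw [hres, hDA])
    obtain ⟨i, t, w, hex⟩ := hf'.exists_shortExact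
    obtain ⟨e⟩ := hf'.nonempty_linearEquiv
    have h1 := hbound _ i t w hex hf'.finrank_hom_eq_one
    rw [← e.finrank_eq] at h1
    have h2 := hf'.le_finrank_hom X (fun b hb => mem_relForms_of_mul hAD (hX b hb)) hX0
    rw [Fintype.card_fin] at h2
    exact h2.trans h1
  refine (injective_iff_map_eq_zero φ).2 fun g hg => hf.eq_zero_of_mem_powFil fun n => ?_
  exact mem_powFil_of_map_eq_zero hε hf.residue_eq_zero φ hφf
    (fun i j => commutator_mem hε hf.residue_eq_zero hsymm i j) hg n

end Main

end IsFlatFibre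

end Generators

/-! ### The number of generators -/

section Dimension

variable {O G : Type u} [CommRing O] [Group G] [TopologicalSpace G]
  {P : ObjectProperty (ProAug O G)} [IsDualCat P] {k : Type u} [Field k]
  [Linear k P.FullSubcategory] {A S Q R : P.FullSubcategory} {π : A ⟶ Q} {q : Q ⟶ S}

open DualCat

lemma IsFlatFibre.nonempty_linearEquiv_ext (hF : IsFlatFibre k π q) :
    Nonempty ((sub A (kerSub π) ⟶ S) ≃ₗ[k] Abelian.Ext.{u + 1} Q S 1) := by
  have := hF.simple
  have : Projective (ShortComplex.mk _ _ (incl_comp π)).X₂ := hF.envelope.projective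
  refine nonempty_linearEquiv_ext_one (shortExact_incl π hF.surjective) k fun g => ?_
  refine DualCat.ext fun x => hF.envelope.eq_zero_of_simple g ?_
  exact (congrArg q.hom (apply_incl π x)).trans (DualCat.map_zero q)

/-- N is a quotient of a power of A and Hom(A, R) = 0, so Hom(N, R) = 0 and Ext¹(Q, R) = 0. With
Ext²(Q, R) = 0 this identifies Ext¹(Q, Q) with Ext¹(Q, S). -/
lemma IsFlatFibre.finrank_ext_eq (hF : IsFlatFibre k π q)
    [Module.Finite k (sub A (kerSub π) ⟶ S)] {i : R ⟶ Q} {w : i ≫ q = 0}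
    (hR : (ShortComplex.mk i q w).ShortExact) (H5 : Subsingleton (Abelian.Ext.{u + 1} Q R 2)) :
    Module.finrank k (sub A (kerSub π) ⟶ S) =
      Module.finrank k (Abelian.Ext.{u + 1} Q Q 1) := by
  have hi : Mono i := hR.mono_f
  have hN : ∀ g : sub A (kerSub π) ⟶ R, g = 0 := fun g => by
    obtain ⟨f, a, e, -, hae⟩ := IsFlatFibre.exists_isDualGen (hF := hF) rfl
    have := epi_of_surjective _ (IsFlatFibre.surjective_desc hae hF)
    rw [← cancel_epi (biproduct.desc a), comp_zero]
    refine biproduct.hom_ext' _ _ fun j => ?_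
    rw [comp_zero, ← cancel_mono i, zero_comp]
    refine hF.eq_zero _ ?_
    rw [Category.assoc, Category.assoc, w, comp_zero, comp_zero]
  have : Projective (ShortComplex.mk _ _ (incl_comp π)).X₂ := hF.envelope.projective
  have h1 : Subsingleton (Abelian.Ext.{u + 1} Q R 1) :=
    subsingleton_ext_one (shortExact_incl π hF.surjective) hN
  obtain ⟨e₁⟩ := hF.nonempty_linearEquiv_ext
  obtain ⟨e₂⟩ := nonempty_linearEquiv_ext_of_subsingleton hR k Q 1 h1 H5
  exact (e₁.trans e₂.symm).finrank_eq

end Dimension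

/-! ### Reduction modulo ϖ -/

section Reduction

variable {O G : Type u} [CommRing O] [Group G] [TopologicalSpace G]
  {P : ObjectProperty (ProAug O G)} [IsDualCat P] {ϖ : O}

open DualCat

namespace DualCatMod

/-- An object of the subcategory killed by `ϖ`, as an object of that subcategory. -/
def mk (X : DualCat P) (hX : ∀ x : X.obj, ϖ • x = 0) : DualCatMod P ϖ := ⟨X.obj, X.property, hX⟩

variable (ϖ) in
/-- The reduction `X / ϖ X`. -/
noncomputable def red (X : DualCat P) : DualCatMod P ϖ :=
  mk (quot X (ProAug.Sub.range (ϖ • 𝟙 X : X ⟶ X).hom)) fun x => by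
    obtain ⟨x, rfl⟩ := proj_surjective _ x
    rw [← DualCat.map_smul]
    exact proj_eq_zero.2 ⟨x, rfl⟩

variable (ϖ) in
/-- The projection onto the reduction. -/
noncomputable def toRed (X : DualCat P) : X ⟶ (incl P ϖ).obj (red ϖ X) := proj X _

lemma toRed_surjective (X : DualCat P) : Function.Surjective (toRed ϖ X).hom := proj_surjective _

lemma toRed_eq_zero {X : DualCat P} {x : X.obj} :
    (toRed ϖ X).hom x = 0 ↔ ∃ y, ϖ • y = x := proj_eq_zero

lemma exists_desc_red {X : DualCat P} {Y : DualCatMod P ϖ} (f : X ⟶ (incl P ϖ).obj Y) :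
    ∃ g : red ϖ X ⟶ Y, toRed ϖ X ≫ (incl P ϖ).map g = f := by
  obtain ⟨g, hg⟩ := exists_desc (toRed ϖ X) (toRed_surjective X) f fun x hx => by
    obtain ⟨y, rfl⟩ := toRed_eq_zero.1 hx
    rw [DualCat.map_smul]
    exact Y.property.2 _
  exact ⟨ObjectProperty.homMk g.hom, hg⟩

lemma red_hom_ext {X : DualCat P} {Y : DualCatMod P ϖ} {f g : red ϖ X ⟶ Y}
    (h : toRed ϖ X ≫ (incl P ϖ).map f = toRed ϖ X ≫ (incl P ϖ).map g) : f = g := by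
  refine DualCat.ext fun x => ?_
  obtain ⟨x, rfl⟩ := toRed_surjective X x
  exact DualCat.ext_iff.1 h x

lemma simple_incl (S : DualCatMod P ϖ) [Simple S] : Simple ((incl P ϖ).obj S) where
  mono_isIso_iff_nonzero {W} f _ := by
    let W' : DualCatMod P ϖ := mk W fun x => injective_of_mono f (by
      rw [DualCat.map_smul, DualCat.map_zero]
      exact S.property.2 _)
    let f' : W' ⟶ S := ObjectProperty.homMk f.hom
    have hf' : Mono f' := mono_of_injective f' (injective_of_mono f)
    have h0 : f' = 0 ↔ f = 0 :=
      (DualCat.ext_iff (f := f') (g := 0)).trans (DualCat.ext_iff (f := f) (g := 0)).symm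
    rw [Ne, ← h0, ← Ne, ← Simple.mono_isIso_iff_nonzero f']
    exact ⟨fun h => isIso_of_bijective f' (injective_of_mono f) (surjective_of_epi f),
      fun h => isIso_of_bijective f (injective_of_mono f) (surjective_of_epi f')⟩

/-- The reduction of a projective envelope is a projective envelope. -/
lemma isProjectiveEnvelope_red {A : DualCat P} {S : DualCatMod P ϖ} {κ : A ⟶ (incl P ϖ).obj S}
    (hκ : IsProjectiveEnvelope κ) {κ' : red ϖ A ⟶ S}
    (hκ' : toRed ϖ A ≫ (incl P ϖ).map κ' = κ) : IsProjectiveEnvelope κ' where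
  projective := ⟨fun {X Y} f e _ => by
    have := hκ.projective
    have : Epi ((incl P ϖ).map e) := epi_of_surjective _ (surjective_of_epi e)
    obtain ⟨l, hl⟩ := exists_desc_red
      (Projective.factorThru (toRed ϖ A ≫ (incl P ϖ).map f) ((incl P ϖ).map e))
    refine ⟨l, red_hom_ext ?_⟩
    rw [Functor.map_comp, ← Category.assoc, hl, Projective.factorThru_comp]⟩
  epi := epi_of_surjective _ fun y => by
    have := hκ.epi
    obtain ⟨x, rfl⟩ := surjective_of_epi κ y
    exact ⟨(toRed ϖ A).hom x, DualCat.ext_iff.1 hκ' x⟩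
  essential {W} s hs := by
    -- The preimage in A of the image of s still surjects onto S, so essentiality of κ makes it all
    -- of A.
    let V : A.obj.Sub := ProAug.Sub.comap (toRed ϖ A).hom (ProAug.Sub.range s.hom)
    have h1 : Epi (DualCat.incl A V ≫ κ) := epi_of_surjective _ fun y => by
      obtain ⟨z, rfl⟩ := surjective_of_epi (s ≫ κ') y
      obtain ⟨x, hx⟩ := toRed_surjective A (s.hom z)
      obtain ⟨v, hv⟩ := exists_incl_eq (U := V) (x := x) ⟨z, hx.symm⟩
      refine ⟨v, ?_⟩
      rw [DualCat.comp_apply, hv, ← hκ', DualCat.comp_apply, hx]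
      rfl
    have := hκ.essential _ h1
    refine epi_of_surjective s fun y => ?_
    obtain ⟨x, rfl⟩ := toRed_surjective A y
    obtain ⟨v, rfl⟩ := surjective_of_epi (DualCat.incl A V) x
    exact incl_mem V v

/-- An endomorphism of the projective envelope of an object killed by `ϖ` which is divisible by all
powers of `ϖ` vanishes. -/
lemma eq_zero_of_forall_dvd {A : DualCat P} {S : DualCatMod P ϖ} [Simple S]
    {κ : A ⟶ (incl P ϖ).obj S} (hκ : IsProjectiveEnvelope κ) {g : A ⟶ A}
    (hg : ∀ n : ℕ, ∃ h : A ⟶ A, g = ϖ ^ n • h) : g = 0 := by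
  have := simple_incl S
  by_contra hne
  obtain ⟨x, hx⟩ := exists_ne_zero_of_hom_ne_zero hne
  obtain ⟨Y, v, hv, hvx, -, hY⟩ := exists_finLen_quotient hx
  let U : ℕ → Y.obj.Sub := fun n => ProAug.Sub.range (ϖ ^ n • v).hom
  obtain ⟨V, ⟨n, rfl⟩, hmin⟩ := hY.wf.has_min (Set.range U) ⟨_, 0, rfl⟩
  have hpow : ∀ n x, (ϖ ^ n • v).hom x = v.hom (ϖ ^ n • x) := fun n x =>
    (DualCat.map_smul v _ x).symm
  have hle : U (n + 1) ≤ U n := by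
    rintro _ ⟨x, rfl⟩
    refine ⟨ϖ • x, ?_⟩
    change (ϖ ^ n • v).hom (ϖ • x) = (ϖ ^ (n + 1) • v).hom x
    rw [hpow, hpow, smul_smul, pow_succ]
  have heq : U (n + 1) = U n := by
    by_contra hne
    exact hmin _ ⟨_, rfl⟩ (lt_of_le_of_ne hle hne)
  obtain ⟨t, ht⟩ := DualCat.exists_lift (DualCat.incl Y (U n)) (incl_injective _)
    (ϖ ^ n • v) fun z => exists_incl_eq ⟨z, rfl⟩
  have hts : Function.Surjective t.hom := fun y => by
    obtain ⟨z, hz⟩ := incl_mem (U n) y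
    exact ⟨z, incl_injective _ ((DualCat.ext_iff.1 ht z).trans hz)⟩
  obtain ⟨S', μ, hS', hμ, -⟩ := exists_simple_quotient (0 : sub Y (U n) ⟶ sub Y (U n)) fun h => by
    obtain ⟨h', hh'⟩ := hg n
    have hmem : v.hom (g.hom x) ∈ U n := ⟨h'.hom x, by rw [hh']; exact hpow n _⟩
    obtain ⟨y, hy⟩ := exists_incl_eq hmem
    obtain ⟨z, hz⟩ := h y
    refine hvx (hy.symm.trans ?_)
    rw [← hz]
    exact DualCat.map_zero _
  have htμ : t ≫ μ ≠ 0 := fun h => hμ (by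
    have := epi_of_surjective t hts
    rw [← cancel_epi t, h, comp_zero])
  -- The simple quotient of U n is also a quotient of A, hence isomorphic to S and killed by ϖ; but
  -- U n = ϖ U n.
  obtain ⟨e, -⟩ := hκ.exists_iso htμ
  have hkill : ∀ s : S'.obj, ϖ • s = 0 := fun s => by
    have h1 : s = e.hom.hom (e.inv.hom s) := by
      rw [← DualCat.comp_apply, e.inv_hom_id]; rfl
    rw [h1, ← DualCat.map_smul]
    exact (congrArg e.hom.hom (S.property.2 _)).trans (DualCat.map_zero _)
  refine hμ (DualCat.ext fun y => ?_)
  have hy : (DualCat.incl Y (U n)).hom y ∈ U (n + 1) := by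
    rw [heq]; exact incl_mem _ y
  obtain ⟨z, hz⟩ := hy
  have hyz : y = t.hom (ϖ • z) := by
    refine incl_injective _ (hz.symm.trans ?_)
    rw [← DualCat.comp_apply, ht]
    change (ϖ ^ (n + 1) • v).hom z = _
    rw [hpow, hpow, smul_smul, pow_succ]
  rw [hyz, DualCat.map_smul, DualCat.map_smul, hkill]
  rfl

end DualCatMod

end Reduction

/-! ### Endomorphism rings under reduction -/

section ReductionHom

variable {O G : Type u} [CommRing O] [Group G] [TopologicalSpace G]
  {P : ObjectProperty (ProAug O G)} [IsDualCat P] {ϖ : O}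

open DualCat

namespace DualCatMod

/-- The map g lands in ϖX, and projectivity lifts it along the surjection ϖ : X → ϖX. -/
lemma exists_eq_smul_of_comp_toRed {A X : DualCat P} [Projective A] {g : A ⟶ X}
    (hg : g ≫ toRed ϖ X = 0) : ∃ h : A ⟶ X, g = ϖ • h := by
  let U : X.obj.Sub := ProAug.Sub.range (ϖ • 𝟙 X : X ⟶ X).hom
  obtain ⟨t, ht⟩ := DualCat.exists_lift (DualCat.incl X U) (incl_injective _)
    (ϖ • 𝟙 X) fun z => exists_incl_eq ⟨z, rfl⟩
  obtain ⟨l, hl⟩ := DualCat.exists_lift (DualCat.incl X U) (incl_injective _) g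
    fun z => exists_incl_eq (proj_eq_zero.1 (DualCat.ext_iff.1 hg z))
  have : Epi t := epi_of_surjective t fun y => by
    obtain ⟨z, hz⟩ := incl_mem U y
    exact ⟨z, incl_injective _ ((DualCat.ext_iff.1 ht z).trans hz)⟩
  refine ⟨Projective.factorThru l t, ?_⟩
  rw [← hl, ← Projective.factorThru_comp l t, Category.assoc, ht, Linear.comp_smul,
    Category.comp_id, Projective.factorThru_comp]

/-- An algebra homomorphism from the endomorphisms of a projective object to an algebra killed by
`ϖ` factors through the endomorphisms of the reduction. -/
lemma exists_algHom_red {A : DualCat P} [Projective A] {B : Type u} [Ring B] [Algebra O B]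
    [Algebra (O ⧸ Ideal.span {ϖ}) B] [IsScalarTower O (O ⧸ Ideal.span {ϖ}) B]
    (ψ : End A →ₐ[O] B) :
    ∃ ψ' : End (red ϖ A) →ₐ[O ⧸ Ideal.span {ϖ}] B, ∀ (g : A ⟶ A) (h : red ϖ A ⟶ red ϖ A),
      g ≫ toRed ϖ A = toRed ϖ A ≫ (incl P ϖ).map h → ψ' h = ψ g := by
  have hker : ∀ g : A ⟶ A, g ≫ toRed ϖ A = 0 → ψ g = 0 := fun g hg => by
    obtain ⟨h, rfl⟩ := exists_eq_smul_of_comp_toRed hg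
    refine (_root_.map_smul ψ ϖ (h : End A)).trans ?_
    rw [← algebraMap_smul (O ⧸ Ideal.span {ϖ}) ϖ (ψ h), Ideal.Quotient.algebraMap_eq,
      Ideal.Quotient.eq_zero_iff_mem.2 (Ideal.mem_span_singleton_self ϖ), zero_smul]
  have : Epi (toRed ϖ A) := epi_of_surjective _ (toRed_surjective A)
  choose lift hlift using fun h : red ϖ A ⟶ red ϖ A =>
    (⟨Projective.factorThru (toRed ϖ A ≫ (incl P ϖ).map h) (toRed ϖ A),
      Projective.factorThru_comp _ _⟩ :
      ∃ g : A ⟶ A, g ≫ toRed ϖ A = toRed ϖ A ≫ (incl P ϖ).map h)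
  have key : ∀ (g : A ⟶ A) (h : red ϖ A ⟶ red ϖ A),
      g ≫ toRed ϖ A = toRed ϖ A ≫ (incl P ϖ).map h → ψ (lift h) = ψ g := fun g h hg => by
    refine sub_eq_zero.1 ((_root_.map_sub ψ (lift h) g).symm.trans (hker _ ?_))
    rw [Preadditive.sub_comp, hlift, hg, sub_self]
  refine ⟨{ toFun := fun h => ψ (lift h)
            map_one' := ?_
            map_mul' := fun x y => ?_
            map_zero' := ?_
            map_add' := fun x y => ?_
            commutes' := fun c => ?_ }, fun g h hg => key g h hg⟩
  · refine (key (𝟙 A) (𝟙 _) ?_).trans (_root_.map_one ψ)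
    rw [CategoryTheory.Functor.map_id, Category.id_comp, Category.comp_id]
  · refine (key (lift y ≫ lift x) (y ≫ x) ?_).trans (_root_.map_mul (M := End A) ψ _ _)
    rw [Category.assoc, hlift, ← Category.assoc, hlift, Category.assoc, Functor.map_comp]
  · refine (key 0 0 ?_).trans (_root_.map_zero ψ)
    rw [zero_comp]
    exact DualCat.ext fun x => rfl
  · refine (key (lift x + lift y) (x + y) ?_).trans (_root_.map_add ψ (lift x) (lift y))
    rw [Preadditive.add_comp, hlift, hlift]
    exact DualCat.ext fun x => rfl
  · obtain ⟨a, rfl⟩ := Ideal.Quotient.mk_surjective c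
    rw [Algebra.algebraMap_eq_smul_one]
    refine (key (a • 𝟙 A) (Ideal.Quotient.mk _ a • 𝟙 _) ?_).trans ?_
    · rw [Linear.smul_comp, Category.id_comp]
      exact DualCat.ext fun x => rfl
    · refine (_root_.map_smul ψ a (1 : End A)).trans ?_
      rw [_root_.map_one, ← Ideal.Quotient.algebraMap_eq, ← IsScalarTower.algebraMap_apply,
        Algebra.algebraMap_eq_smul_one]

/-- Injectivity of a homomorphism to a power series ring can be checked on the reduction. -/
lemma injective_of_injective_red [IsDomain O] (hϖ : ϖ ≠ 0) {A : DualCat P} {S : DualCatMod P ϖ}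
    [Simple S] {κ : A ⟶ (incl P ϖ).obj S} (hκ : IsProjectiveEnvelope κ) {d : ℕ}
    {φ : End A →ₐ[O] MvPowerSeries (Fin d) O} (hφ : Function.Surjective φ)
    (h : ∀ ψ : End (red ϖ A) →ₐ[O ⧸ Ideal.span {ϖ}] MvPowerSeries (Fin d) (O ⧸ Ideal.span {ϖ}),
      Function.Surjective ψ → Function.Injective ψ) : Function.Injective φ := by
  have := hκ.projective
  let m : MvPowerSeries (Fin d) O →ₐ[O] MvPowerSeries (Fin d) (O ⧸ Ideal.span {ϖ}) :=
    MvPowerSeries.mapAlgHom (Ideal.Quotient.mkₐ O (Ideal.span {ϖ}))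
  have hm : Function.Surjective m := fun b =>
    ⟨fun n => (Ideal.Quotient.mk_surjective (b n)).choose,
      funext fun n => (Ideal.Quotient.mk_surjective (b n)).choose_spec⟩
  obtain ⟨ψ, hψ⟩ := exists_algHom_red (ϖ := ϖ) (m.comp φ)
  have hψs : Function.Surjective ψ := fun b => by
    obtain ⟨g, hg⟩ := (hm.comp hφ) b
    obtain ⟨h, hh⟩ := exists_desc_red (ϖ := ϖ) (X := A) (Y := red ϖ A) (g ≫ toRed ϖ A)
    exact ⟨h, (hψ g h hh.symm).trans hg⟩
  -- Injectivity of ψ makes g divisible by ϖ, and the quotient is again in ker φ since power series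
  -- over the domain O have no ϖ-torsion.
  have step : ∀ g : End A, φ g = 0 → ∃ g' : End A, φ g' = 0 ∧ g = ϖ • g' := fun g hg => by
    obtain ⟨g', hg'⟩ := exists_desc_red (ϖ := ϖ) (X := A) (Y := red ϖ A) (g ≫ toRed ϖ A)
    have h0 : ψ g' = ψ 0 := by
      rw [hψ g g' hg'.symm, _root_.map_zero]
      exact (congrArg m hg).trans (_root_.map_zero m)
    have h1 : g' = 0 := h ψ hψs h0
    obtain ⟨t, ht⟩ := exists_eq_smul_of_comp_toRed (ϖ := ϖ) (g := g) (by
      rw [← hg', h1]; exact DualCat.ext fun x => rfl)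
    refine ⟨t, ?_, ht⟩
    have h2 : ϖ • φ t = 0 := (_root_.map_smul φ ϖ (t : End A)).symm.trans (ht ▸ hg)
    funext n
    exact (mul_eq_zero.1 (congrFun h2 n)).resolve_left hϖ
  refine (injective_iff_map_eq_zero φ).2 fun g hg => eq_zero_of_forall_dvd hκ fun n => ?_
  suffices ∃ g' : End A, φ g' = 0 ∧ g = ϖ ^ n • g' from ⟨this.choose, this.choose_spec.2⟩
  induction n with
  | zero => exact ⟨g, hg, by rw [pow_zero, one_smul]⟩
  | succ n ih =>
    obtain ⟨t, ht, rfl⟩ := ih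
    obtain ⟨t', ht', rfl⟩ := step t ht
    exact ⟨t', ht', by rw [smul_smul, pow_succ]⟩

end DualCatMod

end ReductionHom

/-! ### The residue field -/

section ResidueField

variable {O G : Type u} [CommRing O] [Group G] [TopologicalSpace G]
  {P : ObjectProperty (ProAug O G)} [IsDualCat P] {ϖ : O}

/-- Schur's lemma: a nonzero scalar acts invertibly on S, and its inverse is again a scalar. -/
lemma DualCatMod.isField_of_bijective {S : DualCatMod P ϖ} (hS : Simple S)
    (hEnd : Function.Bijective (algebraMap (O ⧸ Ideal.span {ϖ}) (End S))) :
    IsField (O ⧸ Ideal.span {ϖ}) where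
  exists_pair_ne := by
    refine ⟨0, 1, fun h => Simple.not_isZero S ((IsZero.iff_id_eq_zero S).2 ?_)⟩
    have := congrArg (algebraMap (O ⧸ Ideal.span {ϖ}) (End S)) h
    rw [map_zero, map_one] at this
    exact this.symm
  mul_comm := mul_comm
  mul_inv_cancel {a} ha := by
    let f : S ⟶ S := algebraMap (O ⧸ Ideal.span {ϖ}) (End S) a
    have hf : f ≠ 0 := fun h => ha (hEnd.1 (h.trans (map_zero _).symm))
    have := isIso_of_hom_simple hf
    obtain ⟨b, hb⟩ := hEnd.2 (inv f)
    refine ⟨b, hEnd.1 ?_⟩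
    rw [map_mul, map_one, hb]
    exact IsIso.inv_hom_id f

end ResidueField

theorem mainTheorem12
    {p : ℕ} [Fact p.Prime]
    {L : Type u} [Field L] [Algebra ℚ_[p] L] [FiniteDimensional ℚ_[p] L]
    [Algebra ℤ_[p] L] [IsScalarTower ℤ_[p] ℚ_[p] L]
    {G : Type u} [Group G] [TopologicalSpace G] [IsTopologicalGroup G] (hG : IsLocallyProP p G)
    -- `O = integralClosure ℤ_[p] L` is the ring of integers, `ϖ` a uniformizer, `k = O/(ϖ)`
    (ϖ : integralClosure ℤ_[p] L) (hϖ : Irreducible ϖ)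
    -- the categories `C(O) = DualCat P` and `C(k) = DualCatMod P ϖ`
    (P : ObjectProperty (ProAug (integralClosure ℤ_[p] L) G)) [IsDualCat P]
    -- the irreducible object `S` with `End(S) = k` and its projective envelope in `C(O)`
    (S : DualCatMod P ϖ) (hS : Simple S)
    (hEndS : Function.Bijective
      (algebraMap (integralClosure ℤ_[p] L ⧸ Ideal.span {ϖ}) (End S)))
    (Pt : DualCat P) (κ : Pt ⟶ (DualCatMod.incl P ϖ).obj S) (hκ : IsProjectiveEnvelope κ)
    -- the object `Q` of finite length and `R = rad Q`
    (Q : DualCatMod P ϖ) (hQ : IsFiniteLengthObject Q)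
    (R : Subobject Q) (hR : IsRadicalOf R)
    -- the hypotheses (H0)-(H5)
    (H0 : ∀ f : kernel (ϖ • 𝟙 Pt) ⟶ (DualCatMod.incl P ϖ).obj (R : DualCatMod P ϖ), f = 0)
    (H1 : ∀ S' : DualCatMod P ϖ, Simple S' → IsEmpty (S ≅ S') → ∀ f : Q ⟶ S', f = 0)
    (H2 : HasMultiplicity S Q 1)
    (H3 : ∀ S' : DualCatMod P ϖ, Simple S' → IsEmpty (S ≅ S') →
      Subsingleton (Abelian.Ext.{u + 1} Q S' 1))
    (H4 : Module.Finite (integralClosure ℤ_[p] L ⧸ Ideal.span {ϖ}) (Abelian.Ext.{u + 1} Q S 1))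
    (H5 : Subsingleton (Abelian.Ext.{u + 1} Q (R : DualCatMod P ϖ) 2))
    (d r : ℕ)
    (hd : d = Module.finrank (integralClosure ℤ_[p] L ⧸ Ideal.span {ϖ})
      (Abelian.Ext.{u + 1} Q Q 1))
    (hr : r = d / 2)
    (hsurj : ∃ φ : End Pt →ₐ[integralClosure ℤ_[p] L]
      MvPowerSeries (Fin d) (integralClosure ℤ_[p] L), Function.Surjective φ)
    (hbound : ∀ (T : DualCatMod P ϖ) (i : (⨁ fun _ : Fin r => Q) ⟶ T) (q : T ⟶ Q) (w : i ≫ q = 0),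
      (ShortComplex.mk i q w).ShortExact →
      Module.finrank (integralClosure ℤ_[p] L ⧸ Ideal.span {ϖ}) (T ⟶ S) = 1 →
      Module.finrank (integralClosure ℤ_[p] L ⧸ Ideal.span {ϖ}) (Abelian.Ext.{u + 1} T S 1)
        ≤ r * (r - 1) / 2 + d) :
    Nonempty (End Pt ≃ₐ[integralClosure ℤ_[p] L]
      MvPowerSeries (Fin d) (integralClosure ℤ_[p] L)) ∧
    ∀ x y : End Pt, x * y = y * x := by
  have : (Ideal.span {ϖ}).IsMaximal :=
    Ideal.Quotient.maximal_of_isField _ (DualCatMod.isField_of_bijective hS hEndS)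
  let _ := Ideal.Quotient.field (Ideal.span {ϖ})
  have hEnd (v : S ⟶ S) : ∃ c : integralClosure ℤ_[p] L ⧸ Ideal.span {ϖ}, v = c • 𝟙 S := by
    obtain ⟨c, hc⟩ := hEndS.2 v
    exact ⟨c, hc.symm.trans (Algebra.algebraMap_eq_smul_one c)⟩
  obtain ⟨κ', hκ'⟩ := DualCatMod.exists_desc_red κ
  have hκA := DualCatMod.isProjectiveEnvelope_red hκ hκ'
  obtain ⟨π, q, hπq, hπ, h0, hspan⟩ := exists_factorization hκA hEnd H1 H2
  have hq : q ≠ 0 := fun h => hκA.ne_zero (by rw [← hπq, h, comp_zero])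
  obtain ⟨w, hRq⟩ := IsRadicalOf.shortExact H1 hR hq hspan
  have hF := isFlatFibre hκA hEnd hπq hπ h0 hRq H3 H5
  obtain ⟨e⟩ := hF.nonempty_linearEquiv_ext
  have : Module.Finite (integralClosure ℤ_[p] L ⧸ Ideal.span {ϖ})
      (DualCat.sub (DualCatMod.red ϖ Pt) (DualCat.kerSub π) ⟶ S) := Module.Finite.equiv e.symm
  -- The number of variables equals the number of generators of ker π.
  have hd' := (hF.finrank_ext_eq hRq H5).trans hd.symm
  subst hr
  obtain ⟨φ, hφ⟩ := hsurj
  have hinj : Function.Injective φ :=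
    DualCatMod.injective_of_injective_red hϖ.ne_zero hκ hφ fun ψ hψ =>
      hF.injective_of_surjective ψ hd' hψ hbound
  exact ⟨⟨AlgEquiv.ofBijective φ ⟨hinj, hφ⟩⟩, fun x y => hinj (by
    rw [map_mul, map_mul, mul_comm])⟩
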